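/- Let $\mathbb H^3=\{(x,y,z)\in\mathbb R^3: z>0\}$ be the upper half-space model of hyperbolic space, with the metric $\langle\cdot,\cdot\rangle=z^{-2}(dx^2+dy^2+dz^2)$. A horo-shrinker is a smooth immersed surface in $\mathbb H^3$, oriented by a unit normal field $N$, whose (hyperbolic) mean curvature $H$, half the trace of the second fundamental form with respect to $N$, satisfies $H=\langle N,\partial_z\rangle$. It is called (spherical) rotational if it is connected and its image in $\mathbb H^3$ is invariant under all the rotations $(x,y,z)\mapsto(x\cos t-y\sin t,\,x\sin t+y\cos t,\,z)$, $t\in\mathbb R$, about the rotation axis $\{(0,0,z):z>0\}$. Surfaces are identified with their images, and a rotational horo-shrinker is called maximal if it is not a proper subset of another rotational horo-shrinker. Let $\mathsf H_1=\{z=1\}$. For $z_0>0$ let $\mathcal B(z_0)$ be the surface $z=u(r)$, $r=\sqrt{x^2+y^2}$, generated by the maximal positive $C^2$ solution $u$ on an interval $[0,r_{\max})$ of $$\frac{u''}{1+u'^2}+\frac{u'}{r}=2\,\frac{1-u}{u^2}\quad (r>0),\qquad u(0)=z_0,\quad u'(0)=0 .$$ **Theorem.** Every rotational horo-shrinker that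 meets the rotation axis is contained in $\mathcal B(z_0)$ for exactly one $z_0>0$. The maximal rotational horo-shrinkers that meet the rotation axis are exactly the surfaces $\mathcal B(z_0)$, $z_0>0$, and $\mathcal B(z_0)$ meets the axis exactly at the point $(0,0,z_0)$. For every $z_0>0$ the solution $u$ is defined on all of $[0,\infty)$, that is, $\mathcal B(z_0)$ is an entire graph $z=u(\sqrt{x^2+y^2})$ over the plane. If $z_0\neq1$, it oscillates around $\mathsf H_1$: there are $0=\rho_0<\rho_1<\rho_2<\cdots\to\infty$ such that $u$ is strictly monotone on each $[\rho_n,\rho_{n+1}]$ and the values $u(\rho_n)$ lie alternately strictly below and strictly above $1$. Furthermore: 1. $\mathcal B(1)=\mathsf H_1$. 2. If $0<z_0<1$, then $\mathcal B(z_0)$ is strictly convex at $r=0$: $u''(0)>0$ and $u$ is strictly convex on some interval $[0,\varepsilon)$, $\varepsilon>0$. 3. If $z_0>1$, then $\mathcal B(z_0)$ is strictly concave at $r=0$: $u''(0)<0$ and $u$ is strictly concave on some interval $[0,\varepsilon)$, $\varepsilon>0$. -/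

import Mathlib

open Set Filter Topology
open scoped Manifold ContDiff

namespace Horo

/-- The coordinate plane on which surfaces are modelled. -/
abbrev Plane := EuclideanSpace ℝ (Fin 2)

/-- Euclidean three-space with coordinates `(x, y, z) = (p 0, p 1, p 2)`. Hyperbolic space is its
open upper half-space `0 < p 2`, with the metric `hypInner`. -/
abbrev Space := EuclideanSpace ℝ (Fin 3)

/-- The hyperbolic metric `⟨v, w⟩ = ⟨v, w⟩_e / z ^ 2` of the upper half-space, at the point `p`. -/
noncomputable def hypInner (p v w : Space) : ℝ := inner ℝ v w / p 2 ^ 2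

/-- The coordinate vector field `∂_z`. -/
noncomputable def dz : Space := !₂[0, 0, 1]

/-- The Christoffel symbols of the hyperbolic metric, as a bilinear map at the point `p`: the
Levi-Civita connection is `∇_V W = D_V W + christoffel p V W`, with `D` the flat connection.
It is symmetric in `v, w` (no torsion), and `∇` is metric because
`⟨christoffel p u v, w⟩ + ⟨v, christoffel p u w⟩ = -(2 u_z / z) ⟨v, w⟩`. -/
noncomputable def christoffel (p v w : Space) : Space :=
  (p 2)⁻¹ • (inner ℝ v w • dz - v 2 • w - w 2 • v)

/-- The partial derivative `∂_i X` of a parametrization. -/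
noncomputable def partialD (X : Plane → Space) (i : Fin 2) (a : Plane) : Space :=
  fderiv ℝ X a (EuclideanSpace.single i 1)

/-- The first fundamental form `g_ij = ⟨∂_i X, ∂_j X⟩` for the hyperbolic metric. -/
noncomputable def firstForm (X : Plane → Space) (a : Plane) (i j : Fin 2) : ℝ :=
  hypInner (X a) (partialD X i a) (partialD X j a)

/-- The second fundamental form `h_ij = ⟨∇_{∂_i X} ∂_j X, n⟩` for the hyperbolic metric, with
respect to the unit normal vector `n` at `X a`. -/
noncomputable def secondForm (X : Plane → Space) (n : Space) (a : Plane) (i j : Fin 2) : ℝ :=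
  hypInner (X a)
    (partialD (partialD X j) i a + christoffel (X a) (partialD X i a) (partialD X j a)) n

/-- The hyperbolic mean curvature `H = (1/2) ∑ g^{ij} h_ij` of a parametrized surface. -/
noncomputable def paramMeanCurvature (X : Plane → Space) (n : Space) (a : Plane) : ℝ :=
  (firstForm X a 1 1 * secondForm X n a 0 0 - 2 * firstForm X a 0 1 * secondForm X n a 0 1
      + firstForm X a 0 0 * secondForm X n a 1 1) /
    (2 * (firstForm X a 0 0 * firstForm X a 1 1 - firstForm X a 0 1 ^ 2))

/-- The hyperbolic mean curvature at `p` of an immersed surface `Ψ : M → ℍ³` with unit normal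
field `N`, computed in the preferred chart at `p`. -/
noncomputable def meanCurvature {M : Type*} [TopologicalSpace M] [ChartedSpace Plane M]
    (Ψ N : M → Space) (p : M) : ℝ :=
  paramMeanCurvature (Ψ ∘ (chartAt Plane p).symm) (N p) (chartAt Plane p p)

/-- `Ψ : M → ℍ³` is a smooth immersion of a surface, oriented by the smooth (hyperbolic) unit normal
field `N`, whose mean curvature satisfies `H = ⟨N, ∂_z⟩`. -/
structure IsHoroShrinker {M : Type*} [TopologicalSpace M] [ChartedSpace Plane M]
    (Ψ N : M → Space) : Prop where
  smooth : ContMDiff (𝓡 2) 𝓘(ℝ, Space) ∞ Ψ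
  pos : ∀ p, 0 < Ψ p 2
  immersion : ∀ p, Function.Injective (mfderiv (𝓡 2) 𝓘(ℝ, Space) Ψ p)
  smooth_normal : ContMDiff (𝓡 2) 𝓘(ℝ, Space) ∞ N
  normal : ∀ p v, hypInner (Ψ p) (mfderiv (𝓡 2) 𝓘(ℝ, Space) Ψ p v) (N p) = 0
  unit : ∀ p, hypInner (Ψ p) (N p) (N p) = 1
  equation : ∀ p, meanCurvature Ψ N p = hypInner (Ψ p) (N p) dz

/-- The rotation by the angle `t` about the `z`-axis. -/
noncomputable def rot (t : ℝ) (p : Space) : Space :=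
  !₂[p 0 * Real.cos t - p 1 * Real.sin t, p 0 * Real.sin t + p 1 * Real.cos t, p 2]

/-- The rotation axis: the `z`-axis in the upper half-space. -/
def axis : Set Space := {p | p 0 = 0 ∧ p 1 = 0 ∧ 0 < p 2}

/-- `S` is a (spherical) rotational horo-shrinker: the image of a horo-shrinker immersion of a
connected smooth surface, invariant under all rotations about the `z`-axis. -/
def IsRotationalHoroShrinker (S : Set Space) : Prop :=
  (∃ (M : Type) (_ : TopologicalSpace M) (_ : ChartedSpace Plane M),
    T2Space M ∧ SecondCountableTopology M ∧ ConnectedSpace M ∧ IsManifold (𝓡 2) ∞ M ∧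
      ∃ Ψ N : M → Space, IsHoroShrinker Ψ N ∧ range Ψ = S) ∧
  ∀ t : ℝ, rot t '' S = S

/-- The Euclidean distance to the rotation axis. -/
noncomputable def radius (p : Space) : ℝ := Real.sqrt (p 0 ^ 2 + p 1 ^ 2)

/-- `u` is a positive `C²` solution on `J` (an interval `[0, R)` or `[0, ∞)`) of
`u'' / (1 + u'^2) + u' / r = 2 (1 - u) / u^2`, `u 0 = z₀`, `u' 0 = 0`. -/
structure IsProfile (z₀ : ℝ) (J : Set ℝ) (u : ℝ → ℝ) : Prop where
  contDiffOn : ContDiffOn ℝ 2 u J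
  pos : ∀ r ∈ J, 0 < u r
  init : u 0 = z₀
  init_deriv : derivWithin u J 0 = 0
  ode : ∀ r ∈ J, 0 < r →
    derivWithin (derivWithin u J) J r / (1 + derivWithin u J r ^ 2) + derivWithin u J r / r
      = 2 * ((1 - u r) / u r ^ 2)

/-- The surface `𝓑(z₀)` generated by the maximal solution of the initial value problem: the union
of the rotated graphs of all the solutions on intervals `[0, R)`. -/
def bowl (z₀ : ℝ) : Set Space :=
  {p | ∃ (R : ℝ) (u : ℝ → ℝ), IsProfile z₀ (Ico 0 R) u ∧ radius p < R ∧ p 2 = u (radius p)}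

/-- The horosphere `z = 1`. -/
def horosphereOne : Set Space := {p | p 2 = 1}

/-- `u` oscillates around the value `c` on `[0, ∞)`: it is strictly monotone between consecutive
extremal points `0 = ρ 0 < ρ 1 < ⋯ → ∞`, at which its values lie alternately strictly below and
strictly above `c`. -/
def OscillatesAround (u : ℝ → ℝ) (c : ℝ) : Prop :=
  ∃ ρ : ℕ → ℝ, ρ 0 = 0 ∧ StrictMono ρ ∧ Tendsto ρ atTop atTop ∧
    ∀ n, (StrictMonoOn u (Icc (ρ n) (ρ (n + 1))) ∧ u (ρ n) < c ∧ c < u (ρ (n + 1))) ∨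
      (StrictAntiOn u (Icc (ρ n) (ρ (n + 1))) ∧ c < u (ρ n) ∧ u (ρ (n + 1)) < c)

end Horo

/-! Analysis. With `s = r ^ 2` and `u r = v (r ^ 2)` the profile equation becomes `(s v')' = F(v) +
s v'^2 (4 F(v) - 2 v')`, where `F(x) = (1 - x) / (2 x^2)` is `force`. Integrating from `0` and
substituting `σ = s t` gives, for `w = v'`, the integral equation `w(s) = ∫₀¹ (F(v(st)) + s t
b(v(st), w(st))) dt`, in which the singularity at the axis is gone. If the coefficients are
truncated so as to be globally Lipschitz, it is solved on the whole line by a contraction in a sup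
norm with weight `exp (-l |s|)`. The truncation is removed for `s ≥ 0` by a barrier for `w` and by
the energy `log (1 + u'^2) / 2 + V(u)`, `V(x) = 2 log x + 2 / x`, `V' = -4 F`, which does not
increase because `u' / r` is a damping term. As `V` tends to infinity at `0` and at infinity, `u`
stays between two positive constants and `u'` stays bounded, so the solution is global
(`exists_isHeight`). It is smooth in `s` on some `(-δ, ∞)`, so `v (x^2 + y^2)` is smooth across the
axis.

Oscillation. `y = ±(u - 1)` solves `y'' / (1 + y'^2) + y' / r = -k y` with `k = 2 / u^2` bounded
below. A rising solution cannot stay negative (Riccati inequality for `-y' / y`) and cannot rise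
forever (`arctan y'` would decrease at a definite rate). It therefore reaches a critical point with
`y > 0`. Iterating with alternating signs gives the extrema; an accumulation point would be a point
with `u = 1`, `u' = 0`, which backward uniqueness excludes when `z₀ ≠ 1`.

Geometry. For a graph, `H = ⟨N, ∂_z⟩` is a quasilinear equation that does not depend on the
parametrization (`IsImmersionAt.equation_iff`), so each `bowl z₀` is a horo-shrinker. Conversely,
invariance is assumed only of the image. The rotation field must nevertheless be tangent: otherwise
the rotated copies of a small piece would fill an open subset of an image of Hausdorff dimension at
most two. Tangency makes the surface horizontal on the axis, and makes every local graph radial, so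
that it solves the profile equation along rays. Points where the height and the tangent plane agree
with those of the bowl thus form a closed and open set containing the axis point, and connectedness
gives `IsHoroShrinker.range_subset_bowl`. Classification and maximality follow, as a bowl determines
its height on the axis. -/

namespace Horo

/-! ### The averaged integral equation: existence by contraction. -/

open MeasureTheory intervalIntegral

/-- The primitive of `w` with value `z₀` at `0`. -/
noncomputable def primitive (z₀ : ℝ) (w : ℝ → ℝ) (s : ℝ) : ℝ := z₀ + ∫ σ in (0 : ℝ)..s, w σ

theorem hasDerivAt_primitive (z₀ : ℝ) {w : ℝ → ℝ} (hw : Continuous w) (s : ℝ) :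
    HasDerivAt (primitive z₀ w) (w s) s :=
  (integral_hasDerivAt_right (hw.intervalIntegrable _ _)
    hw.aestronglyMeasurable.stronglyMeasurableAtFilter hw.continuousAt).const_add z₀

theorem continuous_primitive (z₀ : ℝ) {w : ℝ → ℝ} (hw : Continuous w) :
    Continuous (primitive z₀ w) :=
  continuous_iff_continuousAt.2 fun s => (hasDerivAt_primitive z₀ hw s).continuousAt

@[simp] theorem primitive_zero (z₀ : ℝ) (w : ℝ → ℝ) : primitive z₀ w 0 = z₀ := by
  simp [primitive]

theorem abs_mul_integral_exp_le {l : ℝ} (hl : 0 < l) (s : ℝ) :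
    |s| * ∫ t in (0 : ℝ)..1, Real.exp (l * |s| * t) ≤ Real.exp (l * |s|) / l := by
  have h : ∫ t in (0 : ℝ)..1, (l * |s|) * Real.exp (l * |s| * t)
      = Real.exp (l * |s|) - 1 := by
    have h1 : ∀ t ∈ uIcc (0 : ℝ) 1, HasDerivAt (fun t => Real.exp (l * |s| * t))
        ((l * |s|) * Real.exp (l * |s| * t)) t := fun t _ => by
      have := ((hasDerivAt_id t).const_mul (l * |s|)).exp
      simpa [mul_comm] using this
    rw [integral_eq_sub_of_hasDerivAt h1 (Continuous.intervalIntegrable (by fun_prop) _ _)]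
    simp
  rw [intervalIntegral.integral_const_mul] at h
  rw [le_div_iff₀ hl]
  linarith [h]

/-- Integrating `exp (l |σ|)` from `0` to `s` costs at most `exp (l |s|) / l`: in the weighted norm,
taking primitives gains a factor `1 / l`. -/
theorem abs_primitive_sub_le {w w' : ℝ → ℝ} (hw : Continuous w) (hw' : Continuous w') {l d : ℝ}
    (hl : 0 < l) (hd : 0 ≤ d) (h : ∀ s, |w s - w' s| ≤ d * Real.exp (l * |s|)) (z₀ s : ℝ) :
    |primitive z₀ w s - primitive z₀ w' s| ≤ d * Real.exp (l * |s|) / l := by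
  have e : primitive z₀ w s - primitive z₀ w' s
      = s * ∫ t in (0 : ℝ)..1, (w (s * t) - w' (s * t)) := by
    rw [intervalIntegral.integral_sub (Continuous.intervalIntegrable (by fun_prop) _ _)
      (Continuous.intervalIntegrable (by fun_prop) _ _), mul_sub,
      mul_integral_comp_mul_left, mul_integral_comp_mul_left]
    simp [primitive]
  rw [e, abs_mul]
  have hc : Continuous fun t : ℝ => d * Real.exp (l * |s| * t) := by fun_prop
  have h1 : |∫ t in (0 : ℝ)..1, (w (s * t) - w' (s * t))|
      ≤ ∫ t in (0 : ℝ)..1, d * Real.exp (l * |s| * t) := by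
    rw [← Real.norm_eq_abs]
    refine intervalIntegral.norm_integral_le_of_norm_le (μ := volume) zero_le_one
      (Eventually.of_forall fun t ht => ?_) (hc.intervalIntegrable _ _)
    have := h (s * t)
    rwa [abs_mul, abs_of_pos ht.1, ← mul_assoc] at this
  rw [intervalIntegral.integral_const_mul] at h1
  calc _ ≤ |s| * (d * ∫ t in (0 : ℝ)..1, Real.exp (l * |s| * t)) := by gcongr
    _ = d * (|s| * ∫ t in (0 : ℝ)..1, Real.exp (l * |s| * t)) := by ring
    _ ≤ d * (Real.exp (l * |s|) / l) := by gcongr; exact abs_mul_integral_exp_le hl s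
    _ = _ := by ring

section Averaged

variable (a : ℝ → ℝ) (b : ℝ → ℝ → ℝ) (z₀ : ℝ)

/-- The right-hand side of the averaged integral equation for the derivative `w`. -/
noncomputable def averaged (w : ℝ → ℝ) (s : ℝ) : ℝ :=
  ∫ t in (0 : ℝ)..1, (a (primitive z₀ w (s * t))
    + s * t * b (primitive z₀ w (s * t)) (w (s * t)))

variable {a b}

theorem continuous_averaged (ha : Continuous a) (hb : Continuous fun p : ℝ × ℝ => b p.1 p.2)
    {w : ℝ → ℝ} (hw : Continuous w) : Continuous (averaged a b z₀ w) := by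
  refine continuous_parametric_intervalIntegral_of_continuous' ?_ _ _
  have hv := continuous_primitive z₀ hw
  have h1 : Continuous fun p : ℝ × ℝ => p.1 * p.2 := by fun_prop
  have h2 : Continuous fun p : ℝ × ℝ => b (primitive z₀ w (p.1 * p.2)) (w (p.1 * p.2)) :=
    hb.comp ((hv.comp h1).prodMk (hw.comp h1))
  exact (ha.comp (hv.comp h1)).add (h1.mul h2)

theorem mul_averaged {w : ℝ → ℝ} (s : ℝ) :
    s * averaged a b z₀ w s
      = ∫ σ in (0 : ℝ)..s, (a (primitive z₀ w σ) + σ * b (primitive z₀ w σ) (w σ)) := by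
  have := mul_integral_comp_mul_left (a := (0 : ℝ)) (b := 1)
    (f := fun σ => a (primitive z₀ w σ) + σ * b (primitive z₀ w σ) (w σ)) s
  simpa [averaged] using this

/-- The `a` term gains `1 / l` from the primitive; the `b` term gains it because `s ∫₀¹ ... dt` is
again an integral from `0` to `s`. The total factor is `3 L / l`, and the rate `l = 1 + 6 L` makes
it at most `1 / 2`. -/
theorem abs_averaged_sub_le {L : ℝ} (hL : 0 ≤ L) (hac : Continuous a)
    (hbc : Continuous fun p : ℝ × ℝ => b p.1 p.2)
    (ha : ∀ x y, |a x - a y| ≤ L * |x - y|)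
    (hb : ∀ x y x' y', |b x y - b x' y'| ≤ L * (|x - x'| + |y - y'|))
    {w w' : ℝ → ℝ} (hw : Continuous w) (hw' : Continuous w') {d : ℝ} (hd : 0 ≤ d)
    (h : ∀ s, |w s - w' s| ≤ d * Real.exp ((1 + 6 * L) * |s|)) (s : ℝ) :
    |averaged a b z₀ w s - averaged a b z₀ w' s|
      ≤ 1 / 2 * d * Real.exp ((1 + 6 * L) * |s|) := by
  set l := 1 + 6 * L with hl
  have hl1 : 1 ≤ l := by linarith
  have hl0 : 0 < l := by linarith
  have hcont : ∀ {w : ℝ → ℝ}, Continuous w → Continuous fun t => (a (primitive z₀ w (s * t))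
    + s * t * b (primitive z₀ w (s * t)) (w (s * t))) := fun {w} hw => by
    have hv := continuous_primitive z₀ hw
    have h1 : Continuous fun t : ℝ => s * t := by fun_prop
    have h2 : Continuous fun t : ℝ => b (primitive z₀ w (s * t)) (w (s * t)) :=
      hbc.comp ((hv.comp h1).prodMk (hw.comp h1))
    exact (hac.comp (hv.comp h1)).add (h1.mul h2)
  unfold averaged
  rw [← intervalIntegral.integral_sub ((hcont hw).intervalIntegrable _ _)
    ((hcont hw').intervalIntegrable _ _)]
  have hI := abs_mul_integral_exp_le hl0 s
  have hE : ∀ t, |s * t| = |s| * |t| := fun t => abs_mul s t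
  have hc : Continuous fun t : ℝ => L * d * Real.exp (l * |s|) / l
    + 2 * L * d * (|s| * Real.exp (l * |s| * t)) := by fun_prop
  rw [← Real.norm_eq_abs]
  refine (intervalIntegral.norm_integral_le_of_norm_le (μ := volume) zero_le_one
    (Eventually.of_forall fun t ht => ?_) (hc.intervalIntegrable _ _)).trans ?_
  · have h1 := h (s * t)
    have h2 := abs_primitive_sub_le hw hw' hl0 hd h z₀ (s * t)
    rw [hE, abs_of_pos ht.1, ← mul_assoc] at h1 h2
    have h3 := ha (primitive z₀ w (s * t)) (primitive z₀ w' (s * t))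
    have h4 := hb (primitive z₀ w (s * t)) (w (s * t)) (primitive z₀ w' (s * t)) (w' (s * t))
    have hmono : Real.exp (l * |s| * t) ≤ Real.exp (l * |s|) :=
      Real.exp_le_exp.2 (mul_le_of_le_one_right (by positivity) ht.2)
    have hp := Real.exp_pos (l * |s| * t)
    have h5 : d * Real.exp (l * |s| * t) / l ≤ d * Real.exp (l * |s| * t) :=
      div_le_self (by positivity) hl1
    have h6 : d * Real.exp (l * |s| * t) / l ≤ d * Real.exp (l * |s|) / l := by gcongr
    have e : ∀ A A' B B' : ℝ, A + s * t * B - (A' + s * t * B') = (A - A') + s * t * (B - B') :=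
      fun _ _ _ _ => by ring
    rw [Real.norm_eq_abs, e]
    refine (abs_add_le _ _).trans ?_
    rw [abs_mul, hE, abs_of_pos ht.1]
    have h7 : |a (primitive z₀ w (s * t)) - a (primitive z₀ w' (s * t))|
        ≤ L * d * Real.exp (l * |s|) / l :=
      h3.trans ((mul_le_mul_of_nonneg_left (h2.trans h6) hL).trans_eq (by ring))
    have h8 : |b (primitive z₀ w (s * t)) (w (s * t)) - b (primitive z₀ w' (s * t)) (w' (s * t))|
        ≤ 2 * L * d * Real.exp (l * |s| * t) := by
      refine h4.trans ((mul_le_mul_of_nonneg_left (add_le_add (h2.trans h5) h1) hL).trans_eq ?_)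
      ring
    have h9 : |s| * t ≤ |s| := mul_le_of_le_one_right (abs_nonneg _) ht.2
    calc _ ≤ L * d * Real.exp (l * |s|) / l + |s| * (2 * L * d * Real.exp (l * |s| * t)) := by
          gcongr
      _ = _ := by ring
  · have hc' : Continuous fun t : ℝ => 2 * L * d * (|s| * Real.exp (l * |s| * t)) := by fun_prop
    rw [intervalIntegral.integral_add (by simp) (hc'.intervalIntegrable _ _),
      intervalIntegral.integral_const_mul, intervalIntegral.integral_const_mul]
    simp only [intervalIntegral.integral_const, sub_zero, one_smul]
    have : L * d * Real.exp (l * |s|) / l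
        + 2 * L * d * (|s| * ∫ t in (0 : ℝ)..1, Real.exp (l * |s| * t))
        ≤ L * d * Real.exp (l * |s|) / l + 2 * L * d * (Real.exp (l * |s|) / l) := by gcongr
    refine this.trans ?_
    have e : L * d * Real.exp (l * |s|) / l + 2 * L * d * (Real.exp (l * |s|) / l)
        = (3 * L / l) * (d * Real.exp (l * |s|)) := by ring
    rw [e, mul_assoc]
    refine mul_le_mul_of_nonneg_right ?_ (by positivity)
    rw [div_le_iff₀ hl0, hl]; linarith

/-- The averaged integral equation with Lipschitz coefficients has a continuous solution. -/
theorem exists_eq_averaged {L : ℝ} (hL : 0 ≤ L) (hac : Continuous a)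
    (hbc : Continuous fun p : ℝ × ℝ => b p.1 p.2)
    (ha : ∀ x y, |a x - a y| ≤ L * |x - y|)
    (hb : ∀ x y x' y', |b x y - b x' y'| ≤ L * (|x - x'| + |y - y'|)) :
    ∃ w : ℝ → ℝ, Continuous w ∧ ∀ s, w s = averaged a b z₀ w s := by
  obtain ⟨l, hl⟩ : ∃ l, l = 1 + 6 * L := ⟨_, rfl⟩
  have hl1 : 1 ≤ l := by linarith
  -- Unknowns are written `w = exp (l |s|) y` with `y` bounded, so that the weighted norm becomes
  -- the sup norm of a complete space.
  obtain ⟨W, hW⟩ : ∃ W : BoundedContinuousFunction ℝ ℝ → ℝ → ℝ,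
    ∀ y, W y = fun s => Real.exp (l * |s|) * y s := ⟨_, fun _ => rfl⟩
  have hWc : ∀ y, Continuous (W y) := fun y => by
    have := y.continuous
    rw [hW]; fun_prop
  have key : ∀ (y y' : BoundedContinuousFunction ℝ ℝ) (s : ℝ), |averaged a b z₀ (W y) s - averaged a b z₀ (W y') s|
      ≤ 1 / 2 * dist y y' * Real.exp (l * |s|) := fun y y' s => by
    rw [hl]
    refine abs_averaged_sub_le z₀ hL hac hbc ha hb (hWc y) (hWc y') dist_nonneg (fun s => ?_) s
    simp only [hW, hl]
    rw [← mul_sub, abs_mul, Real.abs_exp, mul_comm]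
    gcongr
    exact BoundedContinuousFunction.dist_coe_le_dist (f := y) (g := y') s
  have hinv : ∀ s : ℝ, Real.exp (-(l * |s|)) * Real.exp (l * |s|) = 1 := fun s => by
    rw [← Real.exp_add]; simp
  -- The image of `0` grows at most linearly in `s`, which the weight absorbs; with the Lipschitz
  -- bound this shows that the map preserves boundedness.
  have hT0 : ∀ s, |Real.exp (-(l * |s|)) * averaged a b z₀ (W 0) s| ≤ |a z₀| + |b z₀ 0| := by
    intro s
    have h0 : W 0 = fun _ => 0 := by funext s; simp [hW]
    have hp : ∀ s, primitive z₀ (fun _ => (0 : ℝ)) s = z₀ := fun s => by simp [primitive]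
    have h1 : |averaged a b z₀ (W 0) s| ≤ |a z₀| + |s| * |b z₀ 0| := by
      unfold averaged
      simp only [h0, hp]
      have h : ∀ t ∈ uIoc (0 : ℝ) 1, ‖a z₀ + s * t * b z₀ 0‖ ≤ |a z₀| + |s| * |b z₀ 0| := ?_
      · simpa using intervalIntegral.norm_integral_le_of_norm_le_const h
      intro t ht
      rw [uIoc_of_le zero_le_one] at ht
      refine (abs_add_le _ _).trans ?_
      rw [abs_mul, abs_mul, abs_of_pos ht.1]
      gcongr
      exact mul_le_of_le_one_right (abs_nonneg _) ht.2
    have h2 : |s| ≤ Real.exp (l * |s|) := by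
      have h3 := Real.add_one_le_exp (l * |s|)
      have h4 : |s| ≤ l * |s| := le_mul_of_one_le_left (abs_nonneg s) hl1
      linarith
    have h3 : 1 ≤ Real.exp (l * |s|) := Real.one_le_exp (by positivity)
    rw [abs_mul, Real.abs_exp]
    calc _ ≤ Real.exp (-(l * |s|)) * (Real.exp (l * |s|) * (|a z₀| + |b z₀ 0|)) := by
          gcongr
          refine h1.trans ?_
          nlinarith [abs_nonneg (a z₀), abs_nonneg (b z₀ 0),
            mul_le_mul_of_nonneg_right h2 (abs_nonneg (b z₀ 0)),
            mul_le_mul_of_nonneg_right h3 (abs_nonneg (a z₀))]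
      _ = _ := by rw [← mul_assoc, hinv, one_mul]
  have hdist : ∀ y y' s, |Real.exp (-(l * |s|)) * averaged a b z₀ (W y) s
      - Real.exp (-(l * |s|)) * averaged a b z₀ (W y') s| ≤ 1 / 2 * dist y y' := fun y y' s => by
    rw [← mul_sub, abs_mul, Real.abs_exp]
    calc _ ≤ Real.exp (-(l * |s|)) * (1 / 2 * dist y y' * Real.exp (l * |s|)) := by
          gcongr; exact key y y' s
      _ = 1 / 2 * dist y y' * (Real.exp (-(l * |s|)) * Real.exp (l * |s|)) := by ring
      _ = _ := by rw [hinv, mul_one]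
  have hTb : ∀ y s, ‖Real.exp (-(l * |s|)) * averaged a b z₀ (W y) s‖
      ≤ 1 / 2 * dist y 0 + (|a z₀| + |b z₀ 0|) := fun y s => by
    have h1 := hdist y 0 s
    have h2 := hT0 s
    rw [Real.norm_eq_abs]
    have := abs_sub_abs_le_abs_sub (Real.exp (-(l * |s|)) * averaged a b z₀ (W y) s)
      (Real.exp (-(l * |s|)) * averaged a b z₀ (W 0) s)
    linarith
  have hTc : ∀ y, Continuous fun s => Real.exp (-(l * |s|)) * averaged a b z₀ (W y) s :=
    fun y => by have := continuous_averaged z₀ hac hbc (hWc y); fun_prop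
  obtain ⟨T, hTdef⟩ : ∃ T : BoundedContinuousFunction ℝ ℝ → BoundedContinuousFunction ℝ ℝ,
      ∀ y s, T y s = Real.exp (-(l * |s|)) * averaged a b z₀ (W y) s :=
    ⟨fun y => BoundedContinuousFunction.ofNormedAddCommGroup _ (hTc y) _ (hTb y), fun _ _ => rfl⟩
  have hhalf : (1 / 2 : NNReal) < 1 := by
    rw [← NNReal.coe_lt_coe]; norm_num
  have hT : ContractingWith (1 / 2 : NNReal) T := by
    refine ⟨hhalf, LipschitzWith.of_dist_le_mul fun y y' => ?_⟩
    refine (BoundedContinuousFunction.dist_le (by positivity)).2 fun s => ?_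
    rw [Real.dist_eq, hTdef, hTdef]
    simpa using hdist y y' s
  obtain ⟨y, hy⟩ : ∃ y, T y = y := ⟨_, hT.fixedPoint_isFixedPt⟩
  refine ⟨W y, hWc y, fun s => ?_⟩
  have h : T y s = y s := by rw [hy]
  rw [hTdef] at h
  have h' : W y s = Real.exp (l * |s|) * y s := by rw [hW]
  rw [h', ← h, ← mul_assoc, mul_comm (Real.exp (l * |s|)), hinv, one_mul]

end Averaged

end Horo

/-! ### Smoothness of solutions of the averaged equation. -/

namespace Horo

open MeasureTheory intervalIntegral

/-- The averaged moment `∫₀¹ t ^ m f (s t) dt`. -/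
noncomputable def moment (m : ℕ) (f : ℝ → ℝ) (s : ℝ) : ℝ := ∫ t in (0 : ℝ)..1, t ^ m * f (s * t)

theorem continuous_moment (m : ℕ) {f : ℝ → ℝ} (hf : Continuous f) : Continuous (moment m f) :=
  continuous_parametric_intervalIntegral_of_continuous' (by fun_prop) _ _

theorem mul_mul_moment_one (f : ℝ → ℝ) (s : ℝ) :
    s * (s * moment 1 f s) = ∫ σ in (0 : ℝ)..s, σ * f σ := by
  have := mul_integral_comp_mul_left (a := (0 : ℝ)) (b := 1) (f := fun σ => σ * f σ) s
  simp only [mul_zero, mul_one] at this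
  rw [← this, moment, ← intervalIntegral.integral_const_mul]
  simp [mul_assoc]

/-- Away from `0` the function is `s⁻¹ ∫₀ˢ σ f σ`. At `0` the two sides match because `moment 1 f 0
= f 0 / 2`. Only continuity of `f` is used: the factor `s` gains one derivative. -/
theorem hasDerivAt_mul_moment_one {f : ℝ → ℝ} (hf : Continuous f) (s : ℝ) :
    HasDerivAt (fun s => s * moment 1 f s) (f s - moment 1 f s) s := by
  have hc := continuous_moment 1 hf
  rcases eq_or_ne s 0 with rfl | hs
  · have h0 : moment 1 f 0 = f 0 / 2 := by
      simp [moment, intervalIntegral.integral_mul_const]; ring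
    have : f 0 - moment 1 f 0 = moment 1 f 0 := by rw [h0]; ring
    rw [this, hasDerivAt_iff_tendsto_slope_zero]
    refine (hc.tendsto 0).mono_left nhdsWithin_le_nhds |>.congr' ?_
    filter_upwards [self_mem_nhdsWithin] with t ht
    have ht' : t ≠ 0 := ht
    simp [ht']
  · have h1 : HasDerivAt (fun s => ∫ σ in (0 : ℝ)..s, σ * f σ) (s * f s) s := by
      have hg : Continuous fun σ => σ * f σ := by fun_prop
      exact integral_hasDerivAt_right (hg.intervalIntegrable _ _)
        hg.aestronglyMeasurable.stronglyMeasurableAtFilter hg.continuousAt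
    have h2 := (hasDerivAt_inv hs).mul h1
    refine (h2.congr_of_eventuallyEq ?_).congr_deriv ?_
    · filter_upwards [isOpen_ne.mem_nhds hs] with x hx
      have hx' : x ≠ 0 := hx
      rw [Pi.mul_apply, ← mul_mul_moment_one, ← mul_assoc, inv_mul_cancel₀ hx', one_mul]
    · rw [← mul_mul_moment_one]
      field_simp
      ring

/-- A function that is continuous on `(-δ, ∞)` agrees near `(-c, ∞)`, `c < δ`, with a continuous
one. -/
theorem continuous_comp_max {f : ℝ → ℝ} {δ c : ℝ} (hf : ContinuousOn f (Ioi (-δ))) (hc : c < δ) :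
    Continuous fun x => f (max (-c) x) :=
  hf.comp_continuous (by fun_prop) fun x => lt_max_iff.2 (Or.inl (neg_lt_neg hc))

/-- A moment at `s` sees `f` only between `0` and `s`, so facts about globally continuous functions
carry over to functions that are continuous on `(-δ, ∞)`. -/
theorem moment_comp_max (m : ℕ) (f : ℝ → ℝ) {c s : ℝ} (hc : 0 < c) (hs : -c < s) :
    moment m (fun x => f (max (-c) x)) s = moment m f s := by
  refine intervalIntegral.integral_congr fun t ht => ?_
  rw [uIcc_of_le zero_le_one] at ht
  have : -c ≤ s * t := by
    rcases le_or_gt 0 s with h | h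
    · nlinarith [mul_nonneg h ht.1]
    · nlinarith [ht.2, ht.1]
  simp only [max_eq_right this]

theorem exists_between_neg {δ s : ℝ} (hδ : 0 < δ) (hs : -δ < s) : ∃ c, 0 < c ∧ c < δ ∧ -c < s := by
  obtain ⟨c, h1, h2⟩ := exists_between (max_lt hδ (by linarith : -s < δ))
  exact ⟨c, (le_max_left _ _).trans_lt h1, h2, by linarith [(le_max_right 0 (-s)).trans_lt h1]⟩

theorem continuousOn_moment {m : ℕ} {f : ℝ → ℝ} {δ : ℝ} (hδ : 0 < δ)
    (hf : ContinuousOn f (Ioi (-δ))) : ContinuousOn (moment m f) (Ioi (-δ)) := fun s hs => by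
  obtain ⟨c, hc, hcd, hcs⟩ := exists_between_neg hδ hs
  refine ((continuous_moment m (continuous_comp_max hf hcd)).continuousAt.congr ?_)
    |>.continuousWithinAt
  filter_upwards [lt_mem_nhds hcs] with x hx using moment_comp_max m f hc hx

theorem hasDerivAt_mul_moment_one_of_continuousOn {f : ℝ → ℝ} {δ : ℝ} (hδ : 0 < δ)
    (hf : ContinuousOn f (Ioi (-δ))) {s : ℝ} (hs : -δ < s) :
    HasDerivAt (fun s => s * moment 1 f s) (f s - moment 1 f s) s := by
  obtain ⟨c, hc, hcd, hcs⟩ := exists_between_neg hδ hs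
  have h := hasDerivAt_mul_moment_one (continuous_comp_max hf hcd) s
  rw [moment_comp_max 1 f hc hcs, max_eq_right hcs.le] at h
  refine h.congr_of_eventuallyEq ?_
  filter_upwards [lt_mem_nhds hcs] with x hx
  rw [moment_comp_max 1 f hc hx]

theorem hasDerivAt_moment {m : ℕ} {f : ℝ → ℝ} {δ : ℝ} (hδ : 0 < δ)
    (hf : ContDiffOn ℝ 1 f (Ioi (-δ))) {s : ℝ} (hs : -δ < s) :
    HasDerivAt (moment m f) (moment (m + 1) (deriv f) s) s := by
  obtain ⟨c, hc, hcd, hcs⟩ := exists_between_neg hδ hs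
  have hfc := hf.continuousOn
  have hdc : ContinuousOn (deriv f) (Ioi (-δ)) :=
    hf.continuousOn_deriv_of_isOpen isOpen_Ioi le_rfl
  have hmem : ∀ x ∈ Ioo (-c) (|s| + 1), ∀ t ∈ Icc (0 : ℝ) 1, x * t ∈ Icc (-c) (|s| + 1) := by
    intro x hx t ht
    have := abs_nonneg s
    rcases le_or_gt 0 x with h | h
    · exact ⟨by nlinarith [mul_nonneg h ht.1], by nlinarith [ht.2, hx.2]⟩
    · exact ⟨by nlinarith [ht.2, ht.1, hx.1], by nlinarith [ht.1]⟩
  have hsub : Icc (-c) (|s| + 1) ⊆ Ioi (-δ) := fun x hx => by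
    have := hx.1; simp only [mem_Ioi]; linarith
  obtain ⟨C, hC⟩ := isCompact_Icc.exists_bound_of_continuousOn (hdc.mono hsub)
  have hcomp : ∀ {g : ℝ → ℝ}, ContinuousOn g (Ioi (-δ)) → ∀ k : ℕ, ∀ x ∈ Ioo (-c) (|s| + 1),
      ContinuousOn (fun t => t ^ k * g (x * t)) (uIcc 0 1) := fun {g} hg k x hx => by
    refine ContinuousOn.mul (by fun_prop) (hg.comp (by fun_prop) fun t ht => ?_)
    rw [uIcc_of_le zero_le_one] at ht
    exact hsub (hmem x hx t ht)
  have hs1 : Ioo (-c) (|s| + 1) ∈ 𝓝 s :=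
    Ioo_mem_nhds hcs (by linarith [le_abs_self s])
  have hsS : s ∈ Ioo (-c) (|s| + 1) := mem_of_mem_nhds hs1
  refine (intervalIntegral.hasDerivAt_integral_of_dominated_loc_of_deriv_le
    (F := fun x t => t ^ m * f (x * t)) (F' := fun x t => t ^ (m + 1) * deriv f (x * t))
    (bound := fun _ => C) hs1 ?_ ?_ ?_ ?_ (by simp) ?_).2
  · filter_upwards [hs1] with x hx
    exact ((hcomp hfc m x hx).mono uIoc_subset_uIcc).aestronglyMeasurable measurableSet_uIoc
  · exact (hcomp hfc m s hsS).intervalIntegrable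
  · exact ((hcomp hdc (m + 1) s hsS).mono uIoc_subset_uIcc).aestronglyMeasurable
      measurableSet_uIoc
  · refine Eventually.of_forall fun t ht x hx => ?_
    rw [uIoc_of_le zero_le_one] at ht
    have h1 := hC _ (hmem x hx t ⟨ht.1.le, ht.2⟩)
    have h2 : t ^ (m + 1) ≤ 1 := pow_le_one₀ ht.1.le ht.2
    have h3 : 0 ≤ t ^ (m + 1) := pow_nonneg ht.1.le _
    rw [norm_mul, Real.norm_of_nonneg h3]
    nlinarith [norm_nonneg (deriv f (x * t))]
  · refine Eventually.of_forall fun t ht x hx => ?_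
    rw [uIoc_of_le zero_le_one] at ht
    have h1 : HasDerivAt f (deriv f (x * t)) (x * t) :=
      ((hf.differentiableOn one_ne_zero).differentiableAt
        (isOpen_Ioi.mem_nhds (hsub (hmem x hx t ⟨ht.1.le, ht.2⟩)))).hasDerivAt
    have h2 := (h1.comp x ((hasDerivAt_id x).mul_const t)).const_mul (t ^ m)
    refine h2.congr_deriv ?_
    ring

theorem contDiffOn_moment {δ : ℝ} (hδ : 0 < δ) (n : ℕ) : ∀ (m : ℕ) {f : ℝ → ℝ},
    ContDiffOn ℝ n f (Ioi (-δ)) → ContDiffOn ℝ n (moment m f) (Ioi (-δ)) := by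
  induction n with
  | zero =>
    intro m f hf
    simp only [CharP.cast_eq_zero, contDiffOn_zero] at hf ⊢
    exact continuousOn_moment hδ hf
  | succ n ih =>
    intro m f hf
    have h1 : ContDiffOn ℝ 1 f (Ioi (-δ)) := hf.of_le (by norm_cast; omega)
    have hd := fun s (hs : s ∈ Ioi (-δ)) => hasDerivAt_moment (m := m) hδ h1 hs
    push_cast at hf ⊢
    rw [contDiffOn_succ_iff_deriv_of_isOpen isOpen_Ioi] at hf ⊢
    refine ⟨fun s hs => (hd s hs).differentiableAt.differentiableWithinAt, by simp, ?_⟩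
    exact (ih (m + 1) hf.2.2).congr fun s hs => (hd s hs).deriv

theorem contDiffOn_mul_moment_one {δ : ℝ} (hδ : 0 < δ) {n : ℕ} {f : ℝ → ℝ}
    (hf : ContDiffOn ℝ n f (Ioi (-δ))) :
    ContDiffOn ℝ (n + 1) (fun s => s * moment 1 f s) (Ioi (-δ)) := by
  have hd := fun s (hs : s ∈ Ioi (-δ)) =>
    hasDerivAt_mul_moment_one_of_continuousOn hδ hf.continuousOn hs
  rw [contDiffOn_succ_iff_deriv_of_isOpen isOpen_Ioi]
  refine ⟨fun s hs => (hd s hs).differentiableAt.differentiableWithinAt, by simp, ?_⟩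
  exact (hf.sub (contDiffOn_moment hδ n 1 hf)).congr fun s hs => (hd s hs).deriv

/-- Solutions of the averaged integral equation are smooth where the coefficients are. -/
theorem contDiffOn_of_eq_averaged {δ : ℝ} (hδ : 0 < δ) {a : ℝ → ℝ} {b : ℝ → ℝ → ℝ} {z₀ : ℝ}
    {w : ℝ → ℝ} (hw : Continuous w) {P : Set ℝ} (ha : ContDiffOn ℝ ∞ a P)
    (hb : ContDiffOn ℝ ∞ (fun p : ℝ × ℝ => b p.1 p.2) (P ×ˢ univ))
    (hv : ∀ s ∈ Ioi (-δ), primitive z₀ w s ∈ P)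
    (heq : ∀ s ∈ Ioi (-δ), w s = averaged a b z₀ w s) :
    ContDiffOn ℝ ∞ w (Ioi (-δ)) := by
  have hmem : ∀ s ∈ Ioi (-δ), ∀ t ∈ uIcc (0 : ℝ) 1, s * t ∈ Ioi (-δ) := fun s hs t ht => by
    rw [uIcc_of_le zero_le_one] at ht
    simp only [mem_Ioi] at hs ⊢
    rcases le_or_gt 0 s with h | h
    · nlinarith [mul_nonneg h ht.1]
    · nlinarith [ht.2, ht.1]
  have hvc := continuous_primitive z₀ hw
  have hac : ContinuousOn (fun s => a (primitive z₀ w s)) (Ioi (-δ)) :=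
    ha.continuousOn.comp hvc.continuousOn hv
  have hbc : ContinuousOn (fun s => b (primitive z₀ w s) (w s)) (Ioi (-δ)) :=
    hb.continuousOn.comp (f := fun s => (primitive z₀ w s, w s))
      (hvc.prodMk hw).continuousOn fun s hs => ⟨hv s hs, mem_univ _⟩
  -- Bootstrap: if `w` is `C^n`, then `a(v)` is `C^(n+1)` because `v` is a primitive of `w`, while
  -- the term with `b(v, w)`, only `C^n` inside, regains a derivative from the factor `s`.
  have hsplit : ∀ s ∈ Ioi (-δ), w s = moment 0 (fun s => a (primitive z₀ w s)) s
      + s * moment 1 (fun s => b (primitive z₀ w s) (w s)) s := fun s hs => by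
    have hc1 : ContinuousOn (fun t => t ^ 0 * a (primitive z₀ w (s * t))) (uIcc 0 1) :=
      ContinuousOn.mul (by fun_prop) (hac.comp (f := fun t => s * t) (by fun_prop) (hmem s hs))
    have hc2 : ContinuousOn
        (fun t => s * (t ^ 1 * b (primitive z₀ w (s * t)) (w (s * t)))) (uIcc 0 1) :=
      ContinuousOn.mul (by fun_prop) (ContinuousOn.mul (by fun_prop)
        (hbc.comp (f := fun t => s * t) (by fun_prop) (hmem s hs)))
    rw [heq s hs, averaged, moment, moment, ← intervalIntegral.integral_const_mul,
      ← intervalIntegral.integral_add hc1.intervalIntegrable hc2.intervalIntegrable]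
    simp [mul_assoc]
  rw [contDiffOn_infty]
  intro n
  induction n with
  | zero => simpa using hw.continuousOn
  | succ n ih =>
    have hv1 : ContDiffOn ℝ (n + 1) (primitive z₀ w) (Ioi (-δ)) := by
      rw [contDiffOn_succ_iff_deriv_of_isOpen isOpen_Ioi]
      refine ⟨fun s _ => (hasDerivAt_primitive z₀ hw s).differentiableAt.differentiableWithinAt,
        by simp, ih.congr fun s _ => (hasDerivAt_primitive z₀ hw s).deriv⟩
    have ha1 : ContDiffOn ℝ ((n + 1 : ℕ)) (fun s => a (primitive z₀ w s)) (Ioi (-δ)) :=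
      (ha.of_le (mod_cast le_top)).comp (by exact_mod_cast hv1) hv
    have hb1 : ContDiffOn ℝ n (fun s => b (primitive z₀ w s) (w s)) (Ioi (-δ)) :=
      ContDiffOn.comp (hb.of_le (mod_cast le_top))
        ((hv1.of_le (by norm_cast; omega)).prodMk ih) fun s hs => ⟨hv s hs, mem_univ _⟩
    refine ContDiffOn.congr ?_ hsplit
    exact (contDiffOn_moment hδ (n + 1) 0 ha1).add
      (by exact_mod_cast contDiffOn_mul_moment_one hδ hb1)

end Horo

/-! ### Force, potential, and their truncations. -/

namespace Horo

open MeasureTheory intervalIntegral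

/-- The force `(1 - x) / (2 x ^ 2)`, a quarter of the right-hand side of the profile equation. -/
noncomputable def force (x : ℝ) : ℝ := (1 - x) / (2 * x ^ 2)

/-- The potential of the profile equation. -/
noncomputable def potential (x : ℝ) : ℝ := 2 * Real.log x + 2 / x

theorem hasDerivAt_potential {x : ℝ} (hx : 0 < x) :
    HasDerivAt potential (-4 * force x) x := by
  have h := ((Real.hasDerivAt_log hx.ne').const_mul 2).add
    ((hasDerivAt_inv hx.ne').const_mul 2)
  refine (h.congr_of_eventuallyEq ?_).congr_deriv ?_
  · exact Eventually.of_forall fun y => by simp [potential, div_eq_mul_inv]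
  · rw [force]; field_simp; ring

theorem two_le_potential {x : ℝ} (hx : 0 < x) : 2 ≤ potential x := by
  have h := Real.one_sub_inv_le_log_of_pos hx
  rw [potential, div_eq_mul_inv]; linarith

theorem contDiffOn_force : ContDiffOn ℝ ∞ force (Ioi 0) := by
  unfold force
  refine ContDiffOn.div (by fun_prop) (by fun_prop) fun x hx => ?_
  have : (0 : ℝ) < x := hx
  positivity

theorem force_pos {x : ℝ} (hx : 0 < x) (h : x < 1) : 0 < force x :=
  div_pos (by linarith) (by positivity)

theorem force_neg {x : ℝ} (h : 1 < x) : force x < 0 :=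
  div_neg_of_neg_of_pos (by linarith) (by positivity)

theorem abs_force_sub_le {m x y : ℝ} (hm : 0 < m) (hx : m ≤ x) (hy : m ≤ y) :
    |force x - force y| ≤ (1 / m ^ 3 + 1 / m ^ 2) * |x - y| := by
  have hx0 := hm.trans_le hx
  have hy0 := hm.trans_le hy
  have e : force x - force y
      = (1 / (x * y) / 2 - 1 / (x * y ^ 2) / 2 - 1 / (x ^ 2 * y) / 2) * (x - y) := by
    rw [force, force]; field_simp; ring
  have h1 : 1 / (x * y) ≤ 1 / m ^ 2 := by rw [sq]; gcongr
  have h2 : 1 / (x * y ^ 2) ≤ 1 / m ^ 3 := by rw [pow_succ' m 2]; gcongr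
  have h3 : 1 / (x ^ 2 * y) ≤ 1 / m ^ 3 := by rw [pow_succ m 2]; gcongr
  have p1 : 0 < 1 / (x * y) := by positivity
  have p2 : 0 < 1 / (x * y ^ 2) := by positivity
  have p3 : 0 < 1 / (x ^ 2 * y) := by positivity
  rw [e, abs_mul]
  gcongr
  rw [abs_le]
  constructor <;> linarith

theorem abs_force_le {m x : ℝ} (hm : 0 < m) (hx : m ≤ x) :
    |force x| ≤ 1 / m ^ 2 + 1 / m := by
  have hx0 := hm.trans_le hx
  have e : force x = 1 / x ^ 2 / 2 - 1 / x / 2 := by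
    rw [force]; field_simp
  have h1 : 1 / x ^ 2 ≤ 1 / m ^ 2 := by gcongr
  have h2 : 1 / x ≤ 1 / m := by gcongr
  have p1 : 0 < 1 / x ^ 2 := by positivity
  have p2 : 0 < 1 / x := by positivity
  rw [e, abs_le]
  constructor <;> linarith

/-- Truncation to the interval `[-W, W]`. -/
noncomputable def clip (W x : ℝ) : ℝ := max (-W) (min W x)

theorem abs_clip_le {W : ℝ} (hW : 0 ≤ W) (x : ℝ) : |clip W x| ≤ W :=
  abs_le.2 ⟨le_max_left _ _, max_le (by linarith) (min_le_left _ _)⟩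

theorem clip_of_abs_le {W x : ℝ} (h : |x| ≤ W) : clip W x = x := by
  rw [clip, min_eq_right (abs_le.1 h).2, max_eq_right (abs_le.1 h).1]

theorem abs_clip_sub_le (W x y : ℝ) : |clip W x - clip W y| ≤ |x - y| := by
  have h1 := abs_max_sub_max_le_max (-W) (min W x) (-W) (min W y)
  have h2 := abs_min_sub_min_le_max W x W y
  rw [sub_self, abs_zero, max_eq_right (abs_nonneg (_ : ℝ))] at h1 h2
  exact h1.trans h2

theorem continuous_clip (W : ℝ) : Continuous (clip W) := by unfold clip; fun_prop

/-- The nonlinear part of the truncated profile equation. -/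
noncomputable def drag (W m x y : ℝ) : ℝ :=
  clip W y ^ 2 * (4 * force (max m x) - 2 * clip W y)

theorem abs_force_max_sub_le {m : ℝ} (hm : 0 < m) (x y : ℝ) :
    |force (max m x) - force (max m y)| ≤ (1 / m ^ 3 + 1 / m ^ 2) * |x - y| := by
  refine (abs_force_sub_le hm (le_max_left _ _) (le_max_left _ _)).trans ?_
  have := abs_max_sub_max_le_max m x m y
  rw [sub_self, abs_zero, max_eq_right (abs_nonneg (_ : ℝ))] at this
  gcongr

theorem continuous_force_max {m : ℝ} (hm : 0 < m) : Continuous fun x => force (max m x) :=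
  contDiffOn_force.continuousOn.comp_continuous (by fun_prop)
    fun x => hm.trans_le (le_max_left m x)

/-- Both truncations are needed: `force` is singular at height `0`, and the polynomial in the slope
is cubic, hence not globally Lipschitz. -/
theorem abs_drag_sub_le {m W : ℝ} (hm : 0 < m) (hW : 0 ≤ W) : ∃ L, 0 ≤ L ∧ ∀ x y x' y',
    |drag W m x y - drag W m x' y'| ≤ L * (|x - x'| + |y - y'|) := by
  set K := 1 / m ^ 3 + 1 / m ^ 2
  set G := 1 / m ^ 2 + 1 / m
  have hK : 0 ≤ K := by positivity
  have hG : 0 ≤ G := by positivity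
  refine ⟨4 * W ^ 2 * K + 8 * W * G + 6 * W ^ 2, by positivity, fun x y x' y' => ?_⟩
  have h1 := abs_force_max_sub_le hm x x'
  have h2 := abs_force_le hm (le_max_left m x')
  have h3 := abs_clip_sub_le W y y'
  have h4 := abs_clip_le hW y
  have h5 := abs_clip_le hW y'
  unfold drag
  set f := force (max m x)
  set f' := force (max m x')
  set c := clip W y
  set c' := clip W y'
  have e : c ^ 2 * (4 * f - 2 * c) - c' ^ 2 * (4 * f' - 2 * c')
    = 4 * (c * c) * (f - f') + (4 * (c + c') * f' - 2 * (c * c + c * c' + c' * c')) * (c - c') := by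
    ring
  have hcc : |c * c| ≤ W * W := by rw [abs_mul]; gcongr
  have hcc' : |c * c'| ≤ W * W := by rw [abs_mul]; gcongr
  have hc'c' : |c' * c'| ≤ W * W := by rw [abs_mul]; gcongr
  have h6 : |4 * (c + c') * f' - 2 * (c * c + c * c' + c' * c')| ≤ 8 * W * G + 6 * W ^ 2 := by
    refine (abs_sub _ _).trans (add_le_add ?_ ?_)
    · rw [abs_mul, abs_mul, abs_of_pos (by norm_num : (0 : ℝ) < 4)]
      have : |c + c'| ≤ 2 * W := (abs_add_le _ _).trans (by linarith)
      calc _ ≤ 4 * (2 * W) * G := by gcongr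
        _ = _ := by ring
    · rw [abs_mul, abs_of_pos (by norm_num : (0 : ℝ) < 2)]
      have : |c * c + c * c' + c' * c'| ≤ 3 * (W * W) :=
        (abs_add_le _ _).trans (by linarith [abs_add_le (c * c) (c * c')])
      linarith
  rw [e]
  refine (abs_add_le _ _).trans ?_
  rw [abs_mul, abs_mul, abs_mul (_ - _), abs_of_pos (by norm_num : (0 : ℝ) < 4)]
  calc _ ≤ 4 * (W * W) * (K * |x - x'|) + (8 * W * G + 6 * W ^ 2) * |y - y'| := by
        gcongr
    _ ≤ _ := by
      have := mul_nonneg (by positivity : 0 ≤ 4 * W ^ 2 * K) (abs_nonneg (y - y'))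
      have := mul_nonneg (by positivity : 0 ≤ 8 * W * G + 6 * W ^ 2) (abs_nonneg (x - x'))
      nlinarith

theorem continuous_drag {m : ℝ} (hm : 0 < m) (W : ℝ) :
    Continuous fun p : ℝ × ℝ => drag W m p.1 p.2 := by
  have h1 := (continuous_clip W).comp (continuous_snd (X := ℝ) (Y := ℝ))
  have h2 := (continuous_force_max hm).comp (continuous_fst (X := ℝ) (Y := ℝ))
  exact (h1.pow 2).mul ((h2.const_mul 4).sub (h1.const_mul 2))

/-- A function that decreases whenever it takes the value `B` stays below `B`. -/
theorem le_of_deriv_neg_of_eq {w w' : ℝ → ℝ} {B : ℝ} (hw : Continuous w) (h0 : w 0 < B)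
    (hd : ∀ s > 0, HasDerivAt w (w' s) s) (hneg : ∀ s > 0, w s = B → w' s < 0) :
    ∀ s ≥ 0, w s ≤ B := by
  intro s hs
  rcases hs.eq_or_lt with rfl | hs
  · exact h0.le
  have h1 : ∀ᶠ x in 𝓝[>] (0 : ℝ), w x < B :=
    (hw.continuousAt.eventually (gt_mem_nhds h0)).filter_mono nhdsWithin_le_nhds
  obtain ⟨ε, hε, hε0, hεs⟩ := (h1.and (Ioo_mem_nhdsGT hs)).exists
  exact image_le_of_deriv_right_lt_deriv_boundary (B := fun _ => B) (B' := fun _ => 0)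
    hw.continuousOn (fun x hx => (hd x (hε0.trans_le hx.1)).hasDerivWithinAt) hε.le
    (fun x => hasDerivAt_const x B) (fun x hx => hneg x (hε0.trans_le hx.1)) ⟨hεs.le, le_rfl⟩

theorem hasDerivAt_of_eq_averaged {a : ℝ → ℝ} {b : ℝ → ℝ → ℝ} {z₀ : ℝ} {w : ℝ → ℝ}
    (ha : Continuous a) (hb : Continuous fun p : ℝ × ℝ => b p.1 p.2) (hw : Continuous w)
    (heq : ∀ s, w s = averaged a b z₀ w s) (s : ℝ) :
    HasDerivAt (fun s => s * w s) (a (primitive z₀ w s) + s * b (primitive z₀ w s) (w s)) s := by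
  have hv := continuous_primitive z₀ hw
  have hg : Continuous fun s => a (primitive z₀ w s) + s * b (primitive z₀ w s) (w s) :=
    (ha.comp hv).add (continuous_id.mul (hb.comp (hv.prodMk hw)))
  have e : (fun s => s * w s)
      = fun s => ∫ σ in (0 : ℝ)..s, (a (primitive z₀ w σ) + σ * b (primitive z₀ w σ) (w σ)) := by
    funext s
    rw [← mul_averaged, ← heq]
  rw [e]
  exact integral_hasDerivAt_right (hg.intervalIntegrable _ _)
    hg.aestronglyMeasurable.stronglyMeasurableAtFilter hg.continuousAt

theorem hasDerivAt_of_hasDerivAt_mul {w : ℝ → ℝ} {g s : ℝ} (hs : s ≠ 0)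
    (h : HasDerivAt (fun s => s * w s) g s) : HasDerivAt w ((g - w s) / s) s := by
  refine (((hasDerivAt_inv hs).mul h).congr_of_eventuallyEq ?_).congr_deriv ?_
  · filter_upwards [isOpen_ne.mem_nhds hs] with x hx
    have hx' : x ≠ 0 := hx
    simp [hx']
  · field_simp; ring

/-- The potential of the truncated force. -/
noncomputable def truncPotential (m x : ℝ) : ℝ := ∫ t in (1 : ℝ)..x, -4 * force (max m t)

theorem hasDerivAt_truncPotential {m : ℝ} (hm : 0 < m) (x : ℝ) :
    HasDerivAt (truncPotential m) (-4 * force (max m x)) x := by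
  have hg : Continuous fun t => -4 * force (max m t) := (continuous_force_max hm).const_mul _
  exact integral_hasDerivAt_right (hg.intervalIntegrable _ _)
    hg.aestronglyMeasurable.stronglyMeasurableAtFilter hg.continuousAt

theorem truncPotential_eq {m x : ℝ} (hm : 0 < m) (hm1 : m ≤ 1) (hx : m ≤ x) :
    truncPotential m x = potential x - 2 := by
  have hg : Continuous fun t => -4 * force (max m t) := (continuous_force_max hm).const_mul _
  have h : ∀ t ∈ uIcc 1 x, HasDerivAt potential (-4 * force (max m t)) t := fun t ht => by
    have : m ≤ t := (le_min hm1 hx).trans ht.1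
    rw [max_eq_right this]
    exact hasDerivAt_potential (hm.trans_le this)
  rw [truncPotential, integral_eq_sub_of_hasDerivAt h (hg.intervalIntegrable _ _)]
  simp [potential]

/-- Below `m` the truncated force is the constant `force m > 0`, so the truncated potential still
rises as the height drops, and the energy barrier at `m` also excludes lower heights. -/
theorem truncPotential_le_of_le {m x : ℝ} (hm : 0 < m) (hm1 : m < 1) (hx : x ≤ m) :
    truncPotential m m ≤ truncPotential m x := by
  have h : AntitoneOn (truncPotential m) (Iic m) := by
    refine antitoneOn_of_deriv_nonpos (convex_Iic m)
      (fun y _ => (hasDerivAt_truncPotential hm y).continuousAt.continuousWithinAt)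
      (fun y _ => (hasDerivAt_truncPotential hm y).differentiableAt.differentiableWithinAt)
      fun y hy => ?_
    rw [interior_Iic] at hy
    rw [(hasDerivAt_truncPotential hm y).deriv, max_eq_left hy.le]
    linarith [force_pos hm hm1]
  exact h hx self_mem_Iic hx

/-- A lower barrier for the solution with initial height `z₀`. -/
theorem exists_lower_barrier {z₀ : ℝ} (hz : 0 < z₀) :
    ∃ m, 0 < m ∧ m < 1 ∧ m ≤ z₀ ∧ potential z₀ < potential m := by
  -- With `m = exp (-k)` one has `potential m = 2 exp k - 2 k ≥ 2 + k^2 > k ≥ potential z₀`; the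
  -- summand `|log z₀|` ensures `m ≤ z₀`.
  set k := potential z₀ + |Real.log z₀| with hk
  have hV := two_le_potential hz
  have hl := abs_nonneg (Real.log z₀)
  have hk2 : 2 ≤ k := by linarith
  refine ⟨Real.exp (-k), Real.exp_pos _, by rw [Real.exp_lt_one_iff]; linarith, ?_, ?_⟩
  · rw [← Real.le_log_iff_exp_le hz]
    linarith [neg_abs_le (Real.log z₀)]
  · have h1 := Real.quadratic_le_exp_of_nonneg (by linarith : 0 ≤ k)
    have h2 : potential (Real.exp (-k)) = -2 * k + 2 * Real.exp k := by
      rw [potential, Real.log_exp, Real.exp_neg]; field_simp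
    rw [h2]
    nlinarith

end Horo

/-! ### Global existence of the profile. -/

namespace Horo

/-- The profile equation in the variable `s = r ^ 2`, together with a priori bounds: `v (r ^ 2)` is
the height at distance `r` from the axis. -/
structure IsHeight (z₀ δ m M Q : ℝ) (v : ℝ → ℝ) : Prop where
  delta_pos : 0 < δ
  lower_pos : 0 < m
  contDiffOn : ContDiffOn ℝ ∞ v (Ioi (-δ))
  init : v 0 = z₀
  pos : ∀ s ∈ Ioi (-δ), 0 < v s
  bounds : ∀ s ≥ 0, m ≤ v s ∧ v s ≤ M ∧ 4 * s * deriv v s ^ 2 ≤ Q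
  equation : ∀ s ∈ Ioi (-δ), s * deriv (deriv v) s + deriv v s
    = force (v s) + s * (deriv v s ^ 2 * (4 * force (v s) - 2 * deriv v s))

/-- The truncated equation is solved on all of `ℝ`; a priori bounds then show that neither
truncation is active for `s ≥ 0`, nor, by continuity, for slightly negative `s`. -/
theorem exists_isHeight {z₀ : ℝ} (hz : 0 < z₀) :
    ∃ (v : ℝ → ℝ) (δ m M Q : ℝ), IsHeight z₀ δ m M Q v := by
  obtain ⟨m, hm, hm1, hmz, hpot⟩ := exists_lower_barrier hz
  obtain ⟨G, hG⟩ : ∃ G, G = 1 / m ^ 2 + 1 / m := ⟨_, rfl⟩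
  have hG0 : 0 < G := by rw [hG]; positivity
  have hfG : ∀ x, |force (max m x)| ≤ G := fun x => by
    rw [hG]; exact abs_force_le hm (le_max_left _ _)
  -- Since `|F| ≤ G`, at `w = B` both `F - B` and `4 F - 2 B` are negative, so `w` decreases there
  -- and cannot cross `B`; symmetrically at `-B`. Clipping at `W = B + 1` leaves the strict margin
  -- needed for an open condition.
  obtain ⟨B, hB⟩ : ∃ B, B = 2 * G + 1 := ⟨_, rfl⟩
  obtain ⟨W, hW⟩ : ∃ W, W = B + 1 := ⟨_, rfl⟩
  have hW0 : 0 ≤ W := by linarith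
  obtain ⟨L, hL, hLd⟩ := abs_drag_sub_le hm hW0
  have hfc := continuous_force_max hm
  have hdc := continuous_drag hm W
  obtain ⟨w, hw, heq⟩ : ∃ w : ℝ → ℝ, Continuous w ∧
      ∀ s, w s = averaged (fun x => force (max m x)) (drag W m) z₀ w s := by
    refine exists_eq_averaged z₀ (L := max L (1 / m ^ 3 + 1 / m ^ 2)) (hL.trans (le_max_left _ _))
      hfc hdc (fun x y => (abs_force_max_sub_le hm x y).trans ?_)
      fun x y x' y' => (hLd x y x' y').trans ?_
    · gcongr; exact le_max_right _ _
    · gcongr; exact le_max_left _ _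
  obtain ⟨v, hv⟩ : ∃ v, v = primitive z₀ w := ⟨_, rfl⟩
  have hvd : ∀ s, HasDerivAt v (w s) s := fun s => by rw [hv]; exact hasDerivAt_primitive z₀ hw s
  have hvc : Continuous v := continuous_iff_continuousAt.2 fun s => (hvd s).continuousAt
  have hv0 : v 0 = z₀ := by rw [hv, primitive_zero]
  have hmul : ∀ s, HasDerivAt (fun s => s * w s)
      (force (max m (v s)) + s * drag W m (v s) (w s)) s := fun s => by
    rw [hv]; exact hasDerivAt_of_eq_averaged hfc hdc hw heq s
  have hwd : ∀ s > 0, HasDerivAt w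
      ((force (max m (v s)) + s * drag W m (v s) (w s) - w s) / s) s :=
    fun s hs => hasDerivAt_of_hasDerivAt_mul hs.ne' (hmul s)
  have hw0 : w 0 = force (max m z₀) := by
    rw [heq, averaged]; simp
  have hupper : ∀ s ≥ 0, w s ≤ B := by
    refine le_of_deriv_neg_of_eq hw ?_ hwd fun s hs h => ?_
    · linarith [(abs_le.1 (hfG z₀)).2]
    · have h1 := (abs_le.1 (hfG (v s))).2
      rw [drag, h, clip_of_abs_le (by rw [abs_of_pos] <;> linarith)]
      refine div_neg_of_neg_of_pos ?_ hs
      have h2 : s * (B ^ 2 * (4 * force (max m (v s)) - 2 * B)) ≤ 0 :=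
        mul_nonpos_of_nonneg_of_nonpos hs.le
          (mul_nonpos_of_nonneg_of_nonpos (sq_nonneg B) (by linarith))
      linarith
  have hlower : ∀ s ≥ 0, -w s ≤ B := by
    refine le_of_deriv_neg_of_eq hw.neg ?_ (fun s hs => (hwd s hs).neg) fun s hs h => ?_
    · linarith [(abs_le.1 (hfG z₀)).1]
    · have h1 := (abs_le.1 (hfG (v s))).1
      have h' : w s = -B := by have h : -w s = B := h; linarith
      rw [drag, h', clip_of_abs_le (by rw [abs_neg, abs_of_pos] <;> linarith)]
      refine neg_neg_of_pos (div_pos ?_ hs)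
      have h2 : 0 ≤ s * ((-B) ^ 2 * (4 * force (max m (v s)) - 2 * -B)) :=
        mul_nonneg hs.le (mul_nonneg (sq_nonneg _) (by linarith))
      linarith
  have hwB : ∀ s ≥ 0, |w s| < W := fun s hs =>
    (abs_le.2 ⟨by linarith [hlower s hs], hupper s hs⟩).trans_lt (by linarith)
  -- Here `4 s w^2 = u'^2`. The force terms cancel and only the damping remains, with derivative `-2
  -- w^2` in the variable `s`.
  have henergy : AntitoneOn (fun s => Real.log (1 + 4 * s * w s ^ 2) / 2 + truncPotential m (v s))
      (Ici 0) := by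
    have hpos : ∀ s ≥ 0, 0 < 1 + 4 * s * w s ^ 2 := fun s hs => by
      have : 0 ≤ s := hs
      positivity
    have hd : ∀ s > 0, HasDerivAt
        (fun s => Real.log (1 + 4 * s * w s ^ 2) / 2 + truncPotential m (v s))
        (-2 * w s ^ 2) s := fun s hs => by
      have h1 := hwd s hs
      have h2 : HasDerivAt (fun s => 1 + 4 * s * w s ^ 2) _ s :=
        ((((hasDerivAt_id s).const_mul 4).mul (h1.pow 2)).const_add 1)
      have h3 := (h2.log (hpos s hs.le).ne').div_const 2
      have h4 := (hasDerivAt_truncPotential hm (v s)).comp s (hvd s)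
      refine (h3.add h4).congr_deriv ?_
      have hp := (hpos s hs.le).ne'
      rw [drag, clip_of_abs_le (hwB s hs.le).le]
      simp only [Pi.pow_apply, id]
      field_simp
      ring
    refine antitoneOn_of_deriv_nonpos (convex_Ici 0) ?_ ?_ ?_
    · refine ContinuousOn.add (ContinuousOn.div_const (ContinuousOn.log (by fun_prop)
        fun s hs => (hpos s hs).ne') 2) ?_
      exact ((continuous_iff_continuousAt.2 fun x =>
        (hasDerivAt_truncPotential hm x).continuousAt).comp hvc).continuousOn
    · rw [interior_Ici]
      exact fun s hs => (hd s hs).differentiableAt.differentiableWithinAt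
    · rw [interior_Ici]
      intro s hs
      rw [(hd s hs).deriv]
      nlinarith [sq_nonneg (w s)]
  have hE : ∀ s ≥ 0, Real.log (1 + 4 * s * w s ^ 2) / 2 + truncPotential m (v s)
      ≤ potential z₀ - 2 := fun s hs => by
    have := henergy self_mem_Ici hs hs
    simpa [hv0, truncPotential_eq hm hm1.le hmz] using this
  have hlog : ∀ s ≥ 0, 0 ≤ Real.log (1 + 4 * s * w s ^ 2) := fun s hs =>
    Real.log_nonneg (by have : 0 ≤ s := hs; have := sq_nonneg (w s); nlinarith [mul_nonneg hs this])
  have hvm : ∀ s ≥ 0, m < v s := fun s hs => by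
    by_contra! h
    have h1 := truncPotential_le_of_le hm hm1 h
    rw [truncPotential_eq hm hm1.le le_rfl] at h1
    linarith [hE s hs, hlog s hs]
  have hE' : ∀ s ≥ 0, Real.log (1 + 4 * s * w s ^ 2) / 2 + potential (v s) ≤ potential z₀ :=
    fun s hs => by
      have := hE s hs
      rw [truncPotential_eq hm hm1.le (hvm s hs).le] at this
      linarith
  -- The strict bounds at `s = 0` survive on a small interval to the left, which gives an open
  -- domain around the axis value `s = 0`.
  obtain ⟨δ, hδ, hδO⟩ : ∃ δ > 0, ∀ s ∈ Ioi (-δ), m < v s ∧ |w s| < W := by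
    have h : {s | m < v s ∧ |w s| < W} ∈ 𝓝 (0 : ℝ) :=
      ((isOpen_lt continuous_const hvc).inter (isOpen_lt hw.abs continuous_const)).mem_nhds
        ⟨hvm 0 le_rfl, hwB 0 le_rfl⟩
    obtain ⟨δ, hδ, hsub⟩ := Metric.mem_nhds_iff.1 h
    refine ⟨δ, hδ, fun s hs => ?_⟩
    rcases le_or_gt 0 s with h0 | h0
    · exact ⟨hvm s h0, hwB s h0⟩
    · exact hsub (by
        rw [Metric.mem_ball, Real.dist_eq, sub_zero, abs_of_neg h0]
        simp only [mem_Ioi] at hs; linarith)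
  have hdv : deriv v = w := funext fun s => (hvd s).deriv
  have heq' : ∀ s ∈ Ioi (-δ), w s
      = averaged force (fun x y => y ^ 2 * (4 * force x - 2 * y)) z₀ w s := fun s hs => by
    rw [heq]
    refine intervalIntegral.integral_congr fun t ht => ?_
    rw [uIcc_of_le zero_le_one] at ht
    have hst : s * t ∈ Ioi (-δ) := by
      simp only [mem_Ioi] at hs ⊢
      rcases le_or_gt 0 s with h | h
      · nlinarith [mul_nonneg h ht.1]
      · nlinarith [ht.2, ht.1]
    obtain ⟨h1, h2⟩ := hδO _ hst
    rw [hv] at h1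
    simp only [drag, max_eq_right h1.le, clip_of_abs_le h2.le]
  have hsmooth : ContDiffOn ℝ ∞ w (Ioi (-δ)) := by
    refine contDiffOn_of_eq_averaged hδ hw (P := Ioi 0) contDiffOn_force ?_ (fun s hs => ?_) heq'
    · have h1 : ContDiffOn ℝ ∞ (fun p : ℝ × ℝ => force p.1) (Ioi 0 ×ˢ univ) :=
        contDiffOn_force.comp contDiffOn_fst fun p hp => hp.1
      fun_prop
    · rw [← hv]; exact hm.trans (hδO s hs).1
  have hvs : ContDiffOn ℝ ∞ v (Ioi (-δ)) := by
    rw [contDiffOn_infty_iff_deriv_of_isOpen isOpen_Ioi, hdv]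
    exact ⟨fun s _ => (hvd s).differentiableAt.differentiableWithinAt, hsmooth⟩
  -- The upper bounds come from the energy: `2 log v ≤ V(z₀)` because `2 / v > 0`, and `log (1 +
  -- u'^2) / 2 ≤ V(z₀)` because `V ≥ 0`.
  refine ⟨v, δ, m, Real.exp (potential z₀ / 2), Real.exp (2 * potential z₀),
    ⟨hδ, hm, hvs, hv0, fun s hs => hm.trans (hδO s hs).1, fun s hs => ?_, fun s hs => ?_⟩⟩
  · have hvp : 0 < v s := hm.trans (hvm s hs)
    refine ⟨(hvm s hs).le, ?_, ?_⟩
    · rw [← Real.log_le_iff_le_exp hvp]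
      have h1 : 0 < 2 / v s := by positivity
      have h2 := hE' s hs
      rw [potential] at h2
      linarith [hlog s hs]
    · rw [hdv]
      have hp : 0 < 1 + 4 * s * w s ^ 2 := by
        have : 0 ≤ s := hs
        positivity
      have h1 : 1 + 4 * s * w s ^ 2 ≤ Real.exp (2 * potential z₀) := by
        rw [← Real.log_le_iff_le_exp hp]
        linarith [hE' s hs, two_le_potential hvp]
      linarith
  · rw [hdv]
    have hd : HasDerivAt w (deriv w s) s :=
      ((hsmooth.differentiableOn (by simp)).differentiableAt (isOpen_Ioi.mem_nhds hs)).hasDerivAt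
    have h1 := (hmul s).unique ((hasDerivAt_id s).mul hd)
    obtain ⟨h2, h3⟩ := hδO s hs
    rw [drag, max_eq_right h2.le, clip_of_abs_le h3.le] at h1
    simp only [id] at h1
    linarith

end Horo

/-! ### Uniqueness for the first-order system, from either endpoint. -/

namespace Horo

/-- Grönwall: `exp (-K r) D` is nonincreasing, starts at `0` and is nonnegative. -/
theorem eq_zero_of_deriv_le {D D' : ℝ → ℝ} {a b K : ℝ} (hc : ContinuousOn D (Icc a b))
    (hd : ∀ r ∈ Ioo a b, HasDerivAt D (D' r) r) (hle : ∀ r ∈ Ioo a b, D' r ≤ K * D r)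
    (h0 : D a = 0) (hD : ∀ r ∈ Icc a b, 0 ≤ D r) : ∀ r ∈ Icc a b, D r = 0 := by
  have hd' : ∀ r ∈ Ioo a b, HasDerivAt (fun r => Real.exp (-K * r) * D r)
      (Real.exp (-K * r) * (D' r - K * D r)) r := fun r hr => by
    refine (((hasDerivAt_id r).const_mul (-K)).exp.mul (hd r hr)).congr_deriv ?_
    simp only [id]; ring
  have h : AntitoneOn (fun r => Real.exp (-K * r) * D r) (Icc a b) := by
    refine antitoneOn_of_deriv_nonpos (convex_Icc a b)
      (ContinuousOn.mul (by fun_prop) hc) ?_ ?_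
    · rw [interior_Icc]
      exact fun r hr => (hd' r hr).differentiableAt.differentiableWithinAt
    · rw [interior_Icc]
      intro r hr
      rw [(hd' r hr).deriv]
      exact mul_nonpos_of_nonneg_of_nonpos (Real.exp_pos _).le (by linarith [hle r hr])
  intro r hr
  have h1 := h (left_mem_Icc.2 (hr.1.trans hr.2)) hr hr.1
  simp only [h0, mul_zero] at h1
  have h2 := Real.exp_pos (-K * r)
  exact le_antisymm (by by_contra! h3; nlinarith [mul_pos h2 h3]) (hD r hr)

theorem eq_zero_of_le_deriv {D D' : ℝ → ℝ} {a b K : ℝ} (hc : ContinuousOn D (Icc a b))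
    (hd : ∀ r ∈ Ioo a b, HasDerivAt D (D' r) r) (hle : ∀ r ∈ Ioo a b, -K * D r ≤ D' r)
    (h0 : D b = 0) (hD : ∀ r ∈ Icc a b, 0 ≤ D r) : ∀ r ∈ Icc a b, D r = 0 := by
  have hmem : ∀ {r}, r ∈ Icc (-b) (-a) → -r ∈ Icc a b := fun h =>
    ⟨by linarith [h.2], by linarith [h.1]⟩
  have h := eq_zero_of_deriv_le (D := fun r => D (-r)) (D' := fun r => -D' (-r)) (a := -b)
    (b := -a) (K := K) (hc.comp (by fun_prop) fun r hr => hmem hr)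
    (fun r hr => by
      have := (hd (-r) ⟨by linarith [hr.2], by linarith [hr.1]⟩).comp r (hasDerivAt_neg r)
      exact this.congr_deriv (by ring))
    (fun r hr => by linarith [hle (-r) ⟨by linarith [hr.2], by linarith [hr.1]⟩])
    (by simpa using h0) fun r hr => hD _ (hmem hr)
  intro r hr
  simpa using h (-r) ⟨by linarith [hr.2], by linarith [hr.1]⟩

/-- `(u, q)` is a positive solution of the first-order system of the profile equation on
`[a, b]`. -/
structure IsSolution (a b : ℝ) (u q : ℝ → ℝ) : Prop where
  continuousOn : ContinuousOn u (Icc a b)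
  continuousOn_deriv : ContinuousOn q (Icc a b)
  pos : ∀ r ∈ Icc a b, 0 < u r
  hasDerivAt : ∀ r ∈ Ioo a b, HasDerivAt u (q r) r
  hasDerivAt_deriv : ∀ r ∈ Ioo a b,
    HasDerivAt q ((1 + q r ^ 2) * (4 * force (u r) - q r / r)) r

/-- The difference of two solutions solves a linear system with bounded coefficients and
a damping term. -/
theorem IsSolution.exists_linear {a b : ℝ} {u₁ q₁ u₂ q₂ : ℝ → ℝ}
    (h₁ : IsSolution a b u₁ q₁) (h₂ : IsSolution a b u₂ q₂) :
    ∃ (C : ℝ) (k₁ k₂ k₃ : ℝ → ℝ), 0 ≤ C ∧ (∀ r ∈ Icc a b, |k₁ r| ≤ C ∧ |k₂ r| ≤ C ∧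
      0 ≤ k₃ r ∧ k₃ r ≤ C) ∧ ∀ r ∈ Ioo a b, HasDerivAt (fun r => q₁ r - q₂ r)
        (k₁ r * (u₁ r - u₂ r) + (k₂ r - k₃ r / r) * (q₁ r - q₂ r)) r := by
  have c1 := h₁.continuousOn
  have c2 := h₂.continuousOn
  have d1 := h₁.continuousOn_deriv
  have d2 := h₂.continuousOn_deriv
  obtain ⟨k, hk⟩ : ∃ k : ℝ → ℝ, k = fun r => 1 / (u₁ r * u₂ r) / 2
    - 1 / (u₁ r * u₂ r ^ 2) / 2 - 1 / (u₁ r ^ 2 * u₂ r) / 2 := ⟨_, rfl⟩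
  have hkc : ContinuousOn k (Icc a b) := by
    rw [hk]
    refine ContinuousOn.sub (ContinuousOn.sub ?_ ?_) ?_ <;>
    refine ContinuousOn.div_const (ContinuousOn.div (by fun_prop) (by fun_prop) fun r hr => ?_) 2 <;>
    · have := h₁.pos r hr
      have := h₂.pos r hr
      positivity
  have hf : ContinuousOn (fun r => force (u₂ r)) (Icc a b) :=
    contDiffOn_force.continuousOn.comp c2 fun r hr => h₂.pos r hr
  obtain ⟨C₁, hC₁⟩ := isCompact_Icc.exists_bound_of_continuousOn
    (f := fun r => 4 * (1 + q₁ r ^ 2) * k r) (s := Icc a b) (by fun_prop)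
  obtain ⟨C₂, hC₂⟩ := isCompact_Icc.exists_bound_of_continuousOn
    (f := fun r => 4 * force (u₂ r) * (q₁ r + q₂ r)) (s := Icc a b) (by fun_prop)
  obtain ⟨C₃, hC₃⟩ := isCompact_Icc.exists_bound_of_continuousOn
    (f := fun r => 1 + q₁ r ^ 2 + q₁ r * q₂ r + q₂ r ^ 2) (s := Icc a b) (by fun_prop)
  refine ⟨max 0 (max C₁ (max C₂ C₃)), _, _, _, le_max_left _ _, fun r hr =>
    ⟨(hC₁ r hr).trans (by simp), (hC₂ r hr).trans (by simp), ?_,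
      (le_abs_self _).trans ((hC₃ r hr).trans (by simp))⟩, fun r hr => ?_⟩
  · nlinarith [sq_nonneg (q₁ r + q₂ r), sq_nonneg (q₁ r), sq_nonneg (q₂ r)]
  · refine ((h₁.hasDerivAt_deriv r hr).sub (h₂.hasDerivAt_deriv r hr)).congr_deriv ?_
    have p1 := h₁.pos r (Ioo_subset_Icc_self hr)
    have p2 := h₂.pos r (Ioo_subset_Icc_self hr)
    have e : force (u₁ r) - force (u₂ r) = k r * (u₁ r - u₂ r) := by
      rw [hk, force, force]; field_simp; ring
    have e1 : force (u₁ r) = k r * (u₁ r - u₂ r) + force (u₂ r) := by linarith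
    rw [e1]
    ring

/-- Grönwall for the squared distance of the two solutions. The singular coefficient `-k₃ / r` with
`k₃ ≥ 0` only decreases that distance when moving outwards, which is why `a = 0` is allowed. -/
theorem IsSolution.eqOn_of_left {a b : ℝ} {u₁ q₁ u₂ q₂ : ℝ → ℝ} (ha : 0 ≤ a)
    (h₁ : IsSolution a b u₁ q₁) (h₂ : IsSolution a b u₂ q₂) (hu : u₁ a = u₂ a)
    (hq : q₁ a = q₂ a) : ∀ r ∈ Icc a b, u₁ r = u₂ r := by
  obtain ⟨C, k₁, k₂, k₃, hC, hk, hd⟩ := h₁.exists_linear h₂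
  have hc := h₁.continuousOn.sub h₂.continuousOn
  have hc' := h₁.continuousOn_deriv.sub h₂.continuousOn_deriv
  have key := eq_zero_of_deriv_le (D := fun r => (u₁ r - u₂ r) ^ 2 + (q₁ r - q₂ r) ^ 2) (a := a)
    (b := b) (K := 1 + 3 * C) ((hc.pow 2).add (hc'.pow 2))
    (fun r hr => (((h₁.hasDerivAt r hr).sub (h₂.hasDerivAt r hr)).pow 2).add ((hd r hr).pow 2))
    (fun r hr => ?_) (by simp [hu, hq]) (fun r _ => by positivity)
  · intro r hr
    have := key r hr
    nlinarith [sq_nonneg (u₁ r - u₂ r), sq_nonneg (q₁ r - q₂ r)]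
  · obtain ⟨h1, h2, h3, -⟩ := hk r (Ioo_subset_Icc_self hr)
    have h4 : 0 ≤ k₃ r / r := div_nonneg h3 (ha.trans hr.1.le)
    simp only [Pi.sub_apply]
    set x := u₁ r - u₂ r
    set y := q₁ r - q₂ r
    have h5 : k₁ r * (2 * x * y) ≤ C * (x ^ 2 + y ^ 2) := by
      refine (le_abs_self _).trans ?_
      rw [abs_mul]
      gcongr
      rw [abs_le]; constructor <;> nlinarith [sq_nonneg (x + y), sq_nonneg (x - y)]
    have h6 : k₂ r * y ^ 2 ≤ C * y ^ 2 := by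
      gcongr; exact (le_abs_self _).trans h2
    have h7 : 0 ≤ k₃ r / r * y ^ 2 := by positivity
    have h8 : 0 ≤ C * x ^ 2 := by positivity
    norm_num
    nlinarith [sq_nonneg (x - y)]

/-- Moving inwards the damping works against the estimate; it is controlled only by `k₃ / r ≤ C /
a`, hence the requirement `0 < a`. -/
theorem IsSolution.eqOn_of_right {a b : ℝ} {u₁ q₁ u₂ q₂ : ℝ → ℝ} (ha : 0 < a)
    (h₁ : IsSolution a b u₁ q₁) (h₂ : IsSolution a b u₂ q₂) (hu : u₁ b = u₂ b)
    (hq : q₁ b = q₂ b) : ∀ r ∈ Icc a b, u₁ r = u₂ r := by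
  obtain ⟨C, k₁, k₂, k₃, hC, hk, hd⟩ := h₁.exists_linear h₂
  have hc := h₁.continuousOn.sub h₂.continuousOn
  have hc' := h₁.continuousOn_deriv.sub h₂.continuousOn_deriv
  have key := eq_zero_of_le_deriv (D := fun r => (u₁ r - u₂ r) ^ 2 + (q₁ r - q₂ r) ^ 2) (a := a)
    (b := b) (K := 1 + 3 * C + 2 * (C / a)) ((hc.pow 2).add (hc'.pow 2))
    (fun r hr => (((h₁.hasDerivAt r hr).sub (h₂.hasDerivAt r hr)).pow 2).add ((hd r hr).pow 2))
    (fun r hr => ?_) (by simp [hu, hq]) (fun r _ => by positivity)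
  · intro r hr
    have := key r hr
    nlinarith [sq_nonneg (u₁ r - u₂ r), sq_nonneg (q₁ r - q₂ r)]
  · obtain ⟨h1, h2, h3, h3'⟩ := hk r (Ioo_subset_Icc_self hr)
    have h4 : k₃ r / r ≤ C / a := by gcongr; exact hr.1.le
    simp only [Pi.sub_apply]
    set x := u₁ r - u₂ r
    set y := q₁ r - q₂ r
    have h5 : -(C * (x ^ 2 + y ^ 2)) ≤ k₁ r * (2 * x * y) := by
      refine neg_le.1 ((neg_le_abs _).trans ?_)
      rw [abs_mul]
      gcongr
      rw [abs_le]; constructor <;> nlinarith [sq_nonneg (x + y), sq_nonneg (x - y)]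
    have h6 : -(C * y ^ 2) ≤ k₂ r * y ^ 2 := by
      have := (abs_le.1 h2).1
      nlinarith [sq_nonneg y]
    have h7 : k₃ r / r * y ^ 2 ≤ C / a * y ^ 2 := by gcongr
    have h8 : 0 ≤ C * x ^ 2 := by positivity
    have h9 : 0 ≤ C / a * x ^ 2 := by positivity
    norm_num
    nlinarith [sq_nonneg (x + y)]

end Horo

/-! ### The surfaces `bowl z₀` as entire graphs; behaviour at the axis. -/

namespace Horo

namespace IsHeight

variable {z₀ δ m M Q : ℝ} {v : ℝ → ℝ}

theorem mem_of_nonneg (h : IsHeight z₀ δ m M Q v) {s : ℝ} (hs : 0 ≤ s) : s ∈ Ioi (-δ) := by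
  have := h.delta_pos
  simp only [mem_Ioi]; linarith

theorem hasDerivAt (h : IsHeight z₀ δ m M Q v) {s : ℝ} (hs : s ∈ Ioi (-δ)) : HasDerivAt v (deriv v s) s :=
  ((h.contDiffOn.differentiableOn (by simp)).differentiableAt (isOpen_Ioi.mem_nhds hs)).hasDerivAt

theorem contDiffOn_deriv (h : IsHeight z₀ δ m M Q v) : ContDiffOn ℝ ∞ (deriv v) (Ioi (-δ)) :=
  (((contDiffOn_infty_iff_deriv_of_isOpen isOpen_Ioi)).1 h.contDiffOn).2

theorem hasDerivAt_deriv (h : IsHeight z₀ δ m M Q v) {s : ℝ} (hs : s ∈ Ioi (-δ)) :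
    HasDerivAt (deriv v) (deriv (deriv v) s) s :=
  ((h.contDiffOn_deriv.differentiableOn (by simp)).differentiableAt
    (isOpen_Ioi.mem_nhds hs)).hasDerivAt

theorem contDiff_comp (h : IsHeight z₀ δ m M Q v) {E : Type*} [NormedAddCommGroup E] [NormedSpace ℝ E] {f : E → ℝ}
    (hf : ContDiff ℝ ∞ f) (h0 : ∀ x, 0 ≤ f x) : ContDiff ℝ ∞ fun x => v (f x) := by
  rw [← contDiffOn_univ]
  exact h.contDiffOn.comp hf.contDiffOn fun x _ => h.mem_of_nonneg (h0 x)

theorem contDiff_deriv_comp (h : IsHeight z₀ δ m M Q v) {E : Type*} [NormedAddCommGroup E] [NormedSpace ℝ E] {f : E → ℝ}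
    (hf : ContDiff ℝ ∞ f) (h0 : ∀ x, 0 ≤ f x) : ContDiff ℝ ∞ fun x => deriv v (f x) := by
  rw [← contDiffOn_univ]
  exact h.contDiffOn_deriv.comp hf.contDiffOn fun x _ => h.mem_of_nonneg (h0 x)

theorem contDiff_sq (h : IsHeight z₀ δ m M Q v) : ContDiff ℝ ∞ fun r : ℝ => v (r ^ 2) :=
  h.contDiff_comp (f := fun r : ℝ => r ^ 2) (by fun_prop) fun r => sq_nonneg r

theorem hasDerivAt_sq (h : IsHeight z₀ δ m M Q v) (r : ℝ) : HasDerivAt (fun r => v (r ^ 2)) (2 * r * deriv v (r ^ 2)) r := by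
  have h1 := HasDerivAt.comp (h := fun r : ℝ => r ^ 2) r
    (h.hasDerivAt (h.mem_of_nonneg (sq_nonneg r))) (hasDerivAt_pow 2 r)
  refine h1.congr_deriv ?_
  push_cast; ring

theorem hasDerivAt_deriv_sq (h : IsHeight z₀ δ m M Q v) (r : ℝ) : HasDerivAt (fun r => 2 * r * deriv v (r ^ 2))
    (2 * deriv v (r ^ 2) + 4 * (r ^ 2 * deriv (deriv v) (r ^ 2))) r := by
  have h1 := HasDerivAt.comp (h := fun r : ℝ => r ^ 2) r
    (h.hasDerivAt_deriv (h.mem_of_nonneg (sq_nonneg r))) (hasDerivAt_pow 2 r)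
  refine (((hasDerivAt_id r).const_mul 2).mul h1).congr_deriv ?_
  simp only [id, Function.comp]
  push_cast; ring

theorem second_deriv_eq (h : IsHeight z₀ δ m M Q v) {r : ℝ} (hr : r ≠ 0) :
    2 * deriv v (r ^ 2) + 4 * (r ^ 2 * deriv (deriv v) (r ^ 2))
      = (1 + (2 * r * deriv v (r ^ 2)) ^ 2)
        * (4 * force (v (r ^ 2)) - 2 * r * deriv v (r ^ 2) / r) := by
  have h1 := h.equation _ (h.mem_of_nonneg (sq_nonneg r))
  have h2 : 2 * r * deriv v (r ^ 2) / r = 2 * deriv v (r ^ 2) := by field_simp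
  rw [h2]
  linear_combination 4 * h1

theorem isSolution (h : IsHeight z₀ δ m M Q v) {a : ℝ} (ha : 0 ≤ a) (b : ℝ) :
    IsSolution a b (fun r => v (r ^ 2)) (fun r => 2 * r * deriv v (r ^ 2)) where
  continuousOn := h.contDiff_sq.continuous.continuousOn
  continuousOn_deriv := fun r _ => (h.hasDerivAt_deriv_sq r).continuousAt.continuousWithinAt
  pos := fun r _ => h.pos _ (h.mem_of_nonneg (sq_nonneg r))
  hasDerivAt := fun r _ => h.hasDerivAt_sq r
  hasDerivAt_deriv := fun r hr => by
    have := h.hasDerivAt_deriv_sq r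
    rwa [h.second_deriv_eq (ha.trans_lt hr.1).ne'] at this

theorem derivWithin_sq (h : IsHeight z₀ δ m M Q v) {J : Set ℝ} (hJ : UniqueDiffOn ℝ J) {r : ℝ} (hr : r ∈ J) :
    derivWithin (fun r => v (r ^ 2)) J r = 2 * r * deriv v (r ^ 2) :=
  (h.hasDerivAt_sq r).hasDerivWithinAt.derivWithin (hJ r hr)

theorem derivWithin_derivWithin_sq (h : IsHeight z₀ δ m M Q v) {J : Set ℝ} (hJ : UniqueDiffOn ℝ J) {r : ℝ} (hr : r ∈ J) :
    derivWithin (derivWithin (fun r => v (r ^ 2)) J) J r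
      = 2 * deriv v (r ^ 2) + 4 * (r ^ 2 * deriv (deriv v) (r ^ 2)) := by
  rw [derivWithin_congr (fun x hx => h.derivWithin_sq hJ hx) (h.derivWithin_sq hJ hr)]
  exact (h.hasDerivAt_deriv_sq r).hasDerivWithinAt.derivWithin (hJ r hr)

theorem isProfile (h : IsHeight z₀ δ m M Q v) {J : Set ℝ} (hJ : UniqueDiffOn ℝ J) (h0 : 0 ∈ J) :
    IsProfile z₀ J fun r => v (r ^ 2) where
  contDiffOn := (h.contDiff_sq.of_le ENat.LEInfty.out).contDiffOn
  pos := fun r _ => h.pos _ (h.mem_of_nonneg (sq_nonneg r))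
  init := by simpa using h.init
  init_deriv := by simp [h.derivWithin_sq hJ h0]
  ode := fun r hr hr0 => by
    rw [h.derivWithin_derivWithin_sq hJ hr, h.derivWithin_sq hJ hr, h.second_deriv_eq hr0.ne']
    have : 0 < v (r ^ 2) := h.pos _ (h.mem_of_nonneg (sq_nonneg r))
    rw [force]
    field_simp
    ring

end IsHeight

theorem IsProfile.isSolution {z₀ R b : ℝ} {u : ℝ → ℝ} (hu : IsProfile z₀ (Ico 0 R) u)
    (hb : b < R) : IsSolution 0 b u (derivWithin u (Ico 0 R)) := by
  have hsub : Icc 0 b ⊆ Ico 0 R := fun x hx => ⟨hx.1, hx.2.trans_lt hb⟩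
  have hmem : ∀ r ∈ Ioo 0 b, r ∈ Ico 0 R := fun r hr => hsub (Ioo_subset_Icc_self hr)
  have hnhds : ∀ r ∈ Ioo 0 b, Ico 0 R ∈ 𝓝 r := fun r hr => Ico_mem_nhds hr.1 (hr.2.trans hb)
  have hd := (contDiffOn_succ_iff_derivWithin (n := 1) (uniqueDiffOn_Ico 0 R)).1
    (by simpa [one_add_one_eq_two] using hu.contDiffOn)
  refine ⟨hu.contDiffOn.continuousOn.mono hsub, hd.2.2.continuousOn.mono hsub,
    fun r hr => hu.pos r (hsub hr), fun r hr => ?_, fun r hr => ?_⟩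
  · exact ((hd.1 r (hmem r hr)).hasDerivWithinAt).hasDerivAt (hnhds r hr)
  · have h1 := ((hd.2.2.differentiableOn one_ne_zero r (hmem r hr)).hasDerivWithinAt).hasDerivAt
      (hnhds r hr)
    refine h1.congr_deriv ?_
    have h2 := hu.ode r (hmem r hr) hr.1
    have h3 : 0 < 1 + derivWithin u (Ico 0 R) r ^ 2 := by positivity
    have h4 := hu.pos r (hmem r hr)
    have h5 : 4 * force (u r) = 2 * ((1 - u r) / u r ^ 2) := by
      rw [force]; field_simp; ring
    rw [h5, ← h2]
    field_simp
    ring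

theorem IsHeight.eq_of_isProfile {z₀ δ m M Q : ℝ} {v : ℝ → ℝ} (h : IsHeight z₀ δ m M Q v) {R : ℝ}
    {u : ℝ → ℝ} (hu : IsProfile z₀ (Ico 0 R) u) {r : ℝ} (hr : r ∈ Ico 0 R) : u r = v (r ^ 2) := by
  obtain ⟨b, hb, hbR⟩ := exists_between hr.2
  refine (hu.isSolution hbR).eqOn_of_left le_rfl (h.isSolution le_rfl b) ?_ ?_ r ⟨hr.1, hb.le⟩
  · simpa [h.init] using hu.init
  · simpa using hu.init_deriv

theorem radius_nonneg (p : Space) : 0 ≤ radius p := Real.sqrt_nonneg _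

theorem radius_sq (p : Space) : radius p ^ 2 = p 0 ^ 2 + p 1 ^ 2 := Real.sq_sqrt (by positivity)

/-- Uniqueness from the singular endpoint `r = 0` identifies all solutions on all intervals `[0, R)`
with the one global profile, so the union collapses to a single graph. -/
theorem IsHeight.bowl_eq {z₀ δ m M Q : ℝ} {v : ℝ → ℝ} (h : IsHeight z₀ δ m M Q v) :
    bowl z₀ = {p | p 2 = v (p 0 ^ 2 + p 1 ^ 2)} := by
  ext p
  simp only [mem_ofPred_eq, bowl, ← radius_sq]
  constructor
  · rintro ⟨R, u, hu, hR, hp⟩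
    rw [hp, h.eq_of_isProfile hu ⟨radius_nonneg p, hR⟩]
  · intro hp
    have := radius_nonneg p
    exact ⟨radius p + 1, _, h.isProfile (uniqueDiffOn_Ico 0 _) ⟨le_rfl, by linarith⟩,
      by linarith, hp⟩

theorem bowl_inter_axis {z₀ : ℝ} (hz : 0 < z₀) : bowl z₀ ∩ axis = {!₂[0, 0, z₀]} := by
  obtain ⟨v, δ, m, M, Q, h⟩ := exists_isHeight hz
  rw [h.bowl_eq]
  ext p
  simp only [axis, mem_inter_iff, mem_ofPred_eq, mem_singleton_iff]
  constructor
  · rintro ⟨h1, h2, h3, -⟩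
    rw [h2, h3] at h1
    ext i
    fin_cases i <;> simp [h2, h3, h1, h.init]
  · rintro rfl
    simp [h.init, hz]

theorem isSolution_one (a b : ℝ) : IsSolution a b (fun _ => 1) (fun _ => 0) where
  continuousOn := continuousOn_const
  continuousOn_deriv := continuousOn_const
  pos := fun _ _ => one_pos
  hasDerivAt := fun r _ => hasDerivAt_const r 1
  hasDerivAt_deriv := fun r _ => by simpa [force] using hasDerivAt_const r (0 : ℝ)

theorem bowl_one : bowl 1 = horosphereOne := by
  obtain ⟨v, δ, m, M, Q, h⟩ := exists_isHeight one_pos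
  rw [h.bowl_eq]
  ext p
  have h1 := (h.isSolution le_rfl (radius p)).eqOn_of_left le_rfl (isSolution_one 0 _)
    (by simp [h.init]) (by simp) (radius p) ⟨radius_nonneg p, le_rfl⟩
  rw [radius_sq] at h1
  simp only [horosphereOne, mem_ofPred_eq, h1]

/-- A non-constant profile never touches the height `1` horizontally. -/
theorem IsHeight.ne_of_deriv_eq_zero {z₀ δ m M Q : ℝ} {v : ℝ → ℝ} (h : IsHeight z₀ δ m M Q v)
    (hz : z₀ ≠ 1) {r : ℝ} (hr : 0 ≤ r) (hq : 2 * r * deriv v (r ^ 2) = 0) : v (r ^ 2) ≠ 1 := by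
  intro h1
  rcases hr.eq_or_lt with rfl | hr
  · exact hz (by simpa [h.init] using h1)
  -- Backward uniqueness against the constant solution `1` reaches every positive radius but not
  -- `0`; the value at the axis follows by continuity.
  have key : ∀ x ∈ Ioc 0 r, v (x ^ 2) = 1 := fun x hx =>
    (h.isSolution hx.1.le r).eqOn_of_right hx.1 (isSolution_one x r) h1 hq x ⟨le_rfl, hx.2⟩
  have hc : Tendsto (fun x : ℝ => v (x ^ 2)) (𝓝[>] 0) (𝓝 z₀) := by
    have := (h.contDiff_sq.continuous.tendsto 0).mono_left (nhdsWithin_le_nhds (s := Ioi 0))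
    simpa [h.init] using this
  refine hz (tendsto_nhds_unique (hc.congr' ?_) tendsto_const_nhds)
  filter_upwards [Ioc_mem_nhdsGT hr] with x hx using key x hx

theorem IsHeight.second_deriv_zero {z₀ δ m M Q : ℝ} {v : ℝ → ℝ} (h : IsHeight z₀ δ m M Q v) :
    derivWithin (derivWithin (fun r => v (r ^ 2)) (Ici 0)) (Ici 0) 0 = 2 * force z₀ := by
  have h1 := h.equation 0 (h.mem_of_nonneg le_rfl)
  rw [h.derivWithin_derivWithin_sq (uniqueDiffOn_Ici 0) self_mem_Ici]
  simp only [zero_mul, zero_add, add_zero, h.init] at h1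
  simp [h1]

theorem IsHeight.continuous_second_deriv {z₀ δ m M Q : ℝ} {v : ℝ → ℝ}
    (h : IsHeight z₀ δ m M Q v) : Continuous (deriv^[2] fun r => v (r ^ 2)) := by
  have h1 : ContDiff ℝ 2 fun r : ℝ => v (r ^ 2) := h.contDiff_sq.of_le ENat.LEInfty.out
  have := h1.continuous_iteratedDeriv 2 le_rfl
  rwa [iteratedDeriv_eq_iterate] at this

theorem IsHeight.iterate_deriv_zero {z₀ δ m M Q : ℝ} {v : ℝ → ℝ} (h : IsHeight z₀ δ m M Q v) :
    deriv^[2] (fun r => v (r ^ 2)) 0 = 2 * force z₀ := by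
  have h1 := h.equation 0 (h.mem_of_nonneg le_rfl)
  simp only [zero_mul, zero_add, add_zero, h.init] at h1
  have h2 : deriv (fun r => v (r ^ 2)) = fun r => 2 * r * deriv v (r ^ 2) :=
    funext fun r => (h.hasDerivAt_sq r).deriv
  simp only [Function.iterate_succ, Function.iterate_zero, Function.comp, id, h2]
  rw [(h.hasDerivAt_deriv_sq 0).deriv]
  simp [h1]

theorem IsHeight.strictConvexOn {z₀ δ m M Q : ℝ} {v : ℝ → ℝ} (h : IsHeight z₀ δ m M Q v)
    (hz : 0 < z₀) (hz1 : z₀ < 1) : ∃ ε > 0, StrictConvexOn ℝ (Ico 0 ε) fun r => v (r ^ 2) := by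
  have h1 : ∀ᶠ r in 𝓝 (0 : ℝ), 0 < deriv^[2] (fun r => v (r ^ 2)) r :=
    h.continuous_second_deriv.continuousAt.eventually (lt_mem_nhds (by
      rw [h.iterate_deriv_zero]; linarith [force_pos hz hz1]))
  obtain ⟨ε, hε, hsub⟩ := Metric.eventually_nhds_iff.1 h1
  refine ⟨ε, hε, strictConvexOn_of_deriv2_pos (convex_Ico 0 ε)
    h.contDiff_sq.continuous.continuousOn fun x hx => hsub ?_⟩
  rw [interior_Ico] at hx
  rw [Real.dist_eq, sub_zero, abs_of_pos hx.1]
  exact hx.2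

theorem IsHeight.strictConcaveOn {z₀ δ m M Q : ℝ} {v : ℝ → ℝ} (h : IsHeight z₀ δ m M Q v)
    (hz1 : 1 < z₀) : ∃ ε > 0, StrictConcaveOn ℝ (Ico 0 ε) fun r => v (r ^ 2) := by
  have h1 : ∀ᶠ r in 𝓝 (0 : ℝ), deriv^[2] (fun r => v (r ^ 2)) r < 0 :=
    h.continuous_second_deriv.continuousAt.eventually (gt_mem_nhds (by
      rw [h.iterate_deriv_zero]; linarith [force_neg hz1]))
  obtain ⟨ε, hε, hsub⟩ := Metric.eventually_nhds_iff.1 h1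
  refine ⟨ε, hε, strictConcaveOn_of_deriv2_neg (convex_Ico 0 ε)
    h.contDiff_sq.continuous.continuousOn fun x hx => hsub ?_⟩
  rw [interior_Ico] at hx
  rw [Real.dist_eq, sub_zero, abs_of_pos hx.1]
  exact hx.2

end Horo

/-! ### Oscillation around height `1`. -/

namespace Horo

theorem eventually_pos_of_hasDerivAt_pos {p : ℝ → ℝ} {x d : ℝ} (h0 : p x = 0)
    (hd : HasDerivAt p d x) (hpos : 0 < d) : ∀ᶠ r in 𝓝[>] x, 0 < p r := by
  have h := (hasDerivAt_iff_tendsto_slope.1 hd).mono_left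
    (nhdsWithin_mono (s := Ioi x) x (fun r hr => ne_of_gt hr))
  filter_upwards [h.eventually (lt_mem_nhds hpos), self_mem_nhdsWithin] with r h1 h2
  have h2' : x < r := h2
  rw [slope_def_field, h0, sub_zero] at h1
  exact (div_pos_iff_of_pos_right (by linarith)).1 h1

theorem deriv_nonpos_of_pos_left {p : ℝ → ℝ} {a x d : ℝ} (hax : a < x) (h0 : p x = 0)
    (hpos : ∀ r ∈ Ioo a x, 0 < p r) (hd : HasDerivAt p d x) : d ≤ 0 := by
  have h := (hasDerivAt_iff_tendsto_slope.1 hd).mono_left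
    (nhdsWithin_mono (s := Iio x) x (fun r hr => ne_of_lt hr))
  refine le_of_tendsto h ?_
  filter_upwards [Ioo_mem_nhdsLT hax] with r hr
  rw [slope_def_field, h0, sub_zero]
  exact div_nonpos_of_nonneg_of_nonpos (hpos r hr).le (by linarith [hr.2])

/-- A bounded function cannot have a derivative bounded below by a positive constant on
a half-line. -/
theorem not_bounded_of_le_deriv {f f' : ℝ → ℝ} {a c B : ℝ} (hc : 0 < c)
    (hd : ∀ r > a, HasDerivAt f (f' r) r) (hf : ∀ r > a, c ≤ f' r) : ¬ ∀ r > a, |f r| ≤ B := by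
  intro hB
  have hB0 : 0 ≤ B := (abs_nonneg _).trans (hB (a + 1) (by linarith))
  have h1 : ∀ r ≥ a + 1, c * (r - (a + 1)) ≤ f r - f (a + 1) := fun r hr => by
    refine (convex_Icc (a + 1) r).mul_sub_le_image_sub_of_le_deriv (f := f)
      (fun x hx => (hd x (by linarith [hx.1])).continuousAt.continuousWithinAt)
      (fun x hx => ?_) (fun x hx => ?_) _ (left_mem_Icc.2 hr) _ (right_mem_Icc.2 hr) hr
    · rw [interior_Icc] at hx
      exact (hd x (by linarith [hx.1])).differentiableAt.differentiableWithinAt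
    · rw [interior_Icc] at hx
      rw [(hd x (by linarith [hx.1])).deriv]
      exact hf x (by linarith [hx.1])
  have h2 : 0 < (2 * B + 1) / c := by positivity
  have h3 := h1 (a + 1 + (2 * B + 1) / c) (by linarith)
  have h4 : c * (a + 1 + (2 * B + 1) / c - (a + 1)) = 2 * B + 1 := by field_simp; ring
  have h5 := (abs_le.1 (hB (a + 1 + (2 * B + 1) / c) (by linarith))).2
  have h6 := (abs_le.1 (hB (a + 1) (by linarith))).1
  linarith

theorem abs_arctan_le (x : ℝ) : |Real.arctan x| ≤ Real.pi / 2 :=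
  abs_le.2 ⟨(Real.neg_pi_div_two_lt_arctan x).le, (Real.arctan_lt_pi_div_two x).le⟩

/-- The equation `y'' / (1 + y' ^ 2) + y' / r = - k y` of a damped nonlinear oscillator. -/
structure IsOscillator (c Q : ℝ) (k y p : ℝ → ℝ) : Prop where
  c_pos : 0 < c
  c_le_one : c ≤ 1
  Q_nonneg : 0 ≤ Q
  le_k : ∀ r > 0, c ≤ k r
  sq_le : ∀ r > 0, p r ^ 2 ≤ Q
  hasDerivAt : ∀ r, HasDerivAt y (p r) r
  hasDerivAt_deriv : ∀ r > 0, HasDerivAt p ((1 + p r ^ 2) * (-k r * y r - p r / r)) r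
  continuous_deriv : Continuous p
  nondegenerate : ∀ r > 0, p r = 0 → y r ≠ 0

namespace IsOscillator

variable {c Q : ℝ} {k y p : ℝ → ℝ}

theorem continuous (h : IsOscillator c Q k y p) : Continuous y :=
  continuous_iff_continuousAt.2 fun r => (h.hasDerivAt r).continuousAt

/-- An increasing solution cannot stay negative: `- y' / y` satisfies a Riccati inequality. -/
theorem not_neg_of_pos (h : IsOscillator c Q k y p) {a : ℝ} (ha : 0 ≤ a) :
    ¬ ∀ r > a, 0 < p r ∧ y r < 0 := by
  intro hp
  have hc := h.c_pos
  have hQ := h.Q_nonneg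
  -- With `φ = -p / y > 0` one has `φ' = (1 + p^2) k - ((1 + p^2) / r) φ + φ^2`. Beyond `(1 + Q) /
  -- c` the middle coefficient is at most `c`, so `φ' ≥ c - c φ + φ^2 ≥ (c / 2) (1 + φ^2)`, where
  -- the last step uses `c ≤ 1`. Thus `arctan φ` would grow linearly.
  refine not_bounded_of_le_deriv (f := fun r => Real.arctan (-p r / y r))
    (f' := fun r => 1 / (1 + (-p r / y r) ^ 2) *
      ((-((1 + p r ^ 2) * (-k r * y r - p r / r)) * y r - -p r * p r) / y r ^ 2)) (a := a + (1 + Q) / c)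
    (B := Real.pi / 2) (c := c / 2) (by linarith) (fun r hr => ?_) (fun r hr => ?_)
    fun r _ => abs_arctan_le _
  · have : 0 < (1 + Q) / c := by positivity
    have hr0 : 0 < r := by linarith
    exact (((h.hasDerivAt_deriv r hr0).neg.div (h.hasDerivAt r)
      (hp r (by linarith)).2.ne)).arctan
  · have h1 : 0 < (1 + Q) / c := by positivity
    have hr0 : 0 < r := by linarith
    obtain ⟨h2, h3⟩ := hp r (by linarith)
    have h4 := h.le_k r hr0
    have h5 := h.sq_le r hr0
    obtain ⟨φ, hφ⟩ : ∃ φ, φ = -p r / y r := ⟨_, rfl⟩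
    have hφ0 : 0 < φ := by rw [hφ]; exact div_pos_of_neg_of_neg (by linarith) h3
    have hpφ : p r = -φ * y r := by
      rw [hφ, neg_div, neg_neg, div_mul_cancel₀ _ h3.ne]
    have h6 : (1 + p r ^ 2) / r ≤ c := by
      rw [div_le_iff₀ hr0]
      have : (1 + Q) / c < r := by linarith
      rw [div_lt_iff₀ hc] at this
      linarith
    have e : (-((1 + p r ^ 2) * (-k r * y r - p r / r)) * y r - -p r * p r) / y r ^ 2
        = (1 + p r ^ 2) * k r - (1 + p r ^ 2) / r * φ + φ ^ 2 := by
      rw [hφ]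
      have := h3.ne
      field_simp
      ring
    rw [e, ← hφ, one_div, ← div_eq_inv_mul, le_div_iff₀ (by positivity)]
    have h7 : c ≤ (1 + p r ^ 2) * k r := by nlinarith [sq_nonneg (p r)]
    have h8 : (1 + p r ^ 2) / r * φ ≤ c * φ := by gcongr
    have h9 := h.c_le_one
    nlinarith [sq_nonneg (φ - 1), sq_nonneg φ]

/-- A solution that increases forever must reach nonnegative values and is then bounded below by a
positive constant. From there `(arctan p)' = -k y - p / r` is at most a negative constant, against
the boundedness of `arctan`. -/
theorem not_pos (h : IsOscillator c Q k y p) {a : ℝ} (ha : 0 ≤ a) : ¬ ∀ r > a, 0 < p r := by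
  intro hp
  obtain ⟨r₁, hr₁, hy₁⟩ : ∃ r₁ > a, 0 ≤ y r₁ := by
    by_contra! hcon
    exact h.not_neg_of_pos ha fun r hr => ⟨hp r hr, hcon r hr⟩
  have hmono : StrictMonoOn y (Ici r₁) := by
    refine strictMonoOn_of_deriv_pos (convex_Ici r₁) h.continuous.continuousOn fun r hr => ?_
    rw [interior_Ici] at hr
    rw [(h.hasDerivAt r).deriv]
    exact hp r (hr₁.trans hr)
  have hy₂ : 0 < y (r₁ + 1) :=
    hy₁.trans_lt (hmono self_mem_Ici (by simp) (by linarith))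
  refine not_bounded_of_le_deriv (f := fun r => -Real.arctan (p r)) (a := r₁ + 1)
    (B := Real.pi / 2) (c := c * y (r₁ + 1)) (mul_pos h.c_pos hy₂)
    (fun r hr => ((h.hasDerivAt_deriv r (by linarith)).arctan).neg) (fun r hr => ?_)
    fun r _ => by simpa using abs_arctan_le (p r)
  have hr0 : 0 < r := by linarith
  have h1 : 0 < p r / r := div_pos (hp r (by linarith)) hr0
  have h2 : y (r₁ + 1) ≤ y r :=
    hmono.monotoneOn (by simp) (show r₁ ≤ r by linarith) (by linarith)
  have h3 := h.le_k r hr0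
  have h4 : c * y (r₁ + 1) ≤ k r * y r := by
    have := h.c_pos
    have := this.le.trans h3
    gcongr
  have h5 : 0 < 1 + p r ^ 2 := by positivity
  have e : -(1 / (1 + p r ^ 2) * ((1 + p r ^ 2) * (-k r * y r - p r / r)))
      = k r * y r + p r / r := by field_simp; ring
  rw [e]
  linarith

/-- After starting to increase, the solution increases until a critical point at which it is
positive. -/
theorem exists_next (h : IsOscillator c Q k y p) {a : ℝ} (ha : 0 ≤ a)
    (hpos : ∀ᶠ r in 𝓝[>] a, 0 < p r) :
    ∃ b > a, StrictMonoOn y (Icc a b) ∧ p b = 0 ∧ 0 < y b := by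
  obtain ⟨e, hae, he⟩ := mem_nhdsGT_iff_exists_Ioc_subset.1 hpos
  have hae' : a < e := hae
  obtain ⟨r₀, hr₀, hp₀⟩ : ∃ r₀ > a, p r₀ ≤ 0 := by
    by_contra! hcon
    exact h.not_pos ha hcon
  have her₀ : e ≤ r₀ := by
    by_contra! hcon
    exact absurd (he ⟨hr₀, hcon.le⟩) (not_lt.2 hp₀)
  -- The sought point is the first one after the initial rise at which `p ≤ 0`.
  have hcomp : IsCompact (Icc e r₀ ∩ {r | p r ≤ 0}) :=
    isCompact_Icc.inter_right (isClosed_le h.continuous_deriv continuous_const)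
  obtain ⟨b, ⟨hb, hpb⟩, hleast⟩ := hcomp.exists_isLeast ⟨r₀, ⟨her₀, le_rfl⟩, hp₀⟩
  have hab : a < b := hae'.trans_le hb.1
  have hpI : ∀ r ∈ Ioo a b, 0 < p r := fun r hr => by
    by_contra! hcon
    rcases le_or_gt r e with h1 | h1
    · exact absurd (he ⟨hr.1, h1⟩) (not_lt.2 hcon)
    · exact absurd (hleast ⟨⟨h1.le, hr.2.le.trans hb.2⟩, hcon⟩) (not_le.2 hr.2)
  have hpb0 : p b = 0 := by
    refine le_antisymm hpb (ge_of_tendsto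
      (h.continuous_deriv.continuousWithinAt (s := Iio b)).tendsto ?_)
    filter_upwards [Ioo_mem_nhdsLT hab] with r hr using (hpI r hr).le
  have hb0 : 0 < b := ha.trans_lt hab
  refine ⟨b, hab, ?_, hpb0, ?_⟩
  · refine strictMonoOn_of_deriv_pos (convex_Icc a b) h.continuous.continuousOn fun r hr => ?_
    rw [interior_Icc] at hr
    rw [(h.hasDerivAt r).deriv]
    exact hpI r hr
  -- At the first zero of the slope the second derivative is `-k y ≤ 0`, so `y ≥ 0`; the value `0`
  -- is excluded by nondegeneracy.
  · have h1 := deriv_nonpos_of_pos_left hab hpb0 hpI (h.hasDerivAt_deriv b hb0)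
    rw [hpb0] at h1
    have h2 := h.le_k b hb0
    have h3 := h.c_pos
    have h4 : 0 ≤ y b := by
      by_contra! hcon
      have := mul_neg_of_pos_of_neg (h3.trans_le h2) hcon
      norm_num at h1
      linarith
    exact h4.lt_of_ne (h.nondegenerate b hb0 hpb0).symm

end IsOscillator

namespace IsHeight

variable {z₀ δ m M Q : ℝ} {v : ℝ → ℝ}

/-- The sign `σ = ±1` lets the rising and the falling phases be treated as one case. The stiffness
is `2 / u^2 ≥ 2 / M^2`, and the cap at `1` serves the Riccati estimate. -/
theorem isOscillator (h : IsHeight z₀ δ m M Q v) (hz : z₀ ≠ 1) (σ : ℝ) (hσ : σ ^ 2 = 1) :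
    IsOscillator (min 1 (2 / M ^ 2)) Q (fun r => 2 / v (r ^ 2) ^ 2)
      (fun r => σ * (v (r ^ 2) - 1)) (fun r => σ * (2 * r * deriv v (r ^ 2))) := by
  have hσ0 : σ ≠ 0 := by rintro rfl; norm_num at hσ
  have hb := fun r : ℝ => h.bounds (r ^ 2) (sq_nonneg r)
  have hv : ∀ r : ℝ, 0 < v (r ^ 2) := fun r => h.lower_pos.trans_le (hb r).1
  have hM : 0 < M := (hv 0).trans_le (hb 0).2.1
  refine ⟨lt_min one_pos (by positivity), min_le_left _ _, ?_, fun r _ => ?_, fun r _ => ?_,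
    fun r => ?_, fun r hr => ?_, ?_, fun r hr h0 => ?_⟩
  · have := (hb 1).2.2
    have h1 : 0 ≤ 4 * (1 : ℝ) ^ 2 * deriv v (1 ^ 2) ^ 2 := by positivity
    exact h1.trans this
  · refine (min_le_right _ _).trans ?_
    have h1 := (hb r).2.1
    have h2 := hv r
    gcongr
  · have := (hb r).2.2
    rw [mul_pow, hσ]
    linarith
  · exact ((h.hasDerivAt_sq r).sub_const 1).const_mul σ
  · have h1 := (h.hasDerivAt_deriv_sq r).const_mul σ
    rw [h.second_deriv_eq hr.ne'] at h1
    refine h1.congr_deriv ?_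
    have h2 := hv r
    rw [mul_pow σ, hσ, force]
    field_simp
    ring
  · exact (continuous_iff_continuousAt.2
      fun r => (h.hasDerivAt_deriv_sq r).continuousAt).const_mul σ
  · exact mul_ne_zero hσ0 (sub_ne_zero.2
      (h.ne_of_deriv_eq_zero hz hr.le ((mul_eq_zero.1 h0).resolve_left hσ0)))

/-- At a critical point `u''` has the sign of `1 - u`: it equals `4 F(u)` for `a > 0`, and `2 F(u)`
at the axis, where `u' / r` contributes a second copy of `u''`. -/
theorem eventually_pos (h : IsHeight z₀ δ m M Q v) {σ a : ℝ} (ha : 0 ≤ a)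
    (hq : 2 * a * deriv v (a ^ 2) = 0) (hy : σ * (v (a ^ 2) - 1) < 0) :
    ∀ᶠ r in 𝓝[>] a, 0 < σ * (2 * r * deriv v (r ^ 2)) := by
  have hv : 0 < v (a ^ 2) := h.lower_pos.trans_le (h.bounds _ (sq_nonneg a)).1
  have hf : 0 < σ * force (v (a ^ 2)) := by
    have e : σ * force (v (a ^ 2)) = -(σ * (v (a ^ 2) - 1)) / (2 * v (a ^ 2) ^ 2) := by
      rw [force]; ring
    rw [e]
    exact div_pos (by linarith) (by positivity)
  refine eventually_pos_of_hasDerivAt_pos (by rw [hq, mul_zero])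
    ((h.hasDerivAt_deriv_sq a).const_mul σ) ?_
  rcases ha.eq_or_lt with rfl | ha
  · have h1 := h.equation 0 (h.mem_of_nonneg le_rfl)
    simp only [zero_mul, zero_add, add_zero] at h1
    norm_num at hf ⊢
    rw [h1]
    linarith
  · rw [h.second_deriv_eq ha.ne', hq]
    norm_num
    linarith

theorem exists_next (h : IsHeight z₀ δ m M Q v) (hz : z₀ ≠ 1) {a : ℝ} (ha : 0 ≤ a)
    (hq : 2 * a * deriv v (a ^ 2) = 0) : ∃ b > a, 2 * b * deriv v (b ^ 2) = 0 ∧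
      ((StrictMonoOn (fun r => v (r ^ 2)) (Icc a b) ∧ v (a ^ 2) < 1 ∧ 1 < v (b ^ 2)) ∨
        (StrictAntiOn (fun r => v (r ^ 2)) (Icc a b) ∧ 1 < v (a ^ 2) ∧ v (b ^ 2) < 1)) := by
  rcases (h.ne_of_deriv_eq_zero hz ha hq).lt_or_gt with h1 | h1
  · obtain ⟨b, hab, hm, hb, hyb⟩ := (h.isOscillator hz 1 (by norm_num)).exists_next ha
      (h.eventually_pos ha hq (by linarith))
    refine ⟨b, hab, by simpa using hb, Or.inl ⟨fun x hx x' hx' hlt => ?_, h1, by linarith⟩⟩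
    have := hm hx hx' hlt
    simp only at this ⊢
    linarith
  · obtain ⟨b, hab, hm, hb, hyb⟩ := (h.isOscillator hz (-1) (by norm_num)).exists_next ha
      (h.eventually_pos ha hq (by linarith))
    refine ⟨b, hab, by simpa using hb, Or.inr ⟨fun x hx x' hx' hlt => ?_, h1, by linarith⟩⟩
    have := hm hx hx' hlt
    simp only at this ⊢
    linarith

theorem oscillatesAround (h : IsHeight z₀ δ m M Q v) (hz : z₀ ≠ 1) :
    OscillatesAround (fun r => v (r ^ 2)) 1 := by
  have hex : ∀ a : {a : ℝ // 0 ≤ a ∧ 2 * a * deriv v (a ^ 2) = 0},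
      ∃ b : {a : ℝ // 0 ≤ a ∧ 2 * a * deriv v (a ^ 2) = 0}, a.1 < b.1 ∧
      ((StrictMonoOn (fun r => v (r ^ 2)) (Icc a.1 b.1) ∧ v (a.1 ^ 2) < 1 ∧ 1 < v (b.1 ^ 2)) ∨
        (StrictAntiOn (fun r => v (r ^ 2)) (Icc a.1 b.1) ∧ 1 < v (a.1 ^ 2) ∧ v (b.1 ^ 2) < 1)) :=
    fun a => by
      obtain ⟨b, hab, hb, halt⟩ := h.exists_next hz a.2.1 a.2.2
      exact ⟨⟨b, a.2.1.trans hab.le, hb⟩, hab, halt⟩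
  choose next hlt halt using hex
  obtain ⟨R, hR0, hR⟩ : ∃ R : ℕ → {a : ℝ // 0 ≤ a ∧ 2 * a * deriv v (a ^ 2) = 0},
      (R 0).1 = 0 ∧ ∀ n, R (n + 1) = next (R n) :=
    ⟨fun n => next^[n] ⟨0, le_rfl, by simp⟩, rfl, fun n => Function.iterate_succ_apply' _ _ _⟩
  have hmono : StrictMono fun n => (R n).1 :=
    strictMono_nat_of_lt_succ fun n => by rw [hR]; exact hlt _
  refine ⟨fun n => (R n).1, hR0, hmono, ?_, fun n => by simpa only [hR] using halt _⟩
  -- If the extrema accumulated at `l`, the slope would vanish at `l`; moreover the product of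
  -- consecutive deviations from `1` is nonpositive and tends to the square of the deviation at `l`,
  -- so the height there would be `1`.
  rcases tendsto_atTop_of_monotone hmono.monotone with hlim | ⟨l, hl⟩
  · exact hlim
  exfalso
  have hl0 : 0 ≤ l := ge_of_tendsto hl (Eventually.of_forall fun n => (R n).2.1)
  have hUc : Continuous fun r : ℝ => v (r ^ 2) := h.contDiff_sq.continuous
  have hqc : Continuous fun r : ℝ => 2 * r * deriv v (r ^ 2) :=
    continuous_iff_continuousAt.2 fun r => (h.hasDerivAt_deriv_sq r).continuousAt
  have hq : 2 * l * deriv v (l ^ 2) = 0 :=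
    tendsto_nhds_unique ((hqc.tendsto l).comp hl)
      (tendsto_const_nhds.congr fun n => ((R n).2.2).symm)
  have h1 := (hUc.tendsto l).comp hl
  have h2 := h1.comp (tendsto_add_atTop_nat 1)
  have h3 : (v (l ^ 2) - 1) * (v (l ^ 2) - 1) ≤ 0 := by
    refine le_of_tendsto ((h1.sub_const 1).mul (h2.sub_const 1)) (Eventually.of_forall fun n => ?_)
    simp only [Function.comp, hR]
    rcases halt (R n) with ⟨-, h4, h5⟩ | ⟨-, h4, h5⟩
    · exact mul_nonpos_of_nonpos_of_nonneg (by linarith) (by linarith)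
    · exact mul_nonpos_of_nonneg_of_nonpos (by linarith) (by linarith)
  exact h.ne_of_deriv_eq_zero hz hl0 hq (by nlinarith [mul_self_nonneg (v (l ^ 2) - 1)])

end IsHeight

end Horo

/-! ### The mean curvature equation for a parametrized graph. -/

namespace Horo

theorem inner_space (v w : Space) : inner ℝ v w = v 0 * w 0 + v 1 * w 1 + v 2 * w 2 := by
  simp [PiLp.inner_apply, Fin.sum_univ_three, mul_comm]

theorem hypInner_dz (p n : Space) : hypInner p n dz = n 2 / p 2 ^ 2 := by
  simp [hypInner, inner_space, dz]

theorem christoffel_apply (p v w : Space) (i : Fin 3) :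
    christoffel p v w i = (p 2)⁻¹ * (inner ℝ v w * dz i - v 2 * w i - w 2 * v i) := by
  simp [christoffel]

theorem fderiv_apply_coord {Y : Plane → Space} {a : Plane} (hY : DifferentiableAt ℝ Y a)
    (v : Plane) (k : Fin 3) : fderiv ℝ Y a v k = fderiv ℝ (fun b => Y b k) a v := by
  have h := ((EuclideanSpace.proj k : Space →L[ℝ] ℝ).hasFDerivAt).comp a hY.hasFDerivAt
  have h' : HasFDerivAt (fun b => Y b k) _ a := h
  rw [h'.fderiv]
  rfl

theorem partialD_apply {Y : Plane → Space} {a : Plane} (hY : DifferentiableAt ℝ Y a) (i : Fin 2)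
    (k : Fin 3) : partialD Y i a k = fderiv ℝ (fun b => Y b k) a (EuclideanSpace.single i 1) :=
  fderiv_apply_coord hY _ k

/-- The mean curvature equation in terms of the first and second derivatives of a parametrization
of a graph. -/
theorem meanCurvature_algebra {z l P Q A B C a₀ b₀ a₁ b₁ g₀₀ g₀₁ g₁₁ h₀₀ h₀₁ h₁₁ : ℝ}
    (hz : 0 < z) (hl : l ≠ 0) (hD : a₀ * b₁ - a₁ * b₀ ≠ 0)
    (hg₀₀ : g₀₀ = a₀ * a₀ + b₀ * b₀ + (P * a₀ + Q * b₀) * (P * a₀ + Q * b₀))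
    (hg₀₁ : g₀₁ = a₀ * a₁ + b₀ * b₁ + (P * a₀ + Q * b₀) * (P * a₁ + Q * b₁))
    (hg₁₁ : g₁₁ = a₁ * a₁ + b₁ * b₁ + (P * a₁ + Q * b₁) * (P * a₁ + Q * b₁))
    (hh₀₀ : h₀₀ = A * a₀ * a₀ + B * (a₀ * b₀ + b₀ * a₀) + C * b₀ * b₀)
    (hh₀₁ : h₀₁ = A * a₀ * a₁ + B * (a₀ * b₁ + b₀ * a₁) + C * b₀ * b₁)
    (hh₁₁ : h₁₁ = A * a₁ * a₁ + B * (a₁ * b₁ + b₁ * a₁) + C * b₁ * b₁) :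
    (g₁₁ / z ^ 2 * (l / z ^ 2 * (h₀₀ + g₀₀ / z)) - 2 * (g₀₁ / z ^ 2) * (l / z ^ 2 * (h₀₁ + g₀₁ / z))
      + g₀₀ / z ^ 2 * (l / z ^ 2 * (h₁₁ + g₁₁ / z)))
      / (2 * (g₀₀ / z ^ 2 * (g₁₁ / z ^ 2) - (g₀₁ / z ^ 2) ^ 2)) = l / z ^ 2 ↔
    (1 + Q ^ 2) * A - 2 * P * Q * B + (1 + P ^ 2) * C
      = 4 * force z * (1 + P ^ 2 + Q ^ 2) := by
  have hW : 0 < 1 + P ^ 2 + Q ^ 2 := by positivity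
  -- The determinant and the trace numerator both carry the square of the Jacobian of the horizontal
  -- projection, so the parametrization cancels from the quotient.
  have hdet : g₀₀ * g₁₁ - g₀₁ ^ 2 = (a₀ * b₁ - a₁ * b₀) ^ 2 * (1 + P ^ 2 + Q ^ 2) := by
    rw [hg₀₀, hg₀₁, hg₁₁]; ring
  have htr : g₁₁ * h₀₀ - 2 * g₀₁ * h₀₁ + g₀₀ * h₁₁
      = (a₀ * b₁ - a₁ * b₀) ^ 2 * ((1 + Q ^ 2) * A - 2 * P * Q * B + (1 + P ^ 2) * C) := by
    rw [hg₀₀, hg₀₁, hg₁₁, hh₀₀, hh₀₁, hh₁₁]; ring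
  obtain ⟨D, hDdef⟩ : ∃ D, D = a₀ * b₁ - a₁ * b₀ := ⟨_, rfl⟩
  obtain ⟨K, hK⟩ : ∃ K, K = (1 + Q ^ 2) * A - 2 * P * Q * B + (1 + P ^ 2) * C := ⟨_, rfl⟩
  obtain ⟨W, hWdef⟩ : ∃ W, W = 1 + P ^ 2 + Q ^ 2 := ⟨_, rfl⟩
  rw [← hDdef] at hD
  rw [← hDdef, ← hWdef] at hdet
  rw [← hDdef, ← hK] at htr
  rw [← hK, ← hWdef]
  rw [← hWdef] at hW
  have e1 : g₁₁ / z ^ 2 * (l / z ^ 2 * (h₀₀ + g₀₀ / z))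
      - 2 * (g₀₁ / z ^ 2) * (l / z ^ 2 * (h₀₁ + g₀₁ / z))
      + g₀₀ / z ^ 2 * (l / z ^ 2 * (h₁₁ + g₁₁ / z)) = l / z ^ 4 * (D ^ 2 * (K + 2 * W / z)) := by
    have : D ^ 2 * (K + 2 * W / z)
        = (g₁₁ * h₀₀ - 2 * g₀₁ * h₀₁ + g₀₀ * h₁₁) + 2 * (g₀₀ * g₁₁ - g₀₁ ^ 2) / z := by
      rw [htr, hdet]; ring
    rw [this]; field_simp; ring
  have e2 : 2 * (g₀₀ / z ^ 2 * (g₁₁ / z ^ 2) - (g₀₁ / z ^ 2) ^ 2) = 2 * (D ^ 2 * W) / z ^ 4 := by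
    rw [← hdet]; field_simp
  have e3 : l / z ^ 4 * (D ^ 2 * (K + 2 * W / z)) / (2 * (D ^ 2 * W) / z ^ 4)
      = l * (K + 2 * W / z) / (2 * W) := by
    field_simp
  rw [e1, e2, e3, force, div_eq_div_iff (by positivity) (by positivity)]
  have e4 : l * (K + 2 * W / z) * z ^ 2 - l * (2 * W)
      = l * z ^ 2 * (K - 4 * ((1 - z) / (2 * z ^ 2)) * W) := by
    field_simp; ring
  constructor
  · intro h
    have h1 : l * z ^ 2 * (K - 4 * ((1 - z) / (2 * z ^ 2)) * W) = 0 := by rw [← e4, h, sub_self]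
    have h2 := (mul_eq_zero.1 h1).resolve_left (by positivity)
    linarith
  · intro h
    rw [← sub_eq_zero, e4, h, sub_self, mul_zero]

/-- The germ at `a` of an immersed parametrization `X` with unit normal vector `n` at `X a`. -/
structure IsImmersionAt (X : Plane → Space) (n : Space) (a : Plane) : Prop where
  contDiffAt : ContDiffAt ℝ ∞ X a
  injective : Function.Injective (fderiv ℝ X a)
  pos : 0 < X a 2
  normal : ∀ v, inner ℝ (fderiv ℝ X a v) n = 0
  unit : inner ℝ n n = X a 2 ^ 2

/-- `f` has gradient `(p, q)` near `c`, and second derivatives `A`, `B`, `C` at `c`. -/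
structure HasHessianAt (f p q : ℝ × ℝ → ℝ) (A B C : ℝ) (c : ℝ × ℝ) : Prop where
  gradient : ∀ᶠ x in 𝓝 c, HasFDerivAt f
    (p x • ContinuousLinearMap.fst ℝ ℝ ℝ + q x • ContinuousLinearMap.snd ℝ ℝ ℝ) x
  fst : HasFDerivAt p (A • ContinuousLinearMap.fst ℝ ℝ ℝ + B • ContinuousLinearMap.snd ℝ ℝ ℝ) c
  snd : HasFDerivAt q (B • ContinuousLinearMap.fst ℝ ℝ ℝ + C • ContinuousLinearMap.snd ℝ ℝ ℝ) c

/-- The projection to the first two coordinates. -/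
def horizontal (p : Space) : ℝ × ℝ := (p 0, p 1)

theorem continuous_horizontal : Continuous horizontal := by
  unfold horizontal; fun_prop

theorem hasFDerivAt_comp_horizontal {Y : Plane → Space} {a : Plane} (hY : DifferentiableAt ℝ Y a)
    {g : ℝ × ℝ → ℝ} {P Q : ℝ}
    (hg : HasFDerivAt g (P • ContinuousLinearMap.fst ℝ ℝ ℝ + Q • ContinuousLinearMap.snd ℝ ℝ ℝ)
      (horizontal (Y a))) (i : Fin 2) :
    DifferentiableAt ℝ (fun b => g (horizontal (Y b))) a ∧
    fderiv ℝ (fun b => g (horizontal (Y b))) a (EuclideanSpace.single i 1)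
      = P * partialD Y i a 0 + Q * partialD Y i a 1 := by
  have h0 : DifferentiableAt ℝ (fun b => Y b 0) a := by fun_prop
  have h1 : DifferentiableAt ℝ (fun b => Y b 1) a := by fun_prop
  have h2 : HasFDerivAt (fun b => g (horizontal (Y b))) _ a :=
    hg.comp a (h0.hasFDerivAt.prodMk h1.hasFDerivAt)
  refine ⟨h2.differentiableAt, ?_⟩
  rw [h2.fderiv, partialD_apply hY, partialD_apply hY]
  simp

theorem IsImmersionAt.differentiableAt {X : Plane → Space} {n : Space} {a : Plane}
    (hX : IsImmersionAt X n a) : ∀ᶠ b in 𝓝 a, DifferentiableAt ℝ X b := by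
  have := (hX.contDiffAt.of_le (ENat.LEInfty.out : (1 : WithTop ℕ∞) ≤ ∞)).eventually (by simp)
  filter_upwards [this] with b hb using hb.differentiableAt one_ne_zero

theorem IsImmersionAt.differentiableAt_partialD {X : Plane → Space} {n : Space} {a : Plane}
    (hX : IsImmersionAt X n a) (i : Fin 2) : DifferentiableAt ℝ (partialD X i) a := by
  have h1 : ContDiffAt ℝ 1 (fderiv ℝ X) a :=
    hX.contDiffAt.fderiv_right (m := 1) (by norm_cast)
  exact (h1.clm_apply contDiffAt_const).differentiableAt one_ne_zero

section Graph

variable {X : Plane → Space} {n : Space} {a : Plane} {f p q : ℝ × ℝ → ℝ} {A B C : ℝ}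

theorem IsImmersionAt.partialD_graph (hX : IsImmersionAt X n a)
    (hgraph : ∀ᶠ b in 𝓝 a, X b 2 = f (horizontal (X b)))
    (hf : ∀ᶠ x in 𝓝 (horizontal (X a)), HasFDerivAt f
    (p x • ContinuousLinearMap.fst ℝ ℝ ℝ + q x • ContinuousLinearMap.snd ℝ ℝ ℝ) x) :
    ∀ᶠ b in 𝓝 a, ∀ i, partialD X i b 2 = p (horizontal (X b)) * partialD X i b 0
      + q (horizontal (X b)) * partialD X i b 1 := by
  have hc : ContinuousAt (fun b => horizontal (X b)) a :=
    continuous_horizontal.continuousAt.comp hX.contDiffAt.continuousAt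
  filter_upwards [eventually_eventually_nhds.2 hgraph, hc.eventually hf, hX.differentiableAt]
    with b h1 h2 h3 i
  rw [partialD_apply h3, Filter.EventuallyEq.fderiv_eq h1, (hasFDerivAt_comp_horizontal h3 h2 i).2]

/-- On a graph the vertical derivative is a combination of the horizontal ones, so a kernel vector
of the horizontal projection would be a kernel vector of the immersion. -/
theorem IsImmersionAt.det_ne_zero (hX : IsImmersionAt X n a) {P Q : ℝ}
    (h : ∀ i, partialD X i a 2 = P * partialD X i a 0 + Q * partialD X i a 1) :
    partialD X 0 a 0 * partialD X 1 a 1 - partialD X 1 a 0 * partialD X 0 a 1 ≠ 0 := by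
  intro hD
  have key : ∀ α β : ℝ, α * partialD X 0 a 0 + β * partialD X 1 a 0 = 0 →
      α * partialD X 0 a 1 + β * partialD X 1 a 1 = 0 → α = 0 ∧ β = 0 := fun α β h0 h1 => by
    have h2 : fderiv ℝ X a (!₂[α, β]) = 0 := by
      have e : (!₂[α, β] : Plane) = α • EuclideanSpace.single 0 1 + β • EuclideanSpace.single 1 1 := by
        ext i; fin_cases i <;> simp
      rw [e, map_add, map_smul, map_smul]
      change α • partialD X 0 a + β • partialD X 1 a = 0
      ext i
      fin_cases i
      · simpa using h0
      · simpa using h1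
      · have : α * partialD X 0 a 2 + β * partialD X 1 a 2 = 0 := by
          rw [h, h]; linear_combination P * h0 + Q * h1
        simpa using this
    have h3 : (!₂[α, β] : Plane) = 0 := hX.injective (by rw [h2, map_zero])
    exact ⟨by simpa using congrArg (fun w : Plane => w 0) h3,
      by simpa using congrArg (fun w : Plane => w 1) h3⟩
  -- If the determinant vanishes, these Cramer coefficients give kernel vectors, so all horizontal
  -- derivatives vanish; then `(1, 0)` is a kernel vector as well.
  obtain ⟨h1, h2⟩ := key (partialD X 1 a 0) (-partialD X 0 a 0) (by ring) (by linarith)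
  obtain ⟨h3, h4⟩ := key (partialD X 1 a 1) (-partialD X 0 a 1) (by linarith) (by ring)
  have := (key 1 0 (by linarith) (by linarith)).1
  norm_num at this

theorem IsImmersionAt.normal_of_graph (hX : IsImmersionAt X n a) {P Q : ℝ}
    (h : ∀ i, partialD X i a 2 = P * partialD X i a 0 + Q * partialD X i a 1) :
    n 0 = -(P * n 2) ∧ n 1 = -(Q * n 2) ∧ n 2 ≠ 0 := by
  have hD := hX.det_ne_zero h
  have h0 := hX.normal (EuclideanSpace.single 0 1)
  have h1 := hX.normal (EuclideanSpace.single 1 1)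
  change inner ℝ (partialD X 0 a) n = 0 at h0
  change inner ℝ (partialD X 1 a) n = 0 at h1
  rw [inner_space, h] at h0 h1
  have e0 : (n 0 + P * n 2) * (partialD X 0 a 0 * partialD X 1 a 1
      - partialD X 1 a 0 * partialD X 0 a 1) = 0 := by
    linear_combination partialD X 1 a 1 * h0 - partialD X 0 a 1 * h1
  have e1 : (n 1 + Q * n 2) * (partialD X 0 a 0 * partialD X 1 a 1
      - partialD X 1 a 0 * partialD X 0 a 1) = 0 := by
    linear_combination partialD X 0 a 0 * h1 - partialD X 1 a 0 * h0
  have n0 := (mul_eq_zero.1 e0).resolve_right hD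
  have n1 := (mul_eq_zero.1 e1).resolve_right hD
  refine ⟨by linarith, by linarith, fun h2 => ?_⟩
  have hu := hX.unit
  have hp := hX.pos
  rw [h2] at n0 n1
  have n0' : n 0 = 0 := by linarith
  have n1' : n 1 = 0 := by linarith
  rw [inner_space, n0', n1', h2] at hu
  nlinarith

/-- The horo-shrinker equation of a graph. -/
theorem IsImmersionAt.equation_iff (hX : IsImmersionAt X n a)
    (hgraph : ∀ᶠ b in 𝓝 a, X b 2 = f (horizontal (X b)))
    (hf : HasHessianAt f p q A B C (horizontal (X a))) :
    paramMeanCurvature X n a = hypInner (X a) n dz ↔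
      (1 + q (horizontal (X a)) ^ 2) * A - 2 * p (horizontal (X a)) * q (horizontal (X a)) * B
        + (1 + p (horizontal (X a)) ^ 2) * C = 4 * force (X a 2) *
          (1 + p (horizontal (X a)) ^ 2 + q (horizontal (X a)) ^ 2) := by
  have hpart := hX.partialD_graph hgraph hf.gradient
  have hpa := hpart.self_of_nhds
  have hD := hX.det_ne_zero hpa
  obtain ⟨n0, n1, n2⟩ := hX.normal_of_graph hpa
  have hXd := hX.differentiableAt.self_of_nhds
  -- Differentiating `∂_j z = p ∂_j x + q ∂_j y`. The last two terms, with second derivatives of the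
  -- parametrization, cancel on pairing with `n = n 2 • (-p, -q, 1)`; what is left is the Hessian of
  -- `f`.
  have hsecond : ∀ i j, partialD (partialD X j) i a 2
      = A * partialD X i a 0 * partialD X j a 0
        + B * (partialD X i a 0 * partialD X j a 1 + partialD X i a 1 * partialD X j a 0)
        + C * partialD X i a 1 * partialD X j a 1
        + p (horizontal (X a)) * partialD (partialD X j) i a 0
        + q (horizontal (X a)) * partialD (partialD X j) i a 1 := fun i j => by
    have hd := hX.differentiableAt_partialD j
    obtain ⟨dp, ep⟩ := hasFDerivAt_comp_horizontal hXd hf.fst i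
    obtain ⟨dq, eq⟩ := hasFDerivAt_comp_horizontal hXd hf.snd i
    have h0 : DifferentiableAt ℝ (fun b => partialD X j b 0) a := by fun_prop
    have h1 : DifferentiableAt ℝ (fun b => partialD X j b 1) a := by fun_prop
    have e : (fun b => partialD X j b 2) =ᶠ[𝓝 a] fun b => p (horizontal (X b)) * partialD X j b 0
        + q (horizontal (X b)) * partialD X j b 1 := hpart.mono fun b hb => hb j
    have hs : HasFDerivAt (fun b => p (horizontal (X b)) * partialD X j b 0
        + q (horizontal (X b)) * partialD X j b 1) _ a :=
      (dp.hasFDerivAt.mul h0.hasFDerivAt).add (dq.hasFDerivAt.mul h1.hasFDerivAt)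
    rw [partialD_apply hd, e.fderiv_eq, hs.fderiv, partialD_apply hd, partialD_apply hd]
    simp only [_root_.add_apply, _root_.smul_apply, smul_eq_mul, ep, eq]
    ring
  have hz := hX.pos
  have hsf : ∀ i j, secondForm X n a i j = n 2 / X a 2 ^ 2 *
      (A * partialD X i a 0 * partialD X j a 0
        + B * (partialD X i a 0 * partialD X j a 1 + partialD X i a 1 * partialD X j a 0)
        + C * partialD X i a 1 * partialD X j a 1
        + inner ℝ (partialD X i a) (partialD X j a) / X a 2) := fun i j => by
    have hdz : dz 0 = 0 ∧ dz 1 = 0 ∧ dz 2 = 1 := by simp [dz]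
    rw [secondForm, hypInner, inner_space]
    simp only [PiLp.add_apply, christoffel_apply, hdz.1, hdz.2.1, hdz.2.2, hsecond, n0, n1, hpa]
    field_simp
    ring
  rw [paramMeanCurvature, hypInner_dz]
  simp only [hsf, firstForm, hypInner]
  refine meanCurvature_algebra hz n2 hD ?_ ?_ ?_ rfl rfl rfl <;>
  · simp only [inner_space, hpa]

end Graph

end Horo

/-! ### Each `bowl z₀` is a rotational horo-shrinker. -/

namespace Horo

namespace IsHeight

variable {z₀ δ m M Q : ℝ} {v : ℝ → ℝ}

theorem hasHessianAt (h : IsHeight z₀ δ m M Q v) (c : ℝ × ℝ) :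
    HasHessianAt (fun x => v (x.1 ^ 2 + x.2 ^ 2)) (fun x => 2 * x.1 * deriv v (x.1 ^ 2 + x.2 ^ 2))
      (fun x => 2 * x.2 * deriv v (x.1 ^ 2 + x.2 ^ 2))
      (2 * deriv v (c.1 ^ 2 + c.2 ^ 2) + 4 * c.1 ^ 2 * deriv (deriv v) (c.1 ^ 2 + c.2 ^ 2))
      (4 * c.1 * c.2 * deriv (deriv v) (c.1 ^ 2 + c.2 ^ 2))
      (2 * deriv v (c.1 ^ 2 + c.2 ^ 2) + 4 * c.2 ^ 2 * deriv (deriv v) (c.1 ^ 2 + c.2 ^ 2)) c := by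
  have hs : ∀ x : ℝ × ℝ, HasFDerivAt (fun x : ℝ × ℝ => x.1 ^ 2 + x.2 ^ 2)
      ((2 * x.1) • ContinuousLinearMap.fst ℝ ℝ ℝ + (2 * x.2) • ContinuousLinearMap.snd ℝ ℝ ℝ) x :=
    fun x => by
      refine ((hasFDerivAt_fst.pow 2).add (hasFDerivAt_snd.pow 2)).congr_fderiv ?_
      ext <;> simp
  have hmem : ∀ x : ℝ × ℝ, x.1 ^ 2 + x.2 ^ 2 ∈ Ioi (-δ) := fun x => h.mem_of_nonneg (by positivity)
  have hv := fun x : ℝ × ℝ => HasDerivAt.comp_hasFDerivAt (h₂ := v) x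
    (h.hasDerivAt (hmem x)) (hs x)
  have hw := fun x : ℝ × ℝ => HasDerivAt.comp_hasFDerivAt (h₂ := deriv v) x
    (h.hasDerivAt_deriv (hmem x)) (hs x)
  refine ⟨Eventually.of_forall fun x => (hv x).congr_fderiv ?_,
    (((hasFDerivAt_fst (𝕜 := ℝ) (p := c)).const_mul 2).mul (hw c)).congr_fderiv ?_,
    (((hasFDerivAt_snd (𝕜 := ℝ) (p := c)).const_mul 2).mul (hw c)).congr_fderiv ?_⟩
  all_goals
    ext <;> simp <;> ring

/-- The parametrization of the surface of revolution with profile `v` as a graph. -/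
noncomputable def graphMap (v : ℝ → ℝ) (a : Plane) : Space :=
  !₂[a 0, a 1, v (a 0 ^ 2 + a 1 ^ 2)]

/-- The upward unit normal of the surface of revolution. -/
noncomputable def graphNormal (v : ℝ → ℝ) (a : Plane) : Space :=
  (v (a 0 ^ 2 + a 1 ^ 2)
    / Real.sqrt (1 + 4 * (a 0 ^ 2 + a 1 ^ 2) * deriv v (a 0 ^ 2 + a 1 ^ 2) ^ 2)) •
    !₂[-(2 * a 0 * deriv v (a 0 ^ 2 + a 1 ^ 2)), -(2 * a 1 * deriv v (a 0 ^ 2 + a 1 ^ 2)), 1]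

theorem contDiff_height (h : IsHeight z₀ δ m M Q v) :
    ContDiff ℝ ∞ fun a : Plane => v (a 0 ^ 2 + a 1 ^ 2) :=
  h.contDiff_comp (f := fun a : Plane => a 0 ^ 2 + a 1 ^ 2) (by fun_prop) fun a => by positivity

theorem contDiff_graphMap (h : IsHeight z₀ δ m M Q v) : ContDiff ℝ ∞ (graphMap v) := by
  have := h.contDiff_height
  rw [contDiff_euclidean]
  intro i
  fin_cases i
  · simp only [graphMap]; norm_num; fun_prop
  · simp only [graphMap]; norm_num; fun_prop
  · simpa [graphMap] using this

theorem contDiff_graphNormal (h : IsHeight z₀ δ m M Q v) : ContDiff ℝ ∞ (graphNormal v) := by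
  have h1 := h.contDiff_height
  have h2 : ContDiff ℝ ∞ fun a : Plane => deriv v (a 0 ^ 2 + a 1 ^ 2) :=
    h.contDiff_deriv_comp (f := fun a : Plane => a 0 ^ 2 + a 1 ^ 2) (by fun_prop)
      fun a => by positivity
  have h3 : ContDiff ℝ ∞ fun a : Plane =>
      Real.sqrt (1 + 4 * (a 0 ^ 2 + a 1 ^ 2) * deriv v (a 0 ^ 2 + a 1 ^ 2) ^ 2) :=
    ContDiff.sqrt (by fun_prop) fun a => by positivity
  have h4 : ContDiff ℝ ∞ fun a : Plane => v (a 0 ^ 2 + a 1 ^ 2)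
      / Real.sqrt (1 + 4 * (a 0 ^ 2 + a 1 ^ 2) * deriv v (a 0 ^ 2 + a 1 ^ 2) ^ 2) :=
    h1.div h3 fun a => (Real.sqrt_pos.2 (by positivity)).ne'
  refine h4.smul ?_
  rw [contDiff_euclidean]
  intro i
  fin_cases i <;> simp <;> fun_prop

theorem fderiv_graphMap (h : IsHeight z₀ δ m M Q v) (a w : Plane) :
    fderiv ℝ (graphMap v) a w = !₂[w 0, w 1, 2 * a 0 * deriv v (a 0 ^ 2 + a 1 ^ 2) * w 0
      + 2 * a 1 * deriv v (a 0 ^ 2 + a 1 ^ 2) * w 1] := by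
  have hd : DifferentiableAt ℝ (graphMap v) a :=
    (h.contDiff_graphMap.differentiable (by simp)) a
  have hp : ∀ k : Fin 2, HasFDerivAt (fun b : Plane => b k)
      (EuclideanSpace.proj k : Plane →L[ℝ] ℝ) a := fun k =>
    (EuclideanSpace.proj k : Plane →L[ℝ] ℝ).hasFDerivAt
  have h2 : HasFDerivAt (fun b : Plane => v (b 0 ^ 2 + b 1 ^ 2)) _ a :=
    HasFDerivAt.comp (g := fun x : ℝ × ℝ => v (x.1 ^ 2 + x.2 ^ 2)) (f := fun b : Plane => (b 0, b 1))
      a (h.hasHessianAt (a 0, a 1)).gradient.self_of_nhds ((hp 0).prodMk (hp 1))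
  ext k
  rw [fderiv_apply_coord hd]
  fin_cases k
  · simp [graphMap, (hp 0).fderiv]
  · simp [graphMap, (hp 1).fderiv]
  · simp [graphMap, h2.fderiv]

theorem isImmersionAt_graphMap (h : IsHeight z₀ δ m M Q v) (a : Plane) :
    IsImmersionAt (graphMap v) (graphNormal v a) a where
  contDiffAt := h.contDiff_graphMap.contDiffAt
  injective := fun w w' hww => by
    rw [h.fderiv_graphMap, h.fderiv_graphMap] at hww
    ext i
    fin_cases i
    · simpa using congrArg (fun x : Space => x 0) hww
    · simpa using congrArg (fun x : Space => x 1) hww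
  pos := by
    have : 0 < v (a 0 ^ 2 + a 1 ^ 2) := h.pos _ (h.mem_of_nonneg (by positivity))
    simpa [graphMap] using this
  normal := fun w => by
    rw [h.fderiv_graphMap, inner_space]
    simp [graphNormal]
    ring
  unit := by
    rw [inner_space]
    have h1 : 0 < 1 + 4 * (a 0 ^ 2 + a 1 ^ 2) * deriv v (a 0 ^ 2 + a 1 ^ 2) ^ 2 := by positivity
    have h2 := Real.sq_sqrt h1.le
    have h3 := Real.sqrt_pos.2 h1
    obtain ⟨R, hR⟩ : ∃ R, R = Real.sqrt (1 + 4 * (a 0 ^ 2 + a 1 ^ 2)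
        * deriv v (a 0 ^ 2 + a 1 ^ 2) ^ 2) := ⟨_, rfl⟩
    rw [← hR] at h2 h3
    have e0 : graphNormal v a 0 = v (a 0 ^ 2 + a 1 ^ 2) / R
        * -(2 * a 0 * deriv v (a 0 ^ 2 + a 1 ^ 2)) := by simp [graphNormal, hR]
    have e1 : graphNormal v a 1 = v (a 0 ^ 2 + a 1 ^ 2) / R
        * -(2 * a 1 * deriv v (a 0 ^ 2 + a 1 ^ 2)) := by simp [graphNormal, hR]
    have e2 : graphNormal v a 2 = v (a 0 ^ 2 + a 1 ^ 2) / R := by simp [graphNormal, hR]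
    have e3 : graphMap v a 2 = v (a 0 ^ 2 + a 1 ^ 2) := by simp [graphMap]
    rw [e0, e1, e2, e3]
    field_simp
    rw [h2]
    ring

theorem graph_equation (h : IsHeight z₀ δ m M Q v) (x y : ℝ) :
    (1 + (2 * y * deriv v (x ^ 2 + y ^ 2)) ^ 2)
        * (2 * deriv v (x ^ 2 + y ^ 2) + 4 * x ^ 2 * deriv (deriv v) (x ^ 2 + y ^ 2))
      - 2 * (2 * x * deriv v (x ^ 2 + y ^ 2)) * (2 * y * deriv v (x ^ 2 + y ^ 2))
        * (4 * x * y * deriv (deriv v) (x ^ 2 + y ^ 2))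
      + (1 + (2 * x * deriv v (x ^ 2 + y ^ 2)) ^ 2)
        * (2 * deriv v (x ^ 2 + y ^ 2) + 4 * y ^ 2 * deriv (deriv v) (x ^ 2 + y ^ 2))
      = 4 * force (v (x ^ 2 + y ^ 2)) * (1 + (2 * x * deriv v (x ^ 2 + y ^ 2)) ^ 2
        + (2 * y * deriv v (x ^ 2 + y ^ 2)) ^ 2) := by
  have h1 := h.equation (x ^ 2 + y ^ 2) (h.mem_of_nonneg (by positivity))
  linear_combination 4 * h1

theorem isHoroShrinker (h : IsHeight z₀ δ m M Q v) :
    IsHoroShrinker (M := Plane) (graphMap v) (graphNormal v) where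
  smooth := h.contDiff_graphMap.contMDiff
  pos := fun a => (h.isImmersionAt_graphMap a).pos
  immersion := fun a => by
    rw [mfderiv_eq_fderiv]
    exact (h.isImmersionAt_graphMap a).injective
  smooth_normal := h.contDiff_graphNormal.contMDiff
  normal := fun a w => by
    rw [mfderiv_eq_fderiv]
    exact div_eq_zero_iff.2 (Or.inl ((h.isImmersionAt_graphMap a).normal w))
  unit := fun a => by
    have := (h.isImmersionAt_graphMap a).pos
    rw [hypInner, (h.isImmersionAt_graphMap a).unit, div_self (by positivity)]
  equation := fun a => by
    have h1 := ((h.isImmersionAt_graphMap a).equation_iff (Eventually.of_forall fun b => ?_)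
      (h.hasHessianAt _)).2 ?_
    · exact h1
    · simp [graphMap, horizontal]
    · simpa [graphMap, horizontal] using h.graph_equation (a 0) (a 1)

end IsHeight

theorem rot_sq_add_sq (t : ℝ) (p : Space) : rot t p 0 ^ 2 + rot t p 1 ^ 2 = p 0 ^ 2 + p 1 ^ 2 := by
  simp only [rot]
  norm_num
  linear_combination (p 0 ^ 2 + p 1 ^ 2) * Real.sin_sq_add_cos_sq t

theorem rot_two (t : ℝ) (p : Space) : rot t p 2 = p 2 := by simp [rot]

theorem rot_rot_neg (t : ℝ) (p : Space) : rot t (rot (-t) p) = p := by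
  have h := Real.sin_sq_add_cos_sq t
  ext i
  fin_cases i
  · simp [rot]; linear_combination p 0 * h
  · simp [rot]; linear_combination p 1 * h
  · simp [rot]

theorem isRotationalHoroShrinker_bowl {z₀ : ℝ} (hz : 0 < z₀) :
    IsRotationalHoroShrinker (bowl z₀) := by
  obtain ⟨v, δ, m, M, Q, h⟩ := exists_isHeight hz
  refine ⟨⟨Plane, inferInstance, inferInstance, inferInstance, inferInstance, inferInstance,
    inferInstance, _, _, h.isHoroShrinker, ?_⟩, fun t => ?_⟩
  · rw [h.bowl_eq]
    ext p
    simp only [mem_range, mem_ofPred_eq]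
    constructor
    · rintro ⟨a, rfl⟩
      simp [IsHeight.graphMap]
    · intro hp
      refine ⟨!₂[p 0, p 1], ?_⟩
      ext i
      fin_cases i <;> simp [IsHeight.graphMap, hp]
  · rw [h.bowl_eq]
    have key : ∀ t p, p ∈ {p : Space | p 2 = v (p 0 ^ 2 + p 1 ^ 2)} →
        rot t p ∈ {p : Space | p 2 = v (p 0 ^ 2 + p 1 ^ 2)} := fun t p hp => by
      simp only [mem_ofPred_eq] at hp ⊢
      rw [rot_sq_add_sq, rot_two, hp]
    ext p
    constructor
    · rintro ⟨p, hp, rfl⟩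
      exact key t p hp
    · exact fun hp => ⟨rot (-t) p, key _ p hp, rot_rot_neg t p⟩

/-- An immersed horo-shrinker in its preferred chart. -/
theorem IsHoroShrinker.isImmersionAt {M : Type*} [TopologicalSpace M] [ChartedSpace Plane M]
    {Ψ N : M → Space} (h : IsHoroShrinker Ψ N) (x : M) :
    IsImmersionAt (Ψ ∘ (chartAt Plane x).symm) (N x) (chartAt Plane x x) := by
  have hm : MDifferentiableAt (𝓡 2) 𝓘(ℝ, Space) Ψ x :=
    (h.smooth x).mdifferentiableAt (by simp)
  have hc : chartAt Space (Ψ x) = OpenPartialHomeomorph.refl Space := rfl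
  have hfd : mfderiv (𝓡 2) 𝓘(ℝ, Space) Ψ x
      = fderiv ℝ (Ψ ∘ (chartAt Plane x).symm) (chartAt Plane x x) := by
    rw [hm.mfderiv]
    simp only [writtenInExtChartAt, extChartAt, hc]
    simp only [mfld_simps, fderivWithin_univ]
    rfl
  have hX : (Ψ ∘ (chartAt Plane x).symm) (chartAt Plane x x) = Ψ x := by simp
  have hp := h.pos x
  refine ⟨?_, ?_, by rw [hX]; exact hp, fun w => ?_, ?_⟩
  · have h1 := (contMDiffAt_iff.1 (h.smooth x)).2
    simp only [extChartAt, hc] at h1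
    simpa [contDiffWithinAt_univ] using h1
  · have := h.immersion x
    rwa [hfd] at this
  · have h1 := h.normal x w
    rw [hfd] at h1
    exact (div_eq_zero_iff.1 h1).resolve_right (by positivity)
  · have h1 := h.unit x
    rw [hypInner, div_eq_one_iff_eq (by positivity)] at h1
    rw [hX, h1]

end Horo

/-! ### Consequences of rotational invariance: tangency, the axis, local graphs. -/

namespace Horo

section Manifold

variable {M : Type*} [TopologicalSpace M] [ChartedSpace Plane M] {Ψ N : M → Space}

theorem comp_chartAt_symm_apply (Ψ : M → Space) (x : M) {y : M}
    (hy : y ∈ (chartAt Plane x).source) :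
    (Ψ ∘ (chartAt Plane x).symm) (chartAt Plane x y) = Ψ y := by
  simp [(chartAt Plane x).left_inv hy]

/-- Locally the image is a `C^1` image of a disc, so its Hausdorff dimension is at most `2`; a
countable cover preserves this, and `2 < 3`. -/
theorem IsHoroShrinker.dense_compl_range [SecondCountableTopology M] (h : IsHoroShrinker Ψ N) :
    Dense (range Ψ)ᶜ := by
  have hloc : ∀ x : M, ∃ U ∈ 𝓝 x, dimH (Ψ '' U) ≤ 2 := fun x => by
    obtain ⟨u, hu, hXu⟩ := (h.isImmersionAt x).contDiffAt.contDiffOn (m := 1)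
      ENat.LEInfty.out (by simp)
    obtain ⟨ε, hε, hball⟩ := Metric.mem_nhds_iff.1 hu
    have hx := mem_chart_source Plane x
    refine ⟨(chartAt Plane x).source ∩ chartAt Plane x ⁻¹' Metric.ball (chartAt Plane x x) ε,
      inter_mem (chart_source_mem_nhds Plane x) (((chartAt Plane x).continuousAt hx).preimage_mem_nhds
        (Metric.ball_mem_nhds _ hε)), ?_⟩
    have hsub : Ψ '' ((chartAt Plane x).source
        ∩ chartAt Plane x ⁻¹' Metric.ball (chartAt Plane x x) ε)
        ⊆ (Ψ ∘ (chartAt Plane x).symm) '' Metric.ball (chartAt Plane x x) ε := by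
      rintro _ ⟨y, hy, rfl⟩
      exact ⟨_, hy.2, comp_chartAt_symm_apply Ψ x hy.1⟩
    refine (dimH_mono hsub).trans (((hXu.mono hball).dimH_image_le (convex_ball _ _)
      Subset.rfl).trans ?_)
    rw [Real.dimH_of_mem_nhds (Metric.ball_mem_nhds (chartAt Plane x x) hε)]
    simp
  choose U hU hdim using hloc
  obtain ⟨s, hs, hcov⟩ := TopologicalSpace.countable_cover_nhds hU
  refine dense_compl_of_dimH_lt_finrank ?_
  rw [← image_univ, ← hcov, image_iUnion₂, dimH_bUnion hs]
  refine (iSup₂_le fun x _ => hdim x).trans_lt ?_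
  rw [finrank_euclideanSpace_fin]
  norm_num

/-- The rotated images of a parametrized surface. -/
noncomputable def sweep (X : Plane → Space) (y : ℝ × Plane) : Space := rot y.1 (X y.2)

theorem rot_zero (p : Space) : rot 0 p = p := by
  ext i; fin_cases i <;> simp [rot]

theorem contDiffAt_sweep {X : Plane → Space} {a : Plane} (hX : ContDiffAt ℝ ∞ X a) (t : ℝ) :
    ContDiffAt ℝ ∞ (sweep X) (t, a) := by
  have h : ContDiffAt ℝ ∞ (fun y : ℝ × Plane => X y.2) (t, a) :=
    ContDiffAt.comp (t, a) (g := X) (f := Prod.snd) hX contDiffAt_snd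
  rw [contDiffAt_euclidean] at h ⊢
  have h0 := h 0
  have h1 := h 1
  have h2 := h 2
  have hc : ContDiffAt ℝ ∞ (fun y : ℝ × Plane => Real.cos y.1) (t, a) := by fun_prop
  have hs : ContDiffAt ℝ ∞ (fun y : ℝ × Plane => Real.sin y.1) (t, a) := by fun_prop
  intro i
  fin_cases i
  · simpa [sweep, rot] using (h0.mul hc).sub (h1.mul hs)
  · simpa [sweep, rot] using (h0.mul hs).add (h1.mul hc)
  · simpa [sweep, rot] using h2

theorem fderiv_sweep {X : Plane → Space} {a : Plane} (hX : ContDiffAt ℝ ∞ X a) (τ : ℝ)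
    (w : Plane) : fderiv ℝ (sweep X) (0, a) (τ, w)
      = τ • !₂[-(X a 1), X a 0, 0] + fderiv ℝ X a w := by
  have hσ : HasFDerivAt (sweep X) (fderiv ℝ (sweep X) (0, a)) (0, a) :=
    ((contDiffAt_sweep hX 0).differentiableAt (by simp)).hasFDerivAt
  have h1 : fderiv ℝ (sweep X) (0, a) (0, w) = fderiv ℝ X a w := by
    have h := HasFDerivAt.comp (g := sweep X) (f := fun b : Plane => ((0 : ℝ), b)) a hσ
      (hasFDerivAt_prodMk_right 0 a)
    have e : sweep X ∘ (fun b : Plane => ((0 : ℝ), b)) = X := by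
      funext b; simp [sweep, rot_zero]
    rw [e] at h
    rw [h.fderiv]
    simp
  have h2 : fderiv ℝ (sweep X) (0, a) (1, 0) = !₂[-(X a 1), X a 0, 0] := by
    have h := HasFDerivAt.comp_hasDerivAt (l := sweep X) (f := fun t : ℝ => (t, a)) 0 hσ
      ((hasDerivAt_id 0).prodMk (hasDerivAt_const 0 a))
    have hk := fun k : Fin 3 => HasFDerivAt.comp_hasDerivAt (l := fun p : Space => p k) 0
      (EuclideanSpace.proj k : Space →L[ℝ] ℝ).hasFDerivAt h
    have hs := Real.hasDerivAt_sin 0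
    have hc := Real.hasDerivAt_cos 0
    ext i
    fin_cases i
    · refine (hk 0).unique (((hc.const_mul (X a 0)).sub (hs.const_mul (X a 1))).congr_of_eventuallyEq
        (Eventually.of_forall fun t => ?_) |>.congr_deriv ?_)
      · simp [sweep, rot]
      · simp
    · refine (hk 1).unique (((hs.const_mul (X a 0)).add (hc.const_mul (X a 1))).congr_of_eventuallyEq
        (Eventually.of_forall fun t => ?_) |>.congr_deriv ?_)
      · simp [sweep, rot]
      · simp
    · refine (hk 2).unique ((hasDerivAt_const 0 (X a 2)).congr_of_eventuallyEq
        (Eventually.of_forall fun t => ?_) |>.congr_deriv ?_)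
      · simp [sweep, rot]
      · simp
  have e : ((τ, w) : ℝ × Plane) = τ • (1, 0) + (0, w) := by simp
  rw [e, map_add, map_smul, h1, h2]

/-- A rotationally invariant horo-shrinker is everywhere tangent to the rotation field. -/
theorem IsHoroShrinker.tangent_rotation [SecondCountableTopology M] (h : IsHoroShrinker Ψ N)
    (hrot : ∀ t : ℝ, rot t '' range Ψ = range Ψ) (x : M) :
    N x 1 * Ψ x 0 = N x 0 * Ψ x 1 := by
  by_contra hne
  have hX := h.isImmersionAt x
  have hXx : (Ψ ∘ (chartAt Plane x).symm) (chartAt Plane x x) = Ψ x :=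
    comp_chartAt_symm_apply Ψ x (mem_chart_source Plane x)
  obtain ⟨X, hXdef⟩ : ∃ X, X = Ψ ∘ (chartAt Plane x).symm := ⟨_, rfl⟩
  obtain ⟨a, hadef⟩ : ∃ a, a = chartAt Plane x x := ⟨_, rfl⟩
  rw [← hXdef, ← hadef] at hX hXx
  have hσ := (contDiffAt_sweep hX.contDiffAt 0).hasStrictFDerivAt (by simp)
  -- If the rotation field is not orthogonal to the normal, it is transversal to the tangent plane,
  -- so the sweep of the surface under rotations has an invertible differential.
  have hinj : Function.Injective (fderiv ℝ (sweep X) (0, a) : ℝ × Plane →ₗ[ℝ] Space) := by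
    rw [← LinearMap.ker_eq_bot, LinearMap.ker_eq_bot']
    rintro ⟨τ, w⟩ h0
    change fderiv ℝ (sweep X) (0, a) (τ, w) = 0 at h0
    rw [fderiv_sweep hX.contDiffAt] at h0
    have h1 : inner ℝ (τ • !₂[-(X a 1), X a 0, 0] + fderiv ℝ X a w) (N x) = 0 := by
      rw [h0, inner_zero_left]
    rw [inner_add_left, hX.normal, inner_space, hXx] at h1
    have h2 : τ * (N x 1 * Ψ x 0 - N x 0 * Ψ x 1) = 0 := by
      simp at h1
      linarith
    have hτ : τ = 0 := (mul_eq_zero.1 h2).resolve_right (sub_ne_zero.2 hne)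
    rw [hτ, zero_smul, zero_add] at h0
    rw [hτ, hX.injective (a₁ := w) (a₂ := 0) (by rw [h0, map_zero])]
    rfl
  have hsurj := (LinearMap.injective_iff_surjective_of_finrank_eq_finrank (by simp)).1 hinj
  have hmap := hσ.map_nhds_eq_of_surj (LinearMap.range_eq_top.2 hsurj)
  -- The sweep is open at this point and, by invariance of the image, takes values in the image,
  -- which would thus be a neighbourhood of a point.
  have hmem : range Ψ ∈ 𝓝 (sweep X (0, a)) := by
    rw [← hmap, mem_map]
    refine univ_mem' fun y => ?_
    change rot y.1 (X y.2) ∈ range Ψ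
    rw [← hrot y.1]
    exact ⟨_, ⟨(chartAt Plane x).symm y.2, by rw [hXdef]; rfl⟩, rfl⟩
  obtain ⟨p, hp, hp'⟩ := (h.dense_compl_range.inter_nhds_nonempty hmem)
  exact hp hp'

theorem not_injective_coord (L : Plane →L[ℝ] Space) : ¬ ∀ w, L w 2 = 0 → w = 0 := by
  intro h
  obtain ⟨e₀, he₀⟩ : ∃ e₀ : Plane, e₀ = EuclideanSpace.single 0 1 := ⟨_, rfl⟩
  obtain ⟨e₁, he₁⟩ : ∃ e₁ : Plane, e₁ = EuclideanSpace.single 1 1 := ⟨_, rfl⟩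
  have h1 := h (L e₁ 2 • e₀ - L e₀ 2 • e₁) (by
    rw [map_sub, map_smul, map_smul]
    simp [mul_comm])
  have h2 := congrArg (fun w : Plane => w 1) h1
  simp [he₀, he₁] at h2
  have h3 := h e₀ (by rw [he₀]; exact h2)
  have h4 := congrArg (fun w : Plane => w 0) h3
  simp [he₀] at h4

/-- On the rotation axis the surface is horizontal. -/
theorem IsHoroShrinker.normal_of_axis (h : IsHoroShrinker Ψ N)
    (htan : ∀ x, N x 1 * Ψ x 0 = N x 0 * Ψ x 1) {x : M} (h0 : Ψ x 0 = 0) (h1 : Ψ x 1 = 0) :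
    N x 0 = 0 ∧ N x 1 = 0 := by
  have hX := h.isImmersionAt x
  have hXx : (Ψ ∘ (chartAt Plane x).symm) (chartAt Plane x x) = Ψ x :=
    comp_chartAt_symm_apply Ψ x (mem_chart_source Plane x)
  have hNx : (N ∘ (chartAt Plane x).symm) (chartAt Plane x x) = N x :=
    comp_chartAt_symm_apply N x (mem_chart_source Plane x)
  have hNd : DifferentiableAt ℝ (N ∘ (chartAt Plane x).symm) (chartAt Plane x x) := by
    have h1 := (contMDiffAt_iff.1 (h.smooth_normal x)).2
    have hc : chartAt Space (N x) = OpenPartialHomeomorph.refl Space := rfl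
    simp only [extChartAt, hc] at h1
    have h2 : ContDiffAt ℝ ∞ (N ∘ (chartAt Plane x).symm) (chartAt Plane x x) := by
      simpa [contDiffWithinAt_univ] using h1
    exact h2.differentiableAt (by simp)
  have heq : ∀ b, (N ∘ (chartAt Plane x).symm) b 1 * (Ψ ∘ (chartAt Plane x).symm) b 0
      = (N ∘ (chartAt Plane x).symm) b 0 * (Ψ ∘ (chartAt Plane x).symm) b 1 :=
    fun b => htan _
  obtain ⟨X, hXdef⟩ : ∃ X, X = Ψ ∘ (chartAt Plane x).symm := ⟨_, rfl⟩
  obtain ⟨Y, hYdef⟩ : ∃ Y, Y = N ∘ (chartAt Plane x).symm := ⟨_, rfl⟩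
  obtain ⟨a, hadef⟩ : ∃ a, a = chartAt Plane x x := ⟨_, rfl⟩
  rw [← hXdef, ← hadef] at hX hXx
  rw [← hYdef, ← hadef] at hNx hNd
  rw [← hXdef, ← hYdef] at heq
  have hXd := hX.differentiableAt.self_of_nhds
  -- Differentiating the tangency identity at an axis point: the terms with derivatives of `N` carry
  -- the factors `Ψ x 0 = Ψ x 1 = 0` and drop out.
  have hder : ∀ w, N x 1 * fderiv ℝ X a w 0 = N x 0 * fderiv ℝ X a w 1 := fun w => by
    have dY : ∀ k : Fin 3, DifferentiableAt ℝ (fun b => Y b k) a := fun k => by fun_prop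
    have dX : ∀ k : Fin 3, DifferentiableAt ℝ (fun b => X b k) a := fun k => by fun_prop
    have e1 : HasFDerivAt (fun b => Y b 1 * X b 0) _ a := (dY 1).hasFDerivAt.mul (dX 0).hasFDerivAt
    have e2 : HasFDerivAt (fun b => Y b 0 * X b 1) _ a := (dY 0).hasFDerivAt.mul (dX 1).hasFDerivAt
    rw [funext heq] at e1
    have e3 := congrArg (fun L : Plane →L[ℝ] ℝ => L w) (e1.unique e2)
    rw [fderiv_apply_coord hXd, fderiv_apply_coord hXd]
    simpa [hXx, hNx, h0, h1] using e3
  by_contra hne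
  have hm : 0 < N x 0 ^ 2 + N x 1 ^ 2 := by
    by_contra! hle
    exact hne ⟨by nlinarith [sq_nonneg (N x 0), sq_nonneg (N x 1)],
      by nlinarith [sq_nonneg (N x 0), sq_nonneg (N x 1)]⟩
  -- A tangent vector with zero height component has a horizontal part both orthogonal and parallel
  -- to `(N 0, N 1) ≠ 0`, so it vanishes. The height would then be injective on a tangent plane,
  -- which is impossible.
  refine not_injective_coord (fderiv ℝ X a) fun w hw => ?_
  have h2 := hX.normal w
  rw [inner_space, hw] at h2
  have h3 := hder w
  have e0 : (N x 0 ^ 2 + N x 1 ^ 2) * fderiv ℝ X a w 0 = 0 := by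
    linear_combination N x 0 * h2 + N x 1 * h3
  have e1 : (N x 0 ^ 2 + N x 1 ^ 2) * fderiv ℝ X a w 1 = 0 := by
    linear_combination N x 1 * h2 - N x 0 * h3
  refine hX.injective ?_
  rw [map_zero]
  ext i
  fin_cases i
  · exact (mul_eq_zero.1 e0).resolve_left hm.ne'
  · exact (mul_eq_zero.1 e1).resolve_left hm.ne'
  · exact hw

/-- Where the normal is not horizontal, the surface is locally a smooth graph. -/
theorem IsHoroShrinker.exists_local_graph (h : IsHoroShrinker Ψ N) {x : M} (hN : N x 2 ≠ 0) :
    ∃ (f : ℝ × ℝ → ℝ) (s : ℝ × ℝ → M), ContDiffAt ℝ ∞ f (horizontal (Ψ x)) ∧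
      (∀ᶠ y in 𝓝 x, Ψ y 2 = f (horizontal (Ψ y))) ∧ Tendsto s (𝓝 (horizontal (Ψ x))) (𝓝 x) ∧
      ∀ᶠ c in 𝓝 (horizontal (Ψ x)), horizontal (Ψ (s c)) = c := by
  have hX := h.isImmersionAt x
  have hxs := mem_chart_source Plane x
  have hXx : (Ψ ∘ (chartAt Plane x).symm) (chartAt Plane x x) = Ψ x :=
    comp_chartAt_symm_apply Ψ x hxs
  obtain ⟨X, hXdef⟩ : ∃ X, X = Ψ ∘ (chartAt Plane x).symm := ⟨_, rfl⟩
  obtain ⟨a, hadef⟩ : ∃ a, a = chartAt Plane x x := ⟨_, rfl⟩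
  rw [← hXdef, ← hadef] at hX hXx
  have hXd := hX.differentiableAt.self_of_nhds
  have hXk := contDiffAt_euclidean.1 hX.contDiffAt
  have hΦ : ContDiffAt ℝ ∞ (fun b => horizontal (X b)) a := (hXk 0).prodMk (hXk 1)
  have hΦd : HasFDerivAt (fun b => horizontal (X b))
      ((fderiv ℝ (fun b => X b 0) a).prod (fderiv ℝ (fun b => X b 1) a)) a :=
    (((hXk 0).differentiableAt (by simp)).hasFDerivAt).prodMk
      (((hXk 1).differentiableAt (by simp)).hasFDerivAt)
  obtain ⟨L, hL⟩ : ∃ L, L = (fderiv ℝ (fun b => X b 0) a).prod (fderiv ℝ (fun b => X b 1) a) :=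
    ⟨_, rfl⟩
  rw [← hL] at hΦd
  have hker : (L : Plane →ₗ[ℝ] ℝ × ℝ).ker = ⊥ := by
    rw [LinearMap.ker_eq_bot']
    intro w hw
    have hw' : L w = 0 := hw
    rw [hL] at hw'
    have h0 : fderiv ℝ X a w 0 = 0 := by
      rw [fderiv_apply_coord hXd]; exact congrArg Prod.fst hw'
    have h1 : fderiv ℝ X a w 1 = 0 := by
      rw [fderiv_apply_coord hXd]; exact congrArg Prod.snd hw'
    have h2 := hX.normal w
    rw [inner_space, h0, h1] at h2
    have h3 : fderiv ℝ X a w 2 = 0 := by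
      refine (mul_eq_zero.1 (?_ : fderiv ℝ X a w 2 * N x 2 = 0)).resolve_right hN
      linarith
    refine hX.injective ?_
    rw [map_zero]
    ext i
    fin_cases i
    · exact h0
    · exact h1
    · exact h3
  have hrange : (L : Plane →ₗ[ℝ] ℝ × ℝ).range = ⊤ :=
    LinearMap.range_eq_top.2 ((LinearMap.injective_iff_surjective_of_finrank_eq_finrank
      (by simp)).1 (LinearMap.ker_eq_bot.1 hker))
  obtain ⟨e, he⟩ : ∃ e : Plane ≃L[ℝ] ℝ × ℝ, (e : Plane →L[ℝ] ℝ × ℝ) = L :=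
    ⟨ContinuousLinearEquiv.ofBijective L hker hrange, by ext <;> rfl⟩
  rw [← he] at hΦd
  have hstrict : HasStrictFDerivAt (fun b => horizontal (X b)) (e : Plane →L[ℝ] ℝ × ℝ) a :=
    hΦ.hasStrictFDerivAt' hΦd (by simp)
  have hinv : ContDiffAt ℝ ∞ (hstrict.localInverse _ _ _) (horizontal (X a)) :=
    hΦ.to_localInverse hΦd (by simp)
  have hleft := hstrict.eventually_left_inverse
  have hright := hstrict.eventually_right_inverse
  have htend := hstrict.localInverse_tendsto
  have hia : hstrict.localInverse _ _ _ (horizontal (X a)) = a := hleft.self_of_nhds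
  obtain ⟨g, hg⟩ : ∃ g, g = hstrict.localInverse _ _ _ := ⟨_, rfl⟩
  rw [← hg] at hinv hleft hright htend hia
  rw [hXx] at hinv hright htend hia
  refine ⟨fun c => X (g c) 2, fun c => (chartAt Plane x).symm (g c), ?_, ?_, ?_, ?_⟩
  · have : ContDiffAt ℝ ∞ (fun b => X b 2) (g (horizontal (Ψ x))) := by rw [hia]; exact hXk 2
    exact this.comp (horizontal (Ψ x)) hinv
  · have hcont : Tendsto (chartAt Plane x) (𝓝 x) (𝓝 a) := by
      rw [hadef]; exact (chartAt Plane x).continuousAt hxs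
    filter_upwards [hcont.eventually hleft, chart_source_mem_nhds Plane x] with y hy hys
    have hXy : X (chartAt Plane x y) = Ψ y := by
      rw [hXdef]; exact comp_chartAt_symm_apply Ψ x hys
    rw [hXy] at hy
    rw [hy, hXy]
  · have h1 : Tendsto (chartAt Plane x).symm (𝓝 a) (𝓝 x) := by
      have := ((chartAt Plane x).continuousAt_symm (mem_chart_target Plane x)).tendsto
      rwa [(chartAt Plane x).left_inv hxs, ← hadef] at this
    exact h1.comp htend
  · filter_upwards [hright] with c hc
    rw [hXdef] at hc
    exact hc

end Manifold

end Horo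

/-! ### Rotationally symmetric solutions of the graph equation. -/

namespace Horo

/-- The partial derivative of `f` in the first variable. -/
noncomputable def gradFst (f : ℝ × ℝ → ℝ) (c : ℝ × ℝ) : ℝ := fderiv ℝ f c (1, 0)

/-- The partial derivative of `f` in the second variable. -/
noncomputable def gradSnd (f : ℝ × ℝ → ℝ) (c : ℝ × ℝ) : ℝ := fderiv ℝ f c (0, 1)

theorem hasFDerivAt_grad {f : ℝ × ℝ → ℝ} {c : ℝ × ℝ} (hf : DifferentiableAt ℝ f c) :
    HasFDerivAt f (gradFst f c • ContinuousLinearMap.fst ℝ ℝ ℝ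
      + gradSnd f c • ContinuousLinearMap.snd ℝ ℝ ℝ) c := by
  refine hf.hasFDerivAt.congr_fderiv ?_
  ext <;> simp [gradFst, gradSnd]

theorem hasHessianAt_of_contDiffAt {f : ℝ × ℝ → ℝ} {c : ℝ × ℝ} (hf : ContDiffAt ℝ 2 f c) :
    HasHessianAt f (gradFst f) (gradSnd f) (gradFst (gradFst f) c) (gradSnd (gradFst f) c)
      (gradSnd (gradSnd f) c) c := by
  have h1 : ContDiffAt ℝ 1 (fderiv ℝ f) c := hf.fderiv_right (m := 1) (by norm_num)
  have h1d : DifferentiableAt ℝ (fderiv ℝ f) c := h1.differentiableAt one_ne_zero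
  have hp : DifferentiableAt ℝ (gradFst f) c :=
    (h1.clm_apply contDiffAt_const).differentiableAt one_ne_zero
  have hq : DifferentiableAt ℝ (gradSnd f) c :=
    (h1.clm_apply contDiffAt_const).differentiableAt one_ne_zero
  have hsymm : gradFst (gradSnd f) c = gradSnd (gradFst f) c := by
    have hs : IsSymmSndFDerivAt ℝ f c := hf.isSymmSndFDerivAt (by
      rw [minSmoothness_of_isRCLikeNormedField])
    have e1 : ∀ u w : ℝ × ℝ, fderiv ℝ (fun x => fderiv ℝ f x u) c w
        = fderiv ℝ (fderiv ℝ f) c w u := fun u w => by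
      rw [fderiv_clm_apply h1d (by fun_prop)]
      simp
    change fderiv ℝ (fun x => fderiv ℝ f x (0, 1)) c (1, 0)
      = fderiv ℝ (fun x => fderiv ℝ f x (1, 0)) c (0, 1)
    rw [e1, e1]
    exact hs.eq _ _
  refine ⟨?_, hasFDerivAt_grad hp, ?_⟩
  · filter_upwards [(hf.of_le one_le_two).eventually (by simp)]
      with x hx using hasFDerivAt_grad (hx.differentiableAt one_ne_zero)
  · rw [← hsymm]
    exact hasFDerivAt_grad hq

/-- `f` is, near `c`, a rotationally symmetric solution of the horo-shrinker equation. -/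
structure IsRadialSolutionAt (f : ℝ × ℝ → ℝ) (c : ℝ × ℝ) : Prop where
  contDiffAt : ContDiffAt ℝ 2 f c
  pos : 0 < f c
  symmetric : ∀ᶠ x in 𝓝 c, gradSnd f x * x.1 = gradFst f x * x.2
  equation : (1 + gradSnd f c ^ 2) * gradFst (gradFst f) c
    - 2 * gradFst f c * gradSnd f c * gradSnd (gradFst f) c
    + (1 + gradFst f c ^ 2) * gradSnd (gradSnd f) c
    = 4 * force (f c) * (1 + gradFst f c ^ 2 + gradSnd f c ^ 2)

namespace IsRadialSolutionAt

variable {f : ℝ × ℝ → ℝ}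

theorem hasDerivAt_comp {f : ℝ × ℝ → ℝ} {P Q : ℝ} {γ₁ γ₂ : ℝ → ℝ} {γ₁' γ₂' t : ℝ}
    (hf : HasFDerivAt f (P • ContinuousLinearMap.fst ℝ ℝ ℝ + Q • ContinuousLinearMap.snd ℝ ℝ ℝ)
      (γ₁ t, γ₂ t)) (h₁ : HasDerivAt γ₁ γ₁' t) (h₂ : HasDerivAt γ₂ γ₂' t) :
    HasDerivAt (fun t => f (γ₁ t, γ₂ t)) (P * γ₁' + Q * γ₂') t := by
  have := HasFDerivAt.comp_hasDerivAt (l := f) (f := fun t => (γ₁ t, γ₂ t)) t hf (h₁.prodMk h₂)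
  exact this.congr_deriv (by simp)

/-- The profile equation along a ray. -/
theorem hasDerivAt_ray {e₁ e₂ ρ : ℝ} (he : e₁ ^ 2 + e₂ ^ 2 = 1)
    (h : IsRadialSolutionAt f (ρ * e₁, ρ * e₂)) :
    HasDerivAt (fun ρ => f (ρ * e₁, ρ * e₂))
      (gradFst f (ρ * e₁, ρ * e₂) * e₁ + gradSnd f (ρ * e₁, ρ * e₂) * e₂) ρ ∧
    ∃ T, HasDerivAt (fun ρ => gradFst f (ρ * e₁, ρ * e₂) * e₁ + gradSnd f (ρ * e₁, ρ * e₂) * e₂)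
      T ρ ∧ (0 < ρ → T = (1 + (gradFst f (ρ * e₁, ρ * e₂) * e₁
        + gradSnd f (ρ * e₁, ρ * e₂) * e₂) ^ 2) * (4 * force (f (ρ * e₁, ρ * e₂))
          - (gradFst f (ρ * e₁, ρ * e₂) * e₁ + gradSnd f (ρ * e₁, ρ * e₂) * e₂) / ρ)) := by
  obtain ⟨hg, hA, hC⟩ := hasHessianAt_of_contDiffAt h.contDiffAt
  have d₁ : HasDerivAt (fun ρ => ρ * e₁) e₁ ρ := by simpa using (hasDerivAt_id ρ).mul_const e₁
  have d₂ : HasDerivAt (fun ρ => ρ * e₂) e₂ ρ := by simpa using (hasDerivAt_id ρ).mul_const e₂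
  refine ⟨hasDerivAt_comp hg.self_of_nhds d₁ d₂, _,
    ((hasDerivAt_comp hA d₁ d₂).mul_const e₁).add ((hasDerivAt_comp hC d₁ d₂).mul_const e₂), ?_⟩
  intro hρ
  have hsymm := h.symmetric
  have hK : (fun x => gradSnd f x * x.1) =ᶠ[𝓝 (ρ * e₁, ρ * e₂)] fun x => gradFst f x * x.2 := hsymm
  have k1 := hC.mul (hasFDerivAt_fst (𝕜 := ℝ) (p := (ρ * e₁, ρ * e₂)))
  have k2 := hA.mul (hasFDerivAt_snd (𝕜 := ℝ) (p := (ρ * e₁, ρ * e₂)))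
  have k3 := (k2.congr_of_eventuallyEq hK).unique k1
  have s1 := congrArg (fun L : ℝ × ℝ →L[ℝ] ℝ => L (1, 0)) k3
  have s2 := congrArg (fun L : ℝ × ℝ →L[ℝ] ℝ => L (0, 1)) k3
  have s0 := hsymm.self_of_nhds
  have heq := h.equation
  simp at s0 s1 s2
  obtain ⟨P, hP⟩ : ∃ P, P = gradFst f (ρ * e₁, ρ * e₂) := ⟨_, rfl⟩
  obtain ⟨q, hq⟩ : ∃ q, q = gradSnd f (ρ * e₁, ρ * e₂) := ⟨_, rfl⟩
  obtain ⟨A, hA'⟩ : ∃ A, A = gradFst (gradFst f) (ρ * e₁, ρ * e₂) := ⟨_, rfl⟩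
  obtain ⟨B, hB'⟩ : ∃ B, B = gradSnd (gradFst f) (ρ * e₁, ρ * e₂) := ⟨_, rfl⟩
  obtain ⟨C, hC'⟩ : ∃ C, C = gradSnd (gradSnd f) (ρ * e₁, ρ * e₂) := ⟨_, rfl⟩
  rw [← hP, ← hq] at s0
  rw [← hP, ← hq, ← hA', ← hB', ← hC'] at heq
  simp only [← hP, ← hq, ← hA', ← hB', ← hC'] at s1 s2 ⊢
  obtain ⟨T, hT⟩ : ∃ T, T = P * e₁ + q * e₂ := ⟨_, rfl⟩
  have s0' : q * e₁ = P * e₂ := by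
    have : ρ * (q * e₁ - P * e₂) = 0 := by linarith
    have := (mul_eq_zero.1 this).resolve_left hρ.ne'
    linarith
  have hPT : P = T * e₁ := by rw [hT]; linear_combination (-P) * he - e₂ * s0'
  have hqT : q = T * e₂ := by rw [hT]; linear_combination (-q) * he + e₁ * s0'
  rw [← hT]
  -- The derivatives of the symmetry relation `q x = p y` determine the tangential second derivative
  -- of `f`: it is `T / ρ`, the term `u' / r` of the profile equation.
  have t1 : A * e₂ - B * e₁ = q / ρ := by
    rw [eq_div_iff hρ.ne']; linarith
  have t2 : C * e₁ - B * e₂ = P / ρ := by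
    rw [eq_div_iff hρ.ne']; linarith
  have t3 : e₂ ^ 2 * A - 2 * e₁ * e₂ * B + e₁ ^ 2 * C = T / ρ := by
    have : T / ρ = e₂ * (q / ρ) + e₁ * (P / ρ) := by rw [hT]; ring
    rw [this, ← t1, ← t2]; ring
  have t4 : T / ρ = T * (1 / ρ) := by ring
  rw [hPT, hqT] at heq
  have u : (1 + T ^ 2) * (e₂ ^ 2 * A - 2 * e₁ * e₂ * B + e₁ ^ 2 * C)
      + (e₁ ^ 2 * A + 2 * e₁ * e₂ * B + e₂ ^ 2 * C) = 4 * force (f (ρ * e₁, ρ * e₂)) * (1 + T ^ 2) := by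
    linear_combination heq + (A + C + 4 * force (f (ρ * e₁, ρ * e₂)) * T ^ 2) * he
  rw [t3] at u
  linear_combination u

end IsRadialSolutionAt

/-- Points near `r₀ e` are reached from the ray through `e` by rotations that stay near `r₀ e`. -/
theorem eventually_exists_rotation {e : ℂ} (he : ‖e‖ = 1) {r₀ η : ℝ} (hr₀ : 0 ≤ r₀) (hη : 0 < η) :
    ∀ᶠ z in 𝓝 ((r₀ : ℂ) * e), ∃ α : ℝ, z = (‖z‖ : ℂ) * e * Complex.exp (Complex.I * α) ∧
      ∀ t ∈ Icc (0 : ℝ) 1, ‖(‖z‖ : ℂ) * e * Complex.exp (Complex.I * (α * t : ℝ)) - r₀ * e‖ < η := by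
  have he0 : e ≠ 0 := by rintro rfl; simp at he
  have hz₀ : (r₀ : ℂ) * e * e⁻¹ = r₀ := by field_simp
  have hcont : Tendsto (fun z : ℂ => ‖‖z‖ - r₀‖ + r₀ * |Complex.arg (z * e⁻¹)|)
      (𝓝 ((r₀ : ℂ) * e)) (𝓝 0) := by
    have h1 : Tendsto (fun z : ℂ => ‖‖z‖ - r₀‖) (𝓝 ((r₀ : ℂ) * e)) (𝓝 0) := by
      have : Continuous fun z : ℂ => ‖‖z‖ - r₀‖ := by fun_prop
      have h := this.tendsto ((r₀ : ℂ) * e)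
      simpa [he, abs_of_nonneg hr₀] using h
    -- For `r₀ = 0` the angle is not small, but the factor `r₀` removes it; for `r₀ > 0` the
    -- argument is continuous near the positive axis.
    have h2 : Tendsto (fun z : ℂ => r₀ * |Complex.arg (z * e⁻¹)|) (𝓝 ((r₀ : ℂ) * e)) (𝓝 0) := by
      rcases hr₀.eq_or_lt with rfl | hr
      · simp
      · have h3 : ContinuousAt (fun z : ℂ => Complex.arg (z * e⁻¹)) ((r₀ : ℂ) * e) := by
          refine ContinuousAt.comp (g := Complex.arg) (f := fun z : ℂ => z * e⁻¹) ?_ (by fun_prop)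
          rw [hz₀]
          exact Complex.continuousAt_arg (by simp [hr])
        have h4 := (h3.abs.const_mul r₀).tendsto
        simp only [hz₀] at h4
        simpa [Complex.arg_ofReal_of_nonneg hr.le] using h4
    simpa using h1.add h2
  filter_upwards [hcont.eventually (gt_mem_nhds hη)] with z hz
  refine ⟨Complex.arg (z * e⁻¹), ?_, fun t ht => ?_⟩
  · have h1 := Complex.norm_mul_exp_arg_mul_I (z * e⁻¹)
    rw [norm_mul, norm_inv, he, inv_one, mul_one] at h1
    obtain ⟨α, hα⟩ : ∃ α, α = Complex.arg (z * e⁻¹) := ⟨_, rfl⟩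
    rw [← hα] at h1 ⊢
    calc z = e * (z * e⁻¹) := by field_simp
      _ = _ := by rw [← h1, mul_comm Complex.I]; ring
  · refine lt_of_le_of_lt ?_ hz
    set α := Complex.arg (z * e⁻¹)
    have e1 : (‖z‖ : ℂ) * e * Complex.exp (Complex.I * (α * t : ℝ)) - r₀ * e
        = ((‖z‖ - r₀ : ℝ) : ℂ) * (e * Complex.exp (Complex.I * (α * t : ℝ)))
          + r₀ * e * (Complex.exp (Complex.I * (α * t : ℝ)) - 1) := by
      push_cast; ring
    have h1 : ‖Complex.exp (Complex.I * (α * t : ℝ))‖ = 1 := by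
      rw [mul_comm]; exact Complex.norm_exp_ofReal_mul_I _
    rw [e1]
    refine (norm_add_le _ _).trans (add_le_add ?_ ?_)
    · rw [norm_mul, norm_mul, he, h1, Complex.norm_real]; simp
    · rw [norm_mul, norm_mul, he, mul_one, Complex.norm_real, Real.norm_of_nonneg hr₀]
      gcongr
      refine Real.norm_exp_I_mul_ofReal_sub_one_le.trans ?_
      rw [Real.norm_eq_abs, abs_mul, abs_of_nonneg ht.1]
      exact mul_le_of_le_one_right (abs_nonneg _) ht.2

end Horo

/-! ### Local uniqueness: along rays, then along arcs. -/

namespace Horo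

/-- On a ray `f` and its radial derivative solve the same first-order system as the profile. Outward
uniqueness works even from `r₀ = 0`; inward uniqueness needs `0 < ρ`, hence the alternative in the
hypothesis. -/
theorem IsHeight.eq_on_ray {z₀ δ m M Q : ℝ} {v : ℝ → ℝ} (h : IsHeight z₀ δ m M Q v)
    {f : ℝ × ℝ → ℝ} {e₁ e₂ r₀ η : ℝ} (he : e₁ ^ 2 + e₂ ^ 2 = 1) (hr₀ : 0 ≤ r₀)
    (hf : ∀ ρ, |ρ - r₀| < η → IsRadialSolutionAt f (ρ * e₁, ρ * e₂))
    (h0 : f (r₀ * e₁, r₀ * e₂) = v (r₀ ^ 2))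
    (h1 : gradFst f (r₀ * e₁, r₀ * e₂) = 2 * (r₀ * e₁) * deriv v (r₀ ^ 2))
    (h2 : gradSnd f (r₀ * e₁, r₀ * e₂) = 2 * (r₀ * e₂) * deriv v (r₀ ^ 2))
    {ρ : ℝ} (hρ : r₀ ≤ ρ ∨ 0 < ρ) (hρη : |ρ - r₀| < η) : f (ρ * e₁, ρ * e₂) = v (ρ ^ 2) := by
  have hsol : ∀ a b, 0 ≤ a → (∀ r ∈ Icc a b, |r - r₀| < η) →
      IsSolution a b (fun r => f (r * e₁, r * e₂))
        fun r => gradFst f (r * e₁, r * e₂) * e₁ + gradSnd f (r * e₁, r * e₂) * e₂ :=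
    fun a b ha hab => by
      refine ⟨fun r hr => ?_, fun r hr => ?_, fun r hr => ?_, fun r hr => ?_, fun r hr => ?_⟩
      · exact ((hf r (hab r hr)).hasDerivAt_ray he).1.continuousAt.continuousWithinAt
      · obtain ⟨-, T, hT, -⟩ := (hf r (hab r hr)).hasDerivAt_ray he
        exact hT.continuousAt.continuousWithinAt
      · exact (hf r (hab r hr)).pos
      · exact ((hf r (hab r (Ioo_subset_Icc_self hr))).hasDerivAt_ray he).1
      · obtain ⟨-, T, hT, hTr⟩ := (hf r (hab r (Ioo_subset_Icc_self hr))).hasDerivAt_ray he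
        exact hT.congr_deriv (hTr (ha.trans_lt hr.1))
  have hq : gradFst f (r₀ * e₁, r₀ * e₂) * e₁ + gradSnd f (r₀ * e₁, r₀ * e₂) * e₂
      = 2 * r₀ * deriv v (r₀ ^ 2) := by
    rw [h1, h2]; linear_combination (2 * r₀ * deriv v (r₀ ^ 2)) * he
  have habs := abs_lt.1 hρη
  rcases le_total r₀ ρ with hle | hle
  · refine (hsol r₀ ρ hr₀ fun r hr => ?_).eqOn_of_left hr₀ (h.isSolution hr₀ ρ) h0 hq ρ
      ⟨hle, le_rfl⟩
    rw [abs_lt]; constructor <;> linarith [hr.1, hr.2]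
  · rcases hρ with hρ | hρ
    · obtain rfl : ρ = r₀ := le_antisymm hle hρ
      exact h0
    · refine (hsol ρ r₀ hρ.le fun r hr => ?_).eqOn_of_right hρ (h.isSolution hρ.le r₀) h0 hq ρ
        ⟨le_rfl, hle⟩
      rw [abs_lt]; constructor <;> linarith [hr.1, hr.2]

/-- Rotationally symmetric solutions with the same data at a point agree near that point. -/
theorem IsHeight.eventually_eq {z₀ δ m M Q : ℝ} {v : ℝ → ℝ} (h : IsHeight z₀ δ m M Q v)
    {f : ℝ × ℝ → ℝ} {c₀ : ℝ × ℝ} (hf : ∀ᶠ c in 𝓝 c₀, IsRadialSolutionAt f c)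
    (h0 : f c₀ = v (c₀.1 ^ 2 + c₀.2 ^ 2))
    (h1 : gradFst f c₀ = 2 * c₀.1 * deriv v (c₀.1 ^ 2 + c₀.2 ^ 2))
    (h2 : gradSnd f c₀ = 2 * c₀.2 * deriv v (c₀.1 ^ 2 + c₀.2 ^ 2)) :
    ∀ᶠ c in 𝓝 c₀, f c = v (c.1 ^ 2 + c.2 ^ 2) := by
  obtain ⟨ζ, hζ⟩ : ∃ ζ : ℂ, ζ = ⟨c₀.1, c₀.2⟩ := ⟨_, rfl⟩
  obtain ⟨r₀, hr₀⟩ : ∃ r₀ : ℝ, r₀ = ‖ζ‖ := ⟨_, rfl⟩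
  obtain ⟨e, he, hζe⟩ : ∃ e : ℂ, ‖e‖ = 1 ∧ ζ = r₀ * e :=
    ⟨Complex.exp (Complex.arg ζ * Complex.I), Complex.norm_exp_ofReal_mul_I _, by
      rw [hr₀, Complex.norm_mul_exp_arg_mul_I]⟩
  have hr₀' : 0 ≤ r₀ := hr₀ ▸ norm_nonneg _
  have he2 : e.re ^ 2 + e.im ^ 2 = 1 := by
    have := Complex.sq_norm e
    rw [he, Complex.normSq_apply] at this
    linarith
  have hc₀ : c₀ = (r₀ * e.re, r₀ * e.im) := by
    have a1 := congrArg Complex.re hζe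
    have a2 := congrArg Complex.im hζe
    rw [hζ] at a1 a2
    ext
    · simpa using a1
    · simpa using a2
  have hs : c₀.1 ^ 2 + c₀.2 ^ 2 = r₀ ^ 2 := by
    rw [hc₀]; linear_combination r₀ ^ 2 * he2
  have hcontF : Continuous fun z : ℂ => (z.re, z.im) := by fun_prop
  have hcontG : Continuous fun c : ℝ × ℝ => (⟨c.1, c.2⟩ : ℂ) := by
    have : (fun c : ℝ × ℝ => (⟨c.1, c.2⟩ : ℂ)) = fun c => (c.1 : ℂ) + c.2 * Complex.I := by
      funext c; exact Complex.mk_eq_add_mul_I _ _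
    rw [this]; fun_prop
  have hF : Tendsto (fun z : ℂ => (z.re, z.im)) (𝓝 (r₀ * e)) (𝓝 c₀) := by
    have := hcontF.tendsto (r₀ * e)
    rw [hc₀]
    simpa using this
  have hG : Tendsto (fun c : ℝ × ℝ => (⟨c.1, c.2⟩ : ℂ)) (𝓝 c₀) (𝓝 (r₀ * e)) := by
    have := hcontG.tendsto c₀
    rwa [← hζ, hζe] at this
  obtain ⟨η, hη, hball⟩ := Metric.eventually_nhds_iff.1 (hF.eventually hf)
  have hball' : ∀ z : ℂ, ‖z - r₀ * e‖ < η → IsRadialSolutionAt f (z.re, z.im) := fun z hz =>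
    hball (by rwa [dist_eq_norm])
  have hray := fun ρ hρ hρη => h.eq_on_ray (f := f) (ρ := ρ) (η := η) he2 hr₀' (fun ρ hρ => by
    have h3 := hball' (ρ * e) (by
      rw [← sub_mul, norm_mul, he, mul_one, ← Complex.ofReal_sub, Complex.norm_real]; exact hρ)
    simpa using h3) (by rw [← hc₀, h0, hs]) (by rw [← hc₀, h1, hs, hc₀])
    (by rw [← hc₀, h2, hs, hc₀]) hρ hρη
  have hnorm : Tendsto (fun z : ℂ => ‖z‖) (𝓝 (r₀ * e)) (𝓝 r₀) := by
    have := continuous_norm.tendsto ((r₀ : ℂ) * e)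
    rwa [norm_mul, he, mul_one, Complex.norm_real, Real.norm_of_nonneg hr₀'] at this
  have hnear : ∀ᶠ z : ℂ in 𝓝 (r₀ * e), |‖z‖ - r₀| < η := by
    have : Tendsto (fun z : ℂ => |‖z‖ - r₀|) (𝓝 (r₀ * e)) (𝓝 0) := by
      simpa using (hnorm.sub_const r₀).abs
    exact this.eventually (gt_mem_nhds hη)
  have hpos : ∀ᶠ z : ℂ in 𝓝 (r₀ * e), r₀ ≤ ‖z‖ ∨ 0 < ‖z‖ := by
    rcases hr₀'.eq_or_lt with hr | hr
    · exact Eventually.of_forall fun z => Or.inl (hr ▸ norm_nonneg z)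
    · filter_upwards [hnorm.eventually (lt_mem_nhds hr)] with z hz using Or.inr hz
  have hmain : ∀ᶠ z : ℂ in 𝓝 (r₀ * e), f (z.re, z.im) = v (z.re ^ 2 + z.im ^ 2) := by
    filter_upwards [hnear, hpos, eventually_exists_rotation he hr₀' hη] with z hz1 hz2 hz3
    obtain ⟨α, hα, hpath⟩ := hz3
    have hrayz := hray ‖z‖ hz2 hz1
    have hnz : z.re ^ 2 + z.im ^ 2 = ‖z‖ ^ 2 := by
      rw [Complex.sq_norm, Complex.normSq_apply]; ring
    obtain ⟨R, hR⟩ : ∃ R : ℝ, R = ‖z‖ := ⟨_, rfl⟩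
    rw [← hR] at hα hpath hrayz hnz
    obtain ⟨x, hx⟩ : ∃ x : ℝ → ℝ, x = fun t => R * e.re * Real.cos (α * t)
      - R * e.im * Real.sin (α * t) := ⟨_, rfl⟩
    obtain ⟨y, hy⟩ : ∃ y : ℝ → ℝ, y = fun t => R * e.re * Real.sin (α * t)
      + R * e.im * Real.cos (α * t) := ⟨_, rfl⟩
    have hxy : ∀ t, (R : ℂ) * e * Complex.exp (Complex.I * (α * t : ℝ)) = ⟨x t, y t⟩ := fun t => by
      rw [mul_comm Complex.I, Complex.exp_mul_I, ← Complex.ofReal_cos, ← Complex.ofReal_sin]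
      obtain ⟨C, hC⟩ : ∃ C, C = Real.cos (α * t) := ⟨_, rfl⟩
      obtain ⟨S, hS⟩ : ∃ S, S = Real.sin (α * t) := ⟨_, rfl⟩
      simp only [hx, hy, ← hC, ← hS]
      apply Complex.ext <;> simp
    -- Along the arc the derivative of `f` is `α (x ∂_y f - y ∂_x f)`, which the symmetry relation
    -- makes zero; this transports the equality from the ray to `z`.
    have hderiv : ∀ t ∈ Icc (0 : ℝ) 1, HasDerivAt (fun t => f (x t, y t)) 0 t := fun t ht => by
      have hsol : IsRadialSolutionAt f (x t, y t) := by
        have h3 := hpath t ht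
        rw [hxy] at h3
        exact hball' _ h3
      have hsym := hsol.symmetric.self_of_nhds
      simp only at hsym
      have hlin : HasDerivAt (fun t => α * t) α t := by
        simpa using (hasDerivAt_id t).const_mul α
      have dx : HasDerivAt x (-(α * y t)) t := by
        rw [hx, hy]
        refine ((hlin.cos.const_mul (R * e.re)).sub (hlin.sin.const_mul (R * e.im))).congr_deriv ?_
        ring
      have dy : HasDerivAt y (α * x t) t := by
        rw [hx, hy]
        refine ((hlin.sin.const_mul (R * e.re)).add (hlin.cos.const_mul (R * e.im))).congr_deriv ?_
        ring
      refine (IsRadialSolutionAt.hasDerivAt_comp (hasFDerivAt_grad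
        (hsol.contDiffAt.differentiableAt (by simp))) dx dy).congr_deriv ?_
      linear_combination α * hsym
    have hconst := constant_of_has_deriv_right_zero
      (fun t ht => (hderiv t ht).continuousAt.continuousWithinAt)
      (fun t ht => (hderiv t (Ico_subset_Icc_self ht)).hasDerivWithinAt) 1 ⟨zero_le_one, le_rfl⟩
    have hz1 : z = ⟨x 1, y 1⟩ := by rw [← hxy 1, mul_one]; exact hα
    rw [hnz, ← hrayz]
    have e1 : z.re = x 1 := congrArg Complex.re hz1
    have e2 : z.im = y 1 := congrArg Complex.im hz1
    rw [e1, e2, hconst]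
    simp [hx, hy]
  filter_upwards [hG.eventually hmain] with c hc using hc

end Horo

/-! ### The open-closed argument on a connected surface. -/

namespace Horo

section Manifold

variable {M : Type*} [TopologicalSpace M] [ChartedSpace Plane M] {Ψ N : M → Space}

theorem tendsto_chartAt_symm (x : M) :
    Tendsto (chartAt Plane x).symm (𝓝 (chartAt Plane x x)) (𝓝 x) := by
  have := ((chartAt Plane x).continuousAt_symm (mem_chart_target Plane x)).tendsto
  rwa [(chartAt Plane x).left_inv (mem_chart_source Plane x)] at this

/-- The normal of a horo-shrinker that is a graph. -/
theorem IsHoroShrinker.normal_of_graph (h : IsHoroShrinker Ψ N) {x : M} {f p q : ℝ × ℝ → ℝ}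
    (hgraph : ∀ᶠ y in 𝓝 x, Ψ y 2 = f (horizontal (Ψ y)))
    (hf : ∀ᶠ c in 𝓝 (horizontal (Ψ x)), HasFDerivAt f
      (p c • ContinuousLinearMap.fst ℝ ℝ ℝ + q c • ContinuousLinearMap.snd ℝ ℝ ℝ) c) :
    N x 0 = -(p (horizontal (Ψ x)) * N x 2) ∧ N x 1 = -(q (horizontal (Ψ x)) * N x 2)
      ∧ N x 2 ≠ 0 := by
  have hX := h.isImmersionAt x
  have hXx := comp_chartAt_symm_apply Ψ x (mem_chart_source Plane x)
  have hg := (tendsto_chartAt_symm x).eventually hgraph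
  have h1 := hX.partialD_graph (f := f) (p := p) (q := q) hg (by rw [hXx]; exact hf)
  have h2 := hX.normal_of_graph h1.self_of_nhds
  rwa [hXx] at h2

/-- The differential equation of a rotational horo-shrinker that is a graph. -/
theorem IsHoroShrinker.equation_of_graph (h : IsHoroShrinker Ψ N)
    (htan : ∀ x, N x 1 * Ψ x 0 = N x 0 * Ψ x 1) {x : M} {f : ℝ × ℝ → ℝ}
    (hgraph : ∀ᶠ y in 𝓝 x, Ψ y 2 = f (horizontal (Ψ y)))
    (hf : ContDiffAt ℝ 2 f (horizontal (Ψ x))) :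
    gradSnd f (horizontal (Ψ x)) * (horizontal (Ψ x)).1
      = gradFst f (horizontal (Ψ x)) * (horizontal (Ψ x)).2 ∧
    (1 + gradSnd f (horizontal (Ψ x)) ^ 2) * gradFst (gradFst f) (horizontal (Ψ x))
      - 2 * gradFst f (horizontal (Ψ x)) * gradSnd f (horizontal (Ψ x))
        * gradSnd (gradFst f) (horizontal (Ψ x))
      + (1 + gradFst f (horizontal (Ψ x)) ^ 2) * gradSnd (gradSnd f) (horizontal (Ψ x))
      = 4 * force (Ψ x 2)
        * (1 + gradFst f (horizontal (Ψ x)) ^ 2 + gradSnd f (horizontal (Ψ x)) ^ 2) := by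
  have hess := hasHessianAt_of_contDiffAt hf
  have hX := h.isImmersionAt x
  have hXx := comp_chartAt_symm_apply Ψ x (mem_chart_source Plane x)
  have hg := (tendsto_chartAt_symm x).eventually hgraph
  constructor
  · obtain ⟨n0, n1, n2⟩ := h.normal_of_graph hgraph hess.gradient
    have ht := htan x
    rw [n0, n1] at ht
    change _ * Ψ x 0 = _ * Ψ x 1
    refine mul_right_cancel₀ n2 ?_
    linarith
  · have he := hX.equation_iff (f := f) hg (by rw [hXx]; exact hess)
    rw [hXx] at he
    refine he.1 ?_
    have := h.equation x
    rwa [meanCurvature] at this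

/-- The section `s` supplies, over each `c` near the base point, a point of the surface at which the
geometric equations hold; this turns them into equations for `f` at `c`. -/
theorem IsHoroShrinker.eventually_isRadialSolutionAt (h : IsHoroShrinker Ψ N)
    (htan : ∀ x, N x 1 * Ψ x 0 = N x 0 * Ψ x 1) {x : M} {f : ℝ × ℝ → ℝ} {s : ℝ × ℝ → M}
    (hf : ContDiffAt ℝ ∞ f (horizontal (Ψ x)))
    (hgraph : ∀ᶠ y in 𝓝 x, Ψ y 2 = f (horizontal (Ψ y)))
    (hs : Tendsto s (𝓝 (horizontal (Ψ x))) (𝓝 x))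
    (hsec : ∀ᶠ c in 𝓝 (horizontal (Ψ x)), horizontal (Ψ (s c)) = c) :
    ∀ᶠ c in 𝓝 (horizontal (Ψ x)), IsRadialSolutionAt f c := by
  have hC : ∀ᶠ c in 𝓝 (horizontal (Ψ x)), ContDiffAt ℝ 2 f c :=
    (hf.of_le ENat.LEInfty.out).eventually (by simp)
  have key := hs.eventually hgraph.eventually_nhds
  have hsymm : ∀ᶠ c in 𝓝 (horizontal (Ψ x)), gradSnd f c * c.1 = gradFst f c * c.2 := by
    filter_upwards [hC, key, hsec] with c hc hk hsc
    have := (h.equation_of_graph htan hk (by rw [hsc]; exact hc)).1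
    rwa [hsc] at this
  filter_upwards [hC, key, hsec, hsymm.eventually_nhds] with c hc hk hsc hsy
  have h2 := (h.equation_of_graph htan hk (by rw [hsc]; exact hc)).2
  have h3 := hk.self_of_nhds
  have h4 := h.pos (s c)
  rw [h3, hsc] at h4
  rw [h3, hsc] at h2
  exact ⟨hc, h4, hsy, h2⟩

theorem IsHoroShrinker.continuous (h : IsHoroShrinker Ψ N) : Continuous Ψ := h.smooth.continuous

/-- A connected rotational horo-shrinker through the axis lies in the surface generated by the
solution of the initial value problem. -/
theorem IsHoroShrinker.range_subset_bowl [SecondCountableTopology M] [ConnectedSpace M]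
    (h : IsHoroShrinker Ψ N) (hrot : ∀ t : ℝ, rot t '' range Ψ = range Ψ) {x₀ : M}
    (h0 : Ψ x₀ 0 = 0) (h1 : Ψ x₀ 1 = 0) : range Ψ ⊆ bowl (Ψ x₀ 2) := by
  have htan := h.tangent_rotation hrot
  obtain ⟨v, δ, m, K, Q, hv⟩ := exists_isHeight (h.pos x₀)
  have hΨc := h.continuous
  have hNc : Continuous N := h.smooth_normal.continuous
  have hvc : Continuous fun y => v (Ψ y 0 ^ 2 + Ψ y 1 ^ 2) := by
    have h1 := (hv.contDiff_comp (f := fun p : Space => p 0 ^ 2 + p 1 ^ 2) (by fun_prop)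
      fun p => by positivity).continuous
    exact h1.comp hΨc
  have hvc' : Continuous fun y => deriv v (Ψ y 0 ^ 2 + Ψ y 1 ^ 2) := by
    have h1 := (hv.contDiff_deriv_comp (f := fun p : Space => p 0 ^ 2 + p 1 ^ 2) (by fun_prop)
      fun p => by positivity).continuous
    exact h1.comp hΨc
  -- Both the height and the tangent plane are recorded: agreement of the full Cauchy data is what
  -- local uniqueness propagates.
  obtain ⟨C, hC⟩ : ∃ C : Set M, C = {y | Ψ y 2 = v (Ψ y 0 ^ 2 + Ψ y 1 ^ 2) ∧
      N y 0 = -(2 * Ψ y 0 * deriv v (Ψ y 0 ^ 2 + Ψ y 1 ^ 2) * N y 2) ∧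
      N y 1 = -(2 * Ψ y 1 * deriv v (Ψ y 0 ^ 2 + Ψ y 1 ^ 2) * N y 2)} := ⟨_, rfl⟩
  have hclosed : IsClosed C := by
    rw [hC]
    refine IsClosed.inter (isClosed_eq (by fun_prop) hvc)
      (IsClosed.inter (isClosed_eq (by fun_prop) ?_) (isClosed_eq (by fun_prop) ?_)) <;> fun_prop
  have hgrad : ∀ x : M, ∀ᶠ c in 𝓝 (horizontal (Ψ x)), HasFDerivAt
      (fun x : ℝ × ℝ => v (x.1 ^ 2 + x.2 ^ 2)) ((2 * c.1 * deriv v (c.1 ^ 2 + c.2 ^ 2)) •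
        ContinuousLinearMap.fst ℝ ℝ ℝ + (2 * c.2 * deriv v (c.1 ^ 2 + c.2 ^ 2)) •
        ContinuousLinearMap.snd ℝ ℝ ℝ) c := fun x => (hv.hasHessianAt _).gradient
  have hopen : IsOpen C := by
    rw [isOpen_iff_mem_nhds]
    intro x hx
    rw [hC] at hx
    obtain ⟨hx2, hx0, hx1⟩ := hx
    have hN : N x 2 ≠ 0 := fun hN => by
      have hu := (h.isImmersionAt x).unit
      rw [comp_chartAt_symm_apply Ψ x (mem_chart_source Plane x), inner_space, hx0, hx1, hN] at hu
      have := h.pos x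
      have : 0 < Ψ x 2 ^ 2 := by positivity
      simp at hu
      linarith
    -- Near `x` the surface is the graph of a radial solution `f` with the Cauchy data of the
    -- profile, so both graphs coincide nearby, and with them the normals up to the factor `N 2`.
    obtain ⟨f, s, hf, hgraph, hs, hsec⟩ := h.exists_local_graph hN
    obtain ⟨n0, n1, -⟩ := h.normal_of_graph hgraph
      (hasHessianAt_of_contDiffAt (hf.of_le ENat.LEInfty.out)).gradient
    have heq := hv.eventually_eq (h.eventually_isRadialSolutionAt htan hf hgraph hs hsec)
      (by rw [← hgraph.self_of_nhds]; exact hx2)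
      (by
        refine mul_right_cancel₀ hN ?_
        simp only [horizontal] at n0 ⊢
        linarith)
      (by
        refine mul_right_cancel₀ hN ?_
        simp only [horizontal] at n1 ⊢
        linarith)
    have hcont : Tendsto (fun y => horizontal (Ψ y)) (𝓝 x) (𝓝 (horizontal (Ψ x))) :=
      (continuous_horizontal.comp hΨc).tendsto x
    have hgraph' : ∀ᶠ y in 𝓝 x,
        Ψ y 2 = (fun c : ℝ × ℝ => v (c.1 ^ 2 + c.2 ^ 2)) (horizontal (Ψ y)) := by
      filter_upwards [hgraph, hcont.eventually heq] with y hy1 hy2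
      rw [hy1, hy2]
    filter_upwards [hgraph'.eventually_nhds] with y hy
    obtain ⟨k0, k1, -⟩ := h.normal_of_graph hy (hgrad y)
    rw [hC]
    exact ⟨hy.self_of_nhds, k0, k1⟩
  have hne : x₀ ∈ C := by
    obtain ⟨n0, n1⟩ := h.normal_of_axis htan h0 h1
    rw [hC]
    simp [h0, h1, n0, n1, hv.init]
  have huniv : C = univ := IsClopen.eq_univ ⟨hclosed, hopen⟩ ⟨x₀, hne⟩
  rw [hv.bowl_eq]
  rintro _ ⟨y, rfl⟩
  have hy : y ∈ C := huniv ▸ mem_univ y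
  rw [hC] at hy
  exact hy.1

end Manifold

theorem IsRotationalHoroShrinker.subset_bowl {S : Set Space} (hS : IsRotationalHoroShrinker S)
    {p : Space} (hp : p ∈ S) (hpa : p ∈ axis) : S ⊆ bowl (p 2) := by
  obtain ⟨⟨M, _, _, _, _, _, _, Ψ, N, h, rfl⟩, hrot⟩ := hS
  obtain ⟨x, rfl⟩ := hp
  exact h.range_subset_bowl hrot hpa.1 hpa.2.1

theorem eq_of_mem_bowl_of_mem_axis {z₀ : ℝ} (hz : 0 < z₀) {p : Space} (hp : p ∈ bowl z₀)
    (hpa : p ∈ axis) : z₀ = p 2 := by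
  have h1 : p ∈ bowl z₀ ∩ axis := ⟨hp, hpa⟩
  rw [bowl_inter_axis hz] at h1
  rw [mem_singleton_iff.1 h1]
  simp

end Horo

/-! ### The theorem. -/

theorem theoremt4 :
    -- every connected rotational horo-shrinker that meets the axis is part of exactly one `𝓑(z₀)`
    (∀ S : Set Horo.Space, Horo.IsRotationalHoroShrinker S → (S ∩ Horo.axis).Nonempty →
      ∃! z₀ : ℝ, 0 < z₀ ∧ S ⊆ Horo.bowl z₀) ∧
    -- the maximal (inextendible) ones are exactly the surfaces `𝓑(z₀)`
    {S : Set Horo.Space | Maximal Horo.IsRotationalHoroShrinker S ∧ (S ∩ Horo.axis).Nonempty}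
      = {S | ∃ z₀ : ℝ, 0 < z₀ ∧ S = Horo.bowl z₀} ∧
    -- `z₀` is the height at the axis
    (∀ z₀ : ℝ, 0 < z₀ → Horo.bowl z₀ ∩ Horo.axis = {!₂[0, 0, z₀]}) ∧
    -- entire graph, oscillation, convexity and concavity at `r = 0`
    (∀ z₀ : ℝ, 0 < z₀ → ∃ u : ℝ → ℝ,
      Horo.IsProfile z₀ (Set.Ici 0) u ∧
      Horo.bowl z₀ = {p | p 2 = u (Horo.radius p)} ∧
      (z₀ ≠ 1 → Horo.OscillatesAround u 1) ∧
      (z₀ < 1 → 0 < derivWithin (derivWithin u (Set.Ici 0)) (Set.Ici 0) 0 ∧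
        ∃ ε > 0, StrictConvexOn ℝ (Set.Ico 0 ε) u) ∧
      (1 < z₀ → derivWithin (derivWithin u (Set.Ici 0)) (Set.Ici 0) 0 < 0 ∧
        ∃ ε > 0, StrictConcaveOn ℝ (Set.Ico 0 ε) u)) ∧
    Horo.bowl 1 = Horo.horosphereOne := by
  refine ⟨fun S hS hne => ?_, ?_, fun z₀ hz => Horo.bowl_inter_axis hz, fun z₀ hz => ?_,
    Horo.bowl_one⟩
  · obtain ⟨p, hp, hpa⟩ := hne
    exact ⟨p 2, ⟨hpa.2.2, hS.subset_bowl hp hpa⟩, fun z hz =>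
      Horo.eq_of_mem_bowl_of_mem_axis hz.1 (hz.2 hp) hpa⟩
  · ext S
    constructor
    · rintro ⟨hmax, p, hp, hpa⟩
      have hsub := hmax.prop.subset_bowl hp hpa
      exact ⟨p 2, hpa.2.2, subset_antisymm hsub
        (hmax.2 (Horo.isRotationalHoroShrinker_bowl hpa.2.2) hsub)⟩
    · rintro ⟨z₀, hz, rfl⟩
      have hmem : (!₂[0, 0, z₀] : Horo.Space) ∈ Horo.bowl z₀ ∩ Horo.axis := by
        rw [Horo.bowl_inter_axis hz]; rfl
      refine ⟨⟨Horo.isRotationalHoroShrinker_bowl hz, fun S hS hsub => ?_⟩, _, hmem⟩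
      -- A larger rotational horo-shrinker still contains the axis point at height `z₀`, hence lies
      -- in the same bowl.
      have h1 := hS.subset_bowl (hsub hmem.1) hmem.2
      simpa using h1
  · obtain ⟨v, δ, m, K, Q, hv⟩ := Horo.exists_isHeight hz
    refine ⟨fun r => v (r ^ 2), hv.isProfile (uniqueDiffOn_Ici 0) self_mem_Ici, ?_,
      hv.oscillatesAround, fun h1 => ⟨?_, hv.strictConvexOn hz h1⟩,
      fun h1 => ⟨?_, hv.strictConcaveOn h1⟩⟩
    · simp only [hv.bowl_eq, Horo.radius_sq]
    · rw [hv.second_deriv_zero]; linarith [Horo.force_pos hz h1]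
    · rw [hv.second_deriv_zero]; linarith [Horo.force_neg h1]
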